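/- Let $F$ be a field of characteristic different from $2$, let $\lambda\in F\setminus\{0,1\}$, and let $E$ be the elliptic curve over $F$ given by the Legendre equation $y^2=x(x-1)(x-\lambda)$. Let $K_0=(E\times E)/\{\pm 1\}$ be the quotient of $E\times E$ by the involution $(x,y)\mapsto(-x,-y)$, and let $\widetilde K$ be the minimal desingularization of $K_0$. Let $K\subset\mathbb P^3_F$ be the quartic surface with equation $$(\lambda-1)x^2y^2-\lambda x^2z^2+y^2z^2+x^2w^2-\lambda y^2w^2+(\lambda-1)z^2w^2=0.$$ Then the singular points of $K$ (the points at which $K$ is not smooth over $F$) are exactly the four coordinate points $(1:0:0:0)$, $(0:1:0:0)$, $(0:0:1:0)$, $(0:0:0:1)$ and the eight points $(\pm1:\pm1:\pm1:\pm1)$. Each of them is an $A_1$ singularity; more precisely, the completed local ring of $K$ there is isomorphic, as an $F$-algebra, to $F[[a,b,c]]/(ab-c^2)$. Moreover, $K$ is birationally equivalent over $F$ to $K_0$ and to $\widetilde K$. -/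

import Mathlib

open CategoryTheory CategoryTheory.Limits AlgebraicGeometry

universe u

noncomputable section

namespace KummerQuartic

section Hypersurface

/-!
### Projective hypersurfaces

For a homogeneous polynomial `p`, the hypersurface `{p = 0}` is `Proj (F[X] / (p))`.
-/

variable {F : Type u} [Field F] {σ : Type} (p : MvPolynomial σ F)

/-- The homogeneous coordinate ring `F[X] / (p)`. -/
abbrev CoordRing : Type u := MvPolynomial σ F ⧸ Ideal.span {p}

/-- The grading of `F[X] / (p)` by degree. -/
def grading (n : ℕ) : Submodule F (CoordRing p) :=
  (MvPolynomial.homogeneousSubmodule σ F n).map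
    (Ideal.Quotient.mkₐ F (Ideal.span {p})).toLinearMap

lemma mk_mem_grading {n : ℕ} {a : MvPolynomial σ F} (ha : a.IsHomogeneous n) :
    Ideal.Quotient.mk (Ideal.span {p}) a ∈ grading p n :=
  ⟨a, ha, rfl⟩

instance gradedMonoid : SetLike.GradedMonoid (grading p) where
  one_mem := mk_mem_grading p (MvPolynomial.isHomogeneous_one σ F)
  mul_mem := by
    rintro i j _ _ ⟨a, ha, rfl⟩ ⟨b, hb, rfl⟩
    exact mk_mem_grading p (MvPolynomial.IsHomogeneous.mul ha hb)

/-- The decomposition of a polynomial into (classes of) homogeneous components. -/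
def decomposeAux : MvPolynomial σ F →ₐ[F] DirectSum ℕ (fun i => grading p i) :=
  MvPolynomial.aeval fun j =>
    DirectSum.of (fun i => grading p i) 1
      ⟨Ideal.Quotient.mk _ (MvPolynomial.X j), mk_mem_grading p (MvPolynomial.isHomogeneous_X F j)⟩

lemma decomposeAux_monomial (s : σ →₀ ℕ) (c : F) :
    ∃ (n : ℕ) (h : (MvPolynomial.monomial s c).IsHomogeneous n),
      decomposeAux p (MvPolynomial.monomial s c) =
        DirectSum.of (fun i => grading p i) n ⟨Ideal.Quotient.mk _ _, mk_mem_grading p h⟩ := by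
  refine MvPolynomial.induction_on_monomial (motive := fun q => ∃ (n : ℕ) (h : q.IsHomogeneous n),
    decomposeAux p q = DirectSum.of (fun i => grading p i) n
      ⟨Ideal.Quotient.mk _ q, mk_mem_grading p h⟩) ?_ ?_ s c
  · intro a
    refine ⟨0, MvPolynomial.isHomogeneous_C σ a, ?_⟩
    exact AlgHom.commutes (decomposeAux p) a
  · rintro q j ⟨n, h, e⟩
    refine ⟨n + 1, h.mul (MvPolynomial.isHomogeneous_X F j), ?_⟩
    rw [map_mul, e, decomposeAux, MvPolynomial.aeval_X, DirectSum.of_mul_of]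
    rfl

lemma decomposeAux_apply {n : ℕ} {a : MvPolynomial σ F} (ha : a.IsHomogeneous n) :
    decomposeAux p a = DirectSum.of (fun i => grading p i) n
      ⟨Ideal.Quotient.mk _ a, mk_mem_grading p ha⟩ := by
  let L : MvPolynomial.homogeneousSubmodule σ F n →ₗ[F] DirectSum ℕ (fun i => grading p i) :=
    (DirectSum.lof F ℕ (fun i => grading p i) n).comp
      (((Ideal.Quotient.mkₐ F (Ideal.span {p})).toLinearMap.comp
        (Submodule.subtype _)).codRestrict (grading p n) fun x => mk_mem_grading p x.2)
  have hmon : ∀ s ∈ a.support, (MvPolynomial.monomial s (a.coeff s)).IsHomogeneous n := by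
    intro s hs
    exact MvPolynomial.isHomogeneous_monomial _ (by
      rw [← ha (MvPolynomial.mem_support_iff.mp hs), Finsupp.degree_eq_weight_one]; rfl)
  have key : ∀ s : a.support, decomposeAux p (MvPolynomial.monomial s.1 (a.coeff s.1)) =
      L ⟨_, hmon s.1 s.2⟩ := by
    rintro ⟨s, hs⟩
    obtain ⟨m, h, e⟩ := decomposeAux_monomial p s (a.coeff s)
    have hne : MvPolynomial.monomial s (a.coeff s) ≠ 0 := by
      simpa using MvPolynomial.mem_support_iff.mp hs
    obtain rfl := h.inj_right (hmon s hs) hne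
    exact e
  have hsum : (⟨a, ha⟩ : MvPolynomial.homogeneousSubmodule σ F n) =
      ∑ s : a.support, ⟨_, hmon s.1 s.2⟩ := by
    apply Subtype.ext
    rw [AddSubmonoidClass.coe_finsetSum]
    refine (MvPolynomial.as_sum a).trans ?_
    exact (Finset.sum_coe_sort a.support
      (fun s => MvPolynomial.monomial s (a.coeff s))).symm
  change _ = L ⟨a, ha⟩
  rw [hsum, map_sum, ← Finset.sum_congr rfl fun s _ => key s]
  refine (congrArg (decomposeAux p) (MvPolynomial.as_sum a)).trans ?_
  rw [map_sum]
  exact (Finset.sum_coe_sort a.support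
    (fun s => decomposeAux p (MvPolynomial.monomial s (a.coeff s)))).symm

/-- The grading of `F[X] / (p)` for homogeneous `p`. -/
instance gradedAlgebra [hp : Fact (∃ d, p.IsHomogeneous d)] : GradedAlgebra (grading p) :=
  GradedAlgebra.ofAlgHom _
    (Ideal.Quotient.liftₐ (Ideal.span {p}) (decomposeAux p) (by
      obtain ⟨d, hd⟩ := hp.out
      intro a ha
      obtain ⟨b, rfl⟩ := Ideal.mem_span_singleton.mp ha
      have h0 : decomposeAux p p = 0 := by
        rw [decomposeAux_apply p hd]
        have : (⟨Ideal.Quotient.mk _ p, mk_mem_grading p hd⟩ : grading p d) = 0 :=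
          Subtype.ext (Ideal.Quotient.eq_zero_iff_mem.mpr (Ideal.mem_span_singleton_self p))
        rw [this, map_zero]
      rw [map_mul, h0, zero_mul]))
    (by
      apply Ideal.Quotient.algHom_ext
      apply MvPolynomial.algHom_ext
      intro j
      change DirectSum.coeAlgHom (grading p) (decomposeAux p (MvPolynomial.X j)) = _
      rw [decomposeAux, MvPolynomial.aeval_X, DirectSum.coeAlgHom_of]
      rfl)
    (by
      rintro i ⟨_, a, ha, rfl⟩
      exact decomposeAux_apply p ha)

variable [Fact (∃ d, p.IsHomogeneous d)]

/-- The hypersurface `{p = 0}` in projective space over `F`. -/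
abbrev hypersurface : Scheme.{u} := Proj (grading p)

/-- The structure morphism of the hypersurface `{p = 0}`. -/
def hypersurface.structure : hypersurface p ⟶ Spec (.of F) :=
  Proj.toSpecZero (grading p) ≫ Spec.map (CommRingCat.ofHom (algebraMap F (grading p 0)))

lemma map_structure (g : grading p →+*ᵍ grading p)
    (hg : HomogeneousIdeal.irrelevant (grading p) ≤
      (HomogeneousIdeal.irrelevant (grading p)).map g)
    (hF : ∀ a : F, g (algebraMap F (CoordRing p) a) = algebraMap F (CoordRing p) a) :
    (Proj.map g hg : hypersurface p ⟶ hypersurface p) ≫ hypersurface.structure p =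
      hypersurface.structure p := by
  have key : ∀ (i : ℕ) (hi : 0 < i) (t : CoordRing p) (ht : t ∈ grading p i),
      Proj.awayι (grading p) (g t) (g.2 ht) hi ≫ Proj.map g hg ≫ hypersurface.structure p =
        Proj.awayι (grading p) (g t) (g.2 ht) hi ≫ hypersurface.structure p := by
    intro i hi t ht
    rw [hypersurface.structure, Proj.awayι_comp_map_assoc g hg hi t ht,
      Proj.awayι_toSpecZero_assoc, Proj.awayι_toSpecZero_assoc, ← Spec.map_comp, ← Spec.map_comp,
      ← Spec.map_comp, ← CommRingCat.ofHom_comp, ← CommRingCat.ofHom_comp, ← CommRingCat.ofHom_comp]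
    congr 2
    ext a
    change Localization.mk (g (algebraMap F (CoordRing p) a))
        (⟨g 1, _⟩ : Submonoid.powers (g t)) =
      Localization.mk (algebraMap F (CoordRing p) a) (1 : Submonoid.powers (g t))
    rw [hF]
    exact congrArg _ (Subtype.ext (map_one g))
  exact (Proj.mapAffineOpenCover g hg).openCover.hom_ext _ _ fun s => key s.1 s.1.2 s.2 s.2.2

/-- The point `x` of the hypersurface `{p = 0}` is the `F`-rational point with homogeneous
coordinates `v`: all the linear forms `v i * X j - v j * X i` vanish at `x`. For `v ≠ 0` there is
at most one such `x`. -/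
def HasCoords (x : hypersurface p) (v : σ → F) : Prop :=
  ∀ i j, Ideal.Quotient.mk (Ideal.span {p})
    (MvPolynomial.C (v i) * MvPolynomial.X j - MvPolynomial.C (v j) * MvPolynomial.X i) ∈
      (show ProjectiveSpectrum (grading p) from x).asHomogeneousIdeal

end Hypersurface

section Singularities

variable {F : Type u} [Field F] {X : Scheme.{u}} (f : X ⟶ Spec (.of F))

/-- The singular points of a scheme over a field `F`: those with no open neighbourhood that is
smooth over `F`. -/
def singularLocus : Set X :=
  {x | ¬ ∃ U : X.Opens, x ∈ U ∧ Smooth (U.ι ≫ f)}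

/-- The `F`-algebra structure of the local ring of an `F`-scheme. -/
def scalarsToStalk (x : X) : F →+* X.presheaf.stalk x :=
  ((Scheme.ΓSpecIso (.of F)).inv ≫ f.appTop ≫ X.presheaf.germ ⊤ x trivial).hom

/-- The `F`-rational point `x` of `X` is an `A₁` singularity of a surface: its completed local ring
is isomorphic, as an `F`-algebra, to `F⟦a, b, c⟧ / (a b - c ^ 2)`. (This is the split form over
`F`; it implies the same statement over every extension of `F`, in particular over an algebraic
closure.) -/
def IsA1Singularity (x : X) : Prop :=
  ∃ e : AdicCompletion (IsLocalRing.maximalIdeal (X.presheaf.stalk x)) (X.presheaf.stalk x) ≃+*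
      MvPowerSeries (Fin 3) F ⧸
        Ideal.span {(MvPowerSeries.X 0 * MvPowerSeries.X 1 - MvPowerSeries.X 2 ^ 2 :
          MvPowerSeries (Fin 3) F)},
    ∀ a : F, e (algebraMap _ _ (scalarsToStalk f x a)) =
      Ideal.Quotient.mk _ (MvPowerSeries.C a)

end Singularities

section QuotientsAndResolutions

variable {X Y : Scheme.{u}}

/-- `π : X ⟶ Y` is the quotient of the scheme `X` by the group `{1, i}`, where `i` is an
involution of `X`: as a topological space `Y` is the space of orbits, and the sections of the
structure sheaf of `Y` over `U` are the invariant sections over the preimage of `U`. These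
conditions determine `π` up to a unique isomorphism. -/
structure IsQuotientByInvolution (i : X ⟶ X) (π : X ⟶ Y) : Prop where
  involutive : i ≫ i = 𝟙 X
  invariant : i ≫ π = π
  isQuotientMap : Topology.IsQuotientMap π
  orbits : ∀ x x' : X, π x = π x' → x' = x ∨ x' = i x
  app_injective : ∀ U : Y.Opens, Function.Injective (π.app U)
  mem_range_app : ∀ (U : Y.Opens) (hU : π ⁻¹ᵁ U ≤ i ⁻¹ᵁ π ⁻¹ᵁ U) (s : Γ(X, π ⁻¹ᵁ U)),
    i.appLE (π ⁻¹ᵁ U) (π ⁻¹ᵁ U) hU s = s → ∃ t : Γ(Y, U), π.app U t = s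

/-- A desingularization of `Y`: a proper birational morphism from an integral regular scheme. -/
structure IsDesingularization (ρ : X ⟶ Y) : Prop where
  integral : IsIntegral X
  regular : ∀ x : X, IsRegularLocalRing (X.presheaf.stalk x)
  proper : IsProper ρ
  birational : ∃ V : Y.Opens, Dense (V : Set Y) ∧ Dense ((ρ ⁻¹ᵁ V : X.Opens) : Set X) ∧
    IsIso (ρ ∣_ V)

/-- The minimal desingularization: every desingularization factors uniquely through it. -/
structure IsMinimalDesingularization (ρ : X ⟶ Y) : Prop extends IsDesingularization ρ where
  minimal : ∀ (Z : Scheme.{u}) (τ : Z ⟶ Y), IsDesingularization τ → ∃! h : Z ⟶ X, h ≫ ρ = τ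

end QuotientsAndResolutions

section Curve

variable {F : Type u} [Field F] (W : WeierstrassCurve F)

open MvPolynomial in
lemma isHomogeneous_weierstrass : W.toProjective.polynomial.IsHomogeneous 3 := by
  have hX : ∀ i : Fin 3, (X i : MvPolynomial (Fin 3) F).IsHomogeneous 1 := isHomogeneous_X F
  have hC : ∀ a : F, (C a : MvPolynomial (Fin 3) F).IsHomogeneous 0 := isHomogeneous_C _
  refine IsHomogeneous.sub (IsHomogeneous.add (IsHomogeneous.add ?_ ?_) ?_)
    (IsHomogeneous.add (IsHomogeneous.add (IsHomogeneous.add ?_ ?_) ?_) ?_)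
  · exact ((hX 1).pow 2).mul (hX 2)
  · exact (((hC _).mul (hX 0)).mul (hX 1)).mul (hX 2)
  · exact ((hC _).mul (hX 1)).mul ((hX 2).pow 2)
  · exact (hX 0).pow 3
  · exact ((hC _).mul ((hX 0).pow 2)).mul (hX 2)
  · exact ((hC _).mul (hX 0)).mul ((hX 2).pow 2)
  · exact (hC _).mul ((hX 2).pow 3)

instance : Fact (∃ d, W.toProjective.polynomial.IsHomogeneous d) :=
  ⟨3, isHomogeneous_weierstrass W⟩

/-- The projective plane curve over `F` with Weierstrass equation `W`. -/
abbrev curve : Scheme.{u} := hypersurface W.toProjective.polynomial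

/-- The structure morphism of the curve. -/
abbrev curve.structure : curve W ⟶ Spec (.of F) := hypersurface.structure _

/-- The images `(X, -Y - a₁ X - a₃ Z, Z)` of the coordinates under negation. -/
def negCoord : Fin 3 → MvPolynomial (Fin 3) F :=
  ![MvPolynomial.X 0,
    - MvPolynomial.X 1 - MvPolynomial.C W.a₁ * MvPolynomial.X 0 -
      MvPolynomial.C W.a₃ * MvPolynomial.X 2,
    MvPolynomial.X 2]

lemma isHomogeneous_negCoord (i : Fin 3) : (negCoord W i).IsHomogeneous 1 := by
  have hX : ∀ i : Fin 3, (MvPolynomial.X i : MvPolynomial (Fin 3) F).IsHomogeneous 1 :=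
    MvPolynomial.isHomogeneous_X F
  have hC : ∀ (a : F) (i : Fin 3),
      (MvPolynomial.C a * MvPolynomial.X i : MvPolynomial (Fin 3) F).IsHomogeneous 1 := by
    intro a i
    simpa using (MvPolynomial.isHomogeneous_C (Fin 3) a).mul (hX i)
  fin_cases i
  · exact hX 0
  · exact ((hX 1).neg.sub (hC _ _)).sub (hC _ _)
  · exact hX 2

lemma aeval_negCoord_polynomial :
    MvPolynomial.aeval (negCoord W) W.toProjective.polynomial = W.toProjective.polynomial := by
  simp only [WeierstrassCurve.Projective.polynomial, map_add, map_sub, map_mul, map_pow,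
    MvPolynomial.aeval_X, MvPolynomial.aeval_C, MvPolynomial.algebraMap_eq, negCoord]
  simp
  ring

lemma aeval_negCoord_negCoord (a : MvPolynomial (Fin 3) F) :
    MvPolynomial.aeval (negCoord W) (MvPolynomial.aeval (negCoord W) a) = a := by
  have : (MvPolynomial.aeval (negCoord W)).comp (MvPolynomial.aeval (negCoord W)) =
      AlgHom.id F (MvPolynomial (Fin 3) F) := by
    apply MvPolynomial.algHom_ext
    intro i
    fin_cases i <;> simp [negCoord, MvPolynomial.algebraMap_eq]
    ring
  exact AlgHom.congr_fun this a

/-- The automorphism of the coordinate ring of `W` given by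
`(X, Y, Z) ↦ (X, -Y - a₁ X - a₃ Z, Z)`. -/
def negRingHom : CoordRing W.toProjective.polynomial →ₐ[F] CoordRing W.toProjective.polynomial :=
  Ideal.quotientMapₐ _ (MvPolynomial.aeval (negCoord W)) (by
    rw [Ideal.span_singleton_le_iff_mem, Ideal.mem_comap, aeval_negCoord_polynomial]
    exact Ideal.mem_span_singleton_self _)

lemma negRingHom_negRingHom (a : CoordRing W.toProjective.polynomial) :
    negRingHom W (negRingHom W a) = a := by
  obtain ⟨a, rfl⟩ := Ideal.Quotient.mk_surjective a
  exact congrArg (Ideal.Quotient.mk _) (aeval_negCoord_negCoord W a)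

/-- `negRingHom` as a graded homomorphism. -/
def negGradedHom :
    grading W.toProjective.polynomial →+*ᵍ grading W.toProjective.polynomial where
  toRingHom := (negRingHom W).toRingHom
  map_mem := by
    rintro n _ ⟨a, ha, rfl⟩
    have h := MvPolynomial.IsHomogeneous.aeval ha (negCoord W) (isHomogeneous_negCoord W)
    rw [one_mul] at h
    exact mk_mem_grading _ h

lemma irrelevant_le_map_negGradedHom :
    HomogeneousIdeal.irrelevant (grading W.toProjective.polynomial) ≤
      (HomogeneousIdeal.irrelevant (grading W.toProjective.polynomial)).map (negGradedHom W) := by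
  rw [HomogeneousIdeal.irrelevant_le]
  intro i hi x hx
  rw [← negRingHom_negRingHom W x]
  refine Ideal.mem_map_of_mem (negGradedHom W) ?_
  exact HomogeneousIdeal.mem_irrelevant_of_mem _ hi ((negGradedHom W).map_mem hx)

/-- Negation on the curve `W`: `(X : Y : Z) ↦ (X : -Y - a₁ X - a₃ Z : Z)`. -/
def neg : curve W ⟶ curve W :=
  Proj.map (negGradedHom W) (irrelevant_le_map_negGradedHom W)

lemma neg_structure : neg W ≫ curve.structure W = curve.structure W :=
  map_structure _ (negGradedHom W) (irrelevant_le_map_negGradedHom W) (negRingHom W).commutes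

/-- The product `E × E` of the curve with itself over `F`. -/
abbrev square : Scheme.{u} := pullback (curve.structure W) (curve.structure W)

/-- The structure morphism of `E × E`. -/
abbrev square.structure : square W ⟶ Spec (.of F) :=
  pullback.fst _ _ ≫ curve.structure W

/-- The involution `(x, y) ↦ (-x, -y)` of `E × E`. -/
def squareNeg : square W ⟶ square W :=
  pullback.lift (pullback.fst _ _ ≫ neg W) (pullback.snd _ _ ≫ neg W)
    (by rw [Category.assoc, Category.assoc, neg_structure, pullback.condition])

end Curve

section Legendre

variable {F : Type u} [Field F] (l : F)

/-- The Legendre curve `y ^ 2 = x (x - 1) (x - l) = x ^ 3 - (1 + l) x ^ 2 + l x`. -/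
def legendre : WeierstrassCurve F where
  a₁ := 0
  a₂ := -(1 + l)
  a₃ := 0
  a₄ := l
  a₆ := 0

open MvPolynomial in
/-- The quartic form, in the coordinates `(x, y, z, w) = (X 0, X 1, X 2, X 3)`. -/
def quartic : MvPolynomial (Fin 4) F :=
  C (l - 1) * X 0 ^ 2 * X 1 ^ 2 - C l * X 0 ^ 2 * X 2 ^ 2 + X 1 ^ 2 * X 2 ^ 2
    + X 0 ^ 2 * X 3 ^ 2 - C l * X 1 ^ 2 * X 3 ^ 2 + C (l - 1) * X 2 ^ 2 * X 3 ^ 2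

open MvPolynomial in
lemma isHomogeneous_quartic : (quartic l).IsHomogeneous 4 := by
  have hX : ∀ i j : Fin 4, (X i ^ 2 * X j ^ 2 : MvPolynomial (Fin 4) F).IsHomogeneous 4 :=
    fun i j => ((isHomogeneous_X F i).pow 2).mul ((isHomogeneous_X F j).pow 2)
  have hC : ∀ (a : F) (i j : Fin 4),
      (C a * X i ^ 2 * X j ^ 2 : MvPolynomial (Fin 4) F).IsHomogeneous 4 := by
    intro a i j
    rw [mul_assoc]
    simpa using (isHomogeneous_C (Fin 4) a).mul (hX i j)
  exact ((((((hC _ _ _).sub (hC _ _ _)).add (hX _ _)).add (hX _ _)).sub (hC _ _ _)).add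
    (hC _ _ _))

instance : Fact (∃ d, (quartic l).IsHomogeneous d) := ⟨4, isHomogeneous_quartic l⟩

/-- The quartic surface `K` in `P ^ 3`. -/
abbrev quarticSurface : Scheme.{u} := hypersurface (quartic l)

/-- The structure morphism of `K`. -/
abbrev quarticSurface.structure : quarticSurface l ⟶ Spec (.of F) := hypersurface.structure _

/-- Homogeneous coordinates of the nodes: the coordinate points and `(±1 : ±1 : ±1 : ±1)`. -/
def nodes (F : Type u) [Field F] : Set (Fin 4 → F) :=
  {v | (∃ i, v = Pi.single i 1) ∨ ∀ i, v i = 1 ∨ v i = -1}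

end Legendre

end KummerQuartic

end

/-! The quartic is a quadratic form q in the squares of the coordinates (`squareForm`). The form q
is degenerate: its Gram matrix has zero row sums and rank 3, so q = 0 is a quadric cone with vertex
(1:1:1:1), and it passes through the four coordinate points because q has no diagonal terms. Thus K
is the pullback of a cone along the squaring map. The eight sign points lie over the vertex, and the
four coordinate points come from the ramification.

Singular points. Everything is computed in affine charts (`IsChart`). If some partial derivative is
a unit, a Newton step solves infinitesimal lifting problems, so the local ring is formally smooth
(`exists_lift_of_isUnit_pderiv`); the common zeros of the partial derivatives are found by linear
algebra in the squares (`critical_quarticForm`). At a node, conversely, some first order arc does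
not extend to second order (`exists_expansion_at_node`, `not_formallySmooth_of_node`).

Type of the nodes. The completed local ring of an affine hypersurface f = 0 at the origin is the
power series ring modulo f (`exists_adicCompletion_hypersurface`). Explicit formal coordinates make
f a unit multiple of ab - c^2. This works over F itself because the tangent cones contain evident
rational points (`exists_ringEquiv_sign_node`, `exists_ringEquiv_coordinate_node`).

Birationality. Both K and K₀ are compared with the double plane t^2 = f(s) f(X), where f(s) =
s(s-1)(s-l). For K₀ this is invariant theory: on the product of the affine curves, negation has
invariant ring generated by x₁, x₂ and y₁y₂ (`neg_eq_self_iff`), and a quotient by an involution is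
birational to the spectrum of the invariants of a dense stable affine open
(`birationalOver_quotient`).

For K, put w = 1 and s = (y^2 - 1)/(x^2 - 1). The lines of the cone cut K into the curves s = const,
each an intersection of two quadrics through the points (±1, ±1, ±1). Projecting from (-1, -1, -1)
turns such a curve into a plane cubic. With (z+1)/(y+1) = 1 + ρ and (z+1)/(x+1) = 1 + ρX, the cubic
is a quadratic equation for ρ over F(s, X), namely X(l-s)(X-s)ρ^2 + 2X(l-s)(1-s)ρ + (1-s)(l-sX) = 0.
Completing the square with t = X(l-s)((X-s)ρ + 1 - s) gives t^2 = f(s) f(X). The correspondence is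
one-to-one on points with values in any F-algebra, once explicit functions are inverted; so the two
localized rings are isomorphic (`exists_algEquiv`). The remaining work is to see that the opens
involved are dense. -/

noncomputable section
namespace KummerQuartic

/-! ### Affine charts of a projective hypersurface and density of basic opens -/

section Charts

variable {F : Type u} [Field F] {σ : Type} (p : MvPolynomial σ F)

/-- The class of a variable in the homogeneous coordinate ring. -/
abbrev coord (i : σ) : CoordRing p := Ideal.Quotient.mk (Ideal.span {p}) (MvPolynomial.X i)

lemma coord_mem (i : σ) : coord p i ∈ grading p 1 :=
  mk_mem_grading p (MvPolynomial.isHomogeneous_X F i)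

/-- The `F`-algebra `D`, with the family `d` of elements, is the coordinate ring of the affine
chart `X i ≠ 0` of the hypersurface `{p = 0}`. -/
structure IsChart {D : Type u} [CommRing D] [Algebra F D] (i : σ) (d : σ → D) : Prop where
  surjective : Function.Surjective (MvPolynomial.aeval (R := F) d)
  ker_le : ∀ a, MvPolynomial.aeval (R := F) d a = 0 →
    a ∈ Ideal.span {p, MvPolynomial.X i - 1}
  aeval_eq_zero : MvPolynomial.aeval (R := F) d p = 0
  coord_eq_one : d i = 1

lemma aeval_mul_of_isHomogeneous {S : Type*} [CommRing S] [Algebra F S] (u : S) (c : σ → S)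
    {n : ℕ} {a : MvPolynomial σ F} (ha : a.IsHomogeneous n) :
    MvPolynomial.aeval (fun j => u * c j) a = u ^ n * MvPolynomial.aeval c a := by
  rw [MvPolynomial.aeval_def, MvPolynomial.aeval_def, MvPolynomial.eval₂_eq,
    MvPolynomial.eval₂_eq, Finset.mul_sum]
  refine Finset.sum_congr rfl fun s hs => ?_
  have : ∑ j ∈ s.support, s j = n := by
    have := ha (MvPolynomial.mem_support_iff.mp hs)
    rwa [Pi.one_def, ← Finsupp.degree_eq_weight_one] at this
  rw [Finset.prod_congr rfl fun j _ => mul_pow u (c j) (s j), Finset.prod_mul_distrib,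
    Finset.prod_pow_eq_pow_sum, this]
  ring

lemma aeval_mk (a : MvPolynomial σ F) :
    MvPolynomial.aeval (R := F) (fun j => coord p j) a = Ideal.Quotient.mk (Ideal.span {p}) a := by
  have : MvPolynomial.aeval (R := F) (fun j => coord p j) =
      Ideal.Quotient.mkₐ F (Ideal.span {p}) := by
    apply MvPolynomial.algHom_ext; intro j; simp
  rw [this]; rfl

variable [hp : Fact (∃ d, p.IsHomogeneous d)]

open HomogeneousLocalization

/-- The map from polynomials to the degree zero localization away from `X i`. -/
def dehom (i : σ) : MvPolynomial σ F →+* Away (grading p) (coord p i) :=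
  MvPolynomial.eval₂Hom ((algebraMap (grading p 0) _).comp (algebraMap F (grading p 0)))
    fun j => Away.mk _ (coord_mem p i) 1 (coord p j) (by simpa using coord_mem p j)

lemma val_dehom (i : σ) {n : ℕ} {a : MvPolynomial σ F} (ha : a.IsHomogeneous n) :
    (dehom p i a).val = Localization.mk (Ideal.Quotient.mk (Ideal.span {p}) a)
      (⟨coord p i ^ n, n, rfl⟩ : Submonoid.powers (coord p i)) := by
  let L := Localization (Submonoid.powers (coord p i))
  let u : L := Localization.mk 1 (⟨coord p i, 1, pow_one _⟩ : Submonoid.powers (coord p i))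
  have h1 : (algebraMap (Away (grading p) (coord p i)) L).comp (dehom p i) =
      (MvPolynomial.aeval (R := F) fun j => u * algebraMap (CoordRing p) L (coord p j)).toRingHom := by
    apply MvPolynomial.ringHom_ext
    · intro r
      simp only [RingHom.comp_apply, dehom, MvPolynomial.coe_eval₂Hom, MvPolynomial.eval₂_C]
      simp [L]
      rfl
    · intro j
      simp only [RingHom.comp_apply, dehom, MvPolynomial.coe_eval₂Hom, MvPolynomial.eval₂_X]
      simp [L, u, ← Localization.mk_one_eq_algebraMap, Localization.mk_mul]
  have h2 := congr($h1 a)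
  simp only [RingHom.comp_apply] at h2
  refine h2.trans ?_
  refine (aeval_mul_of_isHomogeneous u _ ha).trans ?_
  rw [show (fun j => algebraMap (CoordRing p) L (coord p j)) =
    (algebraMap (CoordRing p) L ∘ fun j => coord p j) from rfl,
    MvPolynomial.aeval_algebraMap_apply, aeval_mk]
  rw [← Localization.mk_one_eq_algebraMap, Localization.mk_pow, Localization.mk_mul, one_pow,
    one_mul, mul_one]
  rfl

lemma dehom_eq_mk (i : σ) {n : ℕ} {a : MvPolynomial σ F} (ha : a.IsHomogeneous n) :
    dehom p i a = Away.mk _ (coord_mem p i) n (Ideal.Quotient.mk _ a)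
      (by simpa using mk_mem_grading p ha) := by
  ext; rw [val_dehom p i ha]; rfl

lemma dehom_surjective (i : σ) : Function.Surjective (dehom p i) := by
  intro x
  obtain ⟨n, a, ha, rfl⟩ := Away.mk_surjective _ (coord_mem p i) x
  obtain ⟨b, hb, rfl⟩ : a ∈ grading p n := by simpa using ha
  exact ⟨b, dehom_eq_mk p i hb⟩

variable {p}
namespace IsChart

variable {D : Type u} [CommRing D] [Algebra F D] {i : σ} {d : σ → D} (h : IsChart p i d)

/-- The map from the homogeneous coordinate ring to the coordinate ring of a chart. -/
def coordHom : CoordRing p →ₐ[F] D :=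
  Ideal.Quotient.liftₐ (Ideal.span {p}) (MvPolynomial.aeval (R := F) d) (fun a ha => by
    obtain ⟨b, rfl⟩ := Ideal.mem_span_singleton.mp ha
    rw [map_mul, h.aeval_eq_zero, zero_mul])

omit hp in
lemma coordHom_mk (a : MvPolynomial σ F) :
    h.coordHom (Ideal.Quotient.mk _ a) = MvPolynomial.aeval (R := F) d a := rfl

omit hp in
lemma isUnit_coord (y : Submonoid.powers (coord p i)) :
    IsUnit (h.coordHom.toRingHom y) := by
  obtain ⟨_, n, rfl⟩ := y
  change IsUnit (h.coordHom (coord p i ^ n))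
  rw [map_pow, coordHom_mk, MvPolynomial.aeval_X, h.coord_eq_one, one_pow]
  exact isUnit_one

/-- The comparison map from the degree zero localization to the coordinate ring of a chart. -/
def awayHom : Away (grading p) (coord p i) →+* D :=
  (IsLocalization.lift (S := Localization (Submonoid.powers (coord p i))) h.isUnit_coord).comp
    (algebraMap _ _)

lemma awayHom_dehom (a : MvPolynomial σ F) :
    h.awayHom (dehom p i a) = MvPolynomial.aeval (R := F) d a := by
  have : h.awayHom.comp (dehom p i) = (MvPolynomial.aeval (R := F) d).toRingHom := by
    apply MvPolynomial.ringHom_ext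
    · intro r
      simp only [RingHom.comp_apply, dehom, MvPolynomial.coe_eval₂Hom, MvPolynomial.eval₂_C]
      have : (algebraMap (Away (grading p) (coord p i))
          (Localization (Submonoid.powers (coord p i))))
          (algebraMap (grading p 0) _ (algebraMap F (grading p 0) r)) =
          algebraMap (CoordRing p) _ (algebraMap F _ r) := rfl
      rw [awayHom, RingHom.comp_apply, this, IsLocalization.lift_eq]
      change h.coordHom (algebraMap F _ r) = _
      simp
    · intro j
      simp only [RingHom.comp_apply, dehom, MvPolynomial.coe_eval₂Hom, MvPolynomial.eval₂_X]
      rw [awayHom, RingHom.comp_apply, HomogeneousLocalization.algebraMap_apply, Away.val_mk,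
        Localization.mk_eq_mk', IsLocalization.lift_mk'_spec]
      change h.coordHom (coord p j) = h.coordHom (coord p i ^ 1) * MvPolynomial.aeval d _
      rw [pow_one, coordHom_mk, coordHom_mk, MvPolynomial.aeval_X, MvPolynomial.aeval_X,
        h.coord_eq_one, one_mul]
  exact congr($this a)

/-- Every degree zero fraction is the dehomogenization of its numerator, so `dehom` is onto. Its
kernel contains p and X i - 1, and by `ker_le` these already generate everything that vanishes in D.
-/
lemma awayHom_bijective : Function.Bijective h.awayHom := by
  constructor
  · rw [injective_iff_map_eq_zero]
    intro x hx
    obtain ⟨a, rfl⟩ := dehom_surjective p i x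
    rw [awayHom_dehom] at hx
    have hle : Ideal.span {p, MvPolynomial.X i - 1} ≤ RingHom.ker (dehom p i) := by
      rw [Ideal.span_le]
      rintro _ (rfl | rfl)
      · obtain ⟨n, hn⟩ := hp.out
        rw [SetLike.mem_coe, RingHom.mem_ker]
        ext
        rw [val_dehom _ i hn, Ideal.Quotient.eq_zero_iff_mem.mpr (Ideal.mem_span_singleton_self _),
          Localization.mk_zero, val_zero]
      · rw [SetLike.mem_coe, RingHom.mem_ker, map_sub, map_one, sub_eq_zero]
        ext
        rw [val_dehom _ i (MvPolynomial.isHomogeneous_X F i)]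
        simp only [pow_one, val_one]
        exact Localization.mk_self (⟨coord p i, _⟩ : Submonoid.powers (coord p i))
    exact hle (h.ker_le a hx)
  · intro x
    obtain ⟨a, rfl⟩ := h.surjective x
    exact ⟨_, h.awayHom_dehom a⟩

/-- The inclusion of an affine chart into the hypersurface. -/
def chart : Spec (.of D) ⟶ hypersurface p :=
  Spec.map (CommRingCat.ofHom h.awayHom) ≫ Proj.awayι (grading p) _ (coord_mem p i) one_pos

instance : IsIso (Spec.map (CommRingCat.ofHom h.awayHom)) := by
  have : IsIso (CommRingCat.ofHom h.awayHom) :=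
    (RingEquiv.ofBijective _ h.awayHom_bijective).toCommRingCatIso.isIso_hom
  infer_instance

instance : IsOpenImmersion h.chart := by
  unfold chart; infer_instance

lemma opensRange_chart : h.chart.opensRange = Proj.basicOpen (grading p) (coord p i) := by
  exact (Scheme.Hom.opensRange_comp_of_isIso _ _).trans (Proj.opensRange_awayι _ _ _ _)

lemma chart_structure : h.chart ≫ hypersurface.structure p =
    Spec.map (CommRingCat.ofHom (algebraMap F D)) := by
  rw [chart, hypersurface.structure, Category.assoc, Proj.awayι_toSpecZero_assoc,
    ← Spec.map_comp, ← Spec.map_comp, ← CommRingCat.ofHom_comp, ← CommRingCat.ofHom_comp]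
  congr 2
  ext r
  have := h.awayHom_dehom (MvPolynomial.C r)
  rw [dehom, MvPolynomial.coe_eval₂Hom, MvPolynomial.eval₂_C, MvPolynomial.aeval_C] at this
  exact this

lemma chart_preimage_basicOpen {n : ℕ} (hn : 0 < n) {a : MvPolynomial σ F}
    (ha : a.IsHomogeneous n) :
    h.chart ⁻¹ᵁ Proj.basicOpen (grading p) (Ideal.Quotient.mk _ a) =
      PrimeSpectrum.basicOpen (MvPolynomial.aeval (R := F) d a) := by
  rw [chart, Scheme.Hom.comp_preimage, Proj.awayι_preimage_basicOpen _ (coord_mem p i) _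
    (mk_mem_grading p ha) hn]
  rw [← awayHom_dehom h, dehom_eq_mk p i ha]
  have : Away.isLocalizationElem (coord_mem p i) (mk_mem_grading p ha) =
      Away.mk _ (coord_mem p i) n (Ideal.Quotient.mk _ a)
      (by simpa using mk_mem_grading p ha) := by
    ext; simp
  rw [this]
  rfl

lemma mem_asHomogeneousIdeal_chart {n : ℕ} (hn : 0 < n) {a : MvPolynomial σ F}
    (ha : a.IsHomogeneous n) (P : Spec (.of D)) :
    Ideal.Quotient.mk _ a ∈
      (show ProjectiveSpectrum (grading p) from h.chart P).asHomogeneousIdeal ↔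
      MvPolynomial.aeval (R := F) d a ∈ (show PrimeSpectrum D from P).asIdeal := by
  have := SetLike.ext_iff.mp (h.chart_preimage_basicOpen hn ha) P
  exact not_iff_not.mp this

lemma exists_chart_eq (x : hypersurface p)
    (hx : coord p i ∉ (show ProjectiveSpectrum (grading p) from x).asHomogeneousIdeal) :
    ∃ P, h.chart P = x := by
  have : x ∈ h.chart.opensRange := by rw [opensRange_chart]; exact hx
  exact this

end IsChart

/-- A form of positive degree has no constant term, so it lies in the ideal generated by the
variables; if that ideal were contained in x, so would be the irrelevant ideal. -/
lemma exists_coord_notMem (x : hypersurface p) :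
    ∃ i, coord p i ∉ (show ProjectiveSpectrum (grading p) from x).asHomogeneousIdeal := by
  by_contra! H
  apply (show ProjectiveSpectrum (grading p) from x).not_irrelevant_le
  rw [HomogeneousIdeal.irrelevant_le]
  rintro n hn _ ⟨a, ha, rfl⟩
  suffices Ideal.Quotient.mk (Ideal.span {p}) a ∈ Ideal.span (Set.range (coord p)) by
    refine (Ideal.span_le.mpr ?_ : Ideal.span (Set.range (coord p)) ≤
      (show ProjectiveSpectrum (grading p) from x).asHomogeneousIdeal.toIdeal) this
    rintro _ ⟨i, rfl⟩
    exact H i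
  have h0 : a ∈ MvPolynomial.idealOfVars σ F := by
    rw [← pow_one (MvPolynomial.idealOfVars σ F), MvPolynomial.mem_pow_idealOfVars_iff]
    intro s hs
    have := ha (MvPolynomial.mem_support_iff.mp hs)
    rw [Pi.one_def, ← Finsupp.degree_eq_weight_one] at this
    omega
  have := Ideal.mem_map_of_mem (Ideal.Quotient.mk (Ideal.span {p})) h0
  rwa [MvPolynomial.idealOfVars, Ideal.map_span, ← Set.range_comp] at this

namespace IsChart

variable {D : Type u} [CommRing D] [Algebra F D] {i : σ} {d : σ → D} (h : IsChart p i d)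

lemma hasCoords_chart (P : Spec (.of D)) (v : σ → F) :
    HasCoords p (h.chart P) v ↔ ∀ j k, algebraMap F D (v j) * d k - algebraMap F D (v k) * d j ∈
      (show PrimeSpectrum D from P).asIdeal := by
  refine forall_congr' fun j => forall_congr' fun k => ?_
  have hC : ∀ (a : F) (j : σ), (MvPolynomial.C a * MvPolynomial.X j :
      MvPolynomial σ F).IsHomogeneous 1 := by
    intro a j
    simpa using (MvPolynomial.isHomogeneous_C σ a).mul (MvPolynomial.isHomogeneous_X F j)
  rw [h.mem_asHomogeneousIdeal_chart one_pos ((hC _ _).sub (hC _ _))]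
  simp

end IsChart

lemma basicOpen_ne_bot {n : ℕ} (hn : 0 < n) {a : CoordRing p} (ha : a ∈ grading p n)
    (h0 : ¬ IsNilpotent a) : Proj.basicOpen (grading p) a ≠ ⊥ := by
  intro h
  rw [← Proj.opensRange_awayι (grading p) a ha hn] at h
  have h2 : IsEmpty (Spec (.of (Away (grading p) a))) := by
    refine ⟨fun x => ?_⟩
    have : Proj.awayι (grading p) a ha hn x ∈ (Proj.awayι (grading p) a ha hn).opensRange :=
      ⟨x, rfl⟩
    rw [h] at this
    exact this
  have h3 : Subsingleton (Away (grading p) a) := PrimeSpectrum.isEmpty_iff_subsingleton.mp h2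
  have h4 : (1 : Localization (Submonoid.powers a)) = 0 := by
    rw [← HomogeneousLocalization.val_one (𝒜 := grading p) (x := Submonoid.powers a),
      Subsingleton.elim (1 : Away (grading p) a) 0, HomogeneousLocalization.val_zero]
  rw [← map_one (algebraMap (CoordRing p) _), IsLocalization.map_eq_zero_iff
    (Submonoid.powers a)] at h4
  obtain ⟨⟨_, m, rfl⟩, hm⟩ := h4
  exact h0 ⟨m, by simpa using hm⟩

/-- Shrink a nonempty basic open to that of a form c. Since c is not nilpotent and a is a
non-zero-divisor, c * a is not nilpotent, so its basic open is nonempty. -/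
lemma dense_basicOpen {n : ℕ} {a : CoordRing p} (ha : a ∈ grading p n)
    (h0 : a ∈ nonZeroDivisors (CoordRing p)) :
    Dense (Proj.basicOpen (grading p) a : Set (hypersurface p)) := by
  refine (ProjectiveSpectrum.isTopologicalBasis_basic_opens (grading p)).dense_iff.mpr ?_
  rintro _ ⟨b, rfl⟩ ⟨x, hx⟩
  replace hx : b ∉ (show ProjectiveSpectrum (grading p) from x).asHomogeneousIdeal := hx
  obtain ⟨i, hi⟩ := exists_coord_notMem x
  classical
  obtain ⟨m, hm⟩ : ∃ m, (DirectSum.decompose (grading p) b m : CoordRing p) ∉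
      (show ProjectiveSpectrum (grading p) from x).asHomogeneousIdeal := by
    by_contra! H
    refine hx ?_
    rw [← DirectSum.sum_support_decompose (grading p) b]
    exact Ideal.sum_mem _ fun m _ => H m
  -- The component of b may have degree zero; the extra coordinate makes the degree positive, as
  -- `basicOpen_ne_bot` requires.
  set c : CoordRing p := (DirectSum.decompose (grading p) b m : CoordRing p) * coord p i with hc
  have hcm : c ∈ grading p (m + 1) :=
    SetLike.mul_mem_graded (DirectSum.decompose (grading p) b m).2 (coord_mem p i)
  have hcx : c ∉ (show ProjectiveSpectrum (grading p) from x).asHomogeneousIdeal := fun h =>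
    ((show ProjectiveSpectrum (grading p) from x).isPrime.mem_or_mem h).elim hm hi
  have hne : ¬ IsNilpotent (c * a) := by
    rintro ⟨k, hk⟩
    rw [mul_pow] at hk
    have h2 := (mul_right_mem_nonZeroDivisors_eq_zero_iff (pow_mem h0 k)).mp hk
    refine hcx ((show ProjectiveSpectrum (grading p) from x).isPrime.mem_of_pow_mem k ?_)
    rw [h2]
    exact Ideal.zero_mem _
  have := basicOpen_ne_bot (n := (m + 1) + n) (by omega) (SetLike.mul_mem_graded hcm ha) hne
  rw [Ne, ← TopologicalSpace.Opens.coe_eq_empty, ← Ne, ← Set.nonempty_iff_ne_empty] at this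
  obtain ⟨y, hy⟩ := this
  replace hy : c * a ∉ (show ProjectiveSpectrum (grading p) from y).asHomogeneousIdeal := hy
  refine ⟨y, fun h => hy ?_, fun h => hy (Ideal.mul_mem_left _ _ h)⟩
  refine Ideal.mul_mem_right _ _ (Ideal.mul_mem_right _ _ ?_)
  exact (show ProjectiveSpectrum (grading p) from y).asHomogeneousIdeal.isHomogeneous m h

end Charts
-- Infinitesimal lifting: the Jacobian criterion and an obstruction at nodes
section Lifting

variable {F : Type u} [Field F] {σ : Type} {D : Type u} [CommRing D] [Algebra F D]
  {p : MvPolynomial σ F} {i : σ} {d : σ → D}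

namespace IsChart

variable (h : IsChart p i d) {B : Type*} [CommRing B] [Algebra F B] (c : σ → B)
  (hp : MvPolynomial.aeval (R := F) c p = 0) (hi : c i = 1)

include h hp hi in
lemma aeval_eq_zero_of_aeval_eq_zero (a : MvPolynomial σ F) (ha : MvPolynomial.aeval d a = 0) :
    MvPolynomial.aeval c a = 0 := by
  have hle : Ideal.span {p, MvPolynomial.X i - 1} ≤
      RingHom.ker (MvPolynomial.aeval (R := F) c) := by
    rw [Ideal.span_le]
    rintro _ (rfl | rfl)
    · exact hp
    · simp [hi]
  exact hle (h.ker_le a ha)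

/-- The algebra map from the coordinate ring of a chart defined by a point of the chart. -/
def lift : D →ₐ[F] B :=
  (Ideal.Quotient.liftₐ (RingHom.ker (MvPolynomial.aeval (R := F) d)) (MvPolynomial.aeval c)
    (h.aeval_eq_zero_of_aeval_eq_zero c hp hi)).comp
    (Ideal.quotientKerAlgEquivOfSurjective h.surjective).symm.toAlgHom

lemma lift_aeval (a : MvPolynomial σ F) :
    h.lift c hp hi (MvPolynomial.aeval d a) = MvPolynomial.aeval c a := by
  have : (Ideal.quotientKerAlgEquivOfSurjective h.surjective).symm (MvPolynomial.aeval d a) =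
      Ideal.Quotient.mk _ a := by
    rw [AlgEquiv.symm_apply_eq]; rfl
  exact (congrArg (Ideal.Quotient.liftₐ (RingHom.ker (MvPolynomial.aeval (R := F) d))
    (MvPolynomial.aeval c) (h.aeval_eq_zero_of_aeval_eq_zero c hp hi)) this).trans rfl

@[simp]
lemma lift_coord (j : σ) : h.lift c hp hi (d j) = c j := by
  simpa using h.lift_aeval c hp hi (MvPolynomial.X j)

include h in
lemma algHom_ext {f g : D →ₐ[F] B} (hfg : ∀ j, f (d j) = g (d j)) : f = g := by
  have : f.comp (MvPolynomial.aeval d) = g.comp (MvPolynomial.aeval d) :=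
    MvPolynomial.algHom_ext fun j => by simpa using hfg j
  ext x
  obtain ⟨a, rfl⟩ := h.surjective x
  exact congr($this a)

end IsChart

lemma aeval_add_single {B : Type*} [CommRing B] [Algebra F B] [DecidableEq σ] (b : σ → B) (j : σ)
    {e : B} (he : e ^ 2 = 0) (a : MvPolynomial σ F) :
    MvPolynomial.aeval (b + Pi.single j e) a =
      MvPolynomial.aeval b a + e * MvPolynomial.aeval b (MvPolynomial.pderiv j a) := by
  induction a using MvPolynomial.induction_on with
  | C r => simp
  | add p q hp hq => simp only [map_add, hp, hq]; ring
  | mul_X p k hp =>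
    rw [map_mul, hp, MvPolynomial.aeval_X, Derivation.leibniz, map_mul, MvPolynomial.aeval_X]
    by_cases hk : k = j
    · subst hk
      simp
      linear_combination (MvPolynomial.aeval b (MvPolynomial.pderiv k p)) * he
    · simp [Pi.single_eq_of_ne hk, MvPolynomial.pderiv_X_of_ne hk]
      ring

lemma isUnit_of_sq_zero {B C : Type*} [CommRing B] [CommRing C] {π : B →+* C}
    (hs : Function.Surjective π) (hπ : ∀ x, π x = 0 → x ^ 2 = 0) {x : B}
    (hx : IsUnit (π x)) : IsUnit x := by
  obtain ⟨y, hy⟩ := hx.exists_right_inv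
  obtain ⟨y, rfl⟩ := hs y
  have h2 := hπ (x * y - 1) (by simp [hy])
  exact IsUnit.of_mul_eq_one (y * (2 - x * y)) (by linear_combination -h2)

lemma sq_eq_zero_of_mk_eq_zero {B : Type*} [CommRing B] {I : Ideal B} (hI : I ^ 2 = ⊥) (x : B)
    (hx : Ideal.Quotient.mk I x = 0) : x ^ 2 = 0 := by
  have := Ideal.pow_mem_pow (Ideal.Quotient.eq_zero_iff_mem.mp hx) 2
  rwa [hI] at this

/-- Units lift along surjections with square-zero kernel, so a lift defined on D automatically
inverts M. Hence lifting problems for the localization can be solved on D. -/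
lemma formallySmooth_localization (M : Submonoid D)
    (H : ∀ (B C : Type u) [CommRing B] [CommRing C] [Algebra F B] [Algebra F C] (π : B →ₐ[F] C)
      (_ : Function.Surjective π) (_ : ∀ x, π x = 0 → x ^ 2 = 0)
      (φ : D →ₐ[F] C) (_ : ∀ y ∈ M, IsUnit (φ y)), ∃ g : D →ₐ[F] B, π.comp g = φ) :
    Algebra.FormallySmooth F (Localization M) := by
  refine Algebra.FormallySmooth.of_comp_surjective fun B _ _ I hI φ => ?_
  have hunit : ∀ y ∈ M, IsUnit (φ (algebraMap D _ y)) := fun y hy =>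
    (IsLocalization.map_units (Localization M) (⟨y, hy⟩ : M)).map φ
  obtain ⟨g, hg⟩ := H B (B ⧸ I) (Ideal.Quotient.mkₐ F I) Ideal.Quotient.mk_surjective
    (sq_eq_zero_of_mk_eq_zero hI) (φ.comp (IsScalarTower.toAlgHom F D _)) hunit
  have hg' : ∀ y, Ideal.Quotient.mk I (g y) = φ (algebraMap D _ y) := fun y => congr($hg y)
  have hM : ∀ y : M, IsUnit (g y) := fun y => by
    apply isUnit_of_sq_zero (π := Ideal.Quotient.mk I) Ideal.Quotient.mk_surjective
      (sq_eq_zero_of_mk_eq_zero hI)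
    rw [hg']
    exact hunit _ y.2
  refine ⟨IsLocalization.liftAlgHom (M := M) (f := g) hM, ?_⟩
  apply AlgHom.coe_ringHom_injective
  apply IsLocalization.ringHom_ext M
  ext y
  simpa using hg' y

/-- A single Newton step. Lift the coordinates arbitrarily to b, then change the j-th one by e =
-p(b) / ∂ⱼp(b). As p(b) lies in the kernel, e^2 = 0 and the first order Taylor formula
`aeval_add_single` is exact. -/
lemma IsChart.exists_lift_of_isUnit_pderiv (h : IsChart p i d) {j : σ} (hij : i ≠ j)
    {B C : Type*} [CommRing B] [CommRing C] [Algebra F B] [Algebra F C] (π : B →ₐ[F] C)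
    (hs : Function.Surjective π) (hπ : ∀ x, π x = 0 → x ^ 2 = 0) (φ : D →ₐ[F] C)
    (hu : IsUnit (φ (MvPolynomial.aeval (R := F) d (MvPolynomial.pderiv j p)))) :
    ∃ g : D →ₐ[F] B, π.comp g = φ := by
  classical
  -- The i-th coordinate is lifted to 1 on the nose; as j ≠ i, the Newton correction does not
  -- disturb this, and the result is again a point of the chart.
  have hb : ∀ k, ∃ b : B, π b = φ (d k) ∧ (k = i → b = 1) := by
    intro k
    by_cases hk : k = i
    · exact ⟨1, by simp [hk, h.coord_eq_one], fun _ => rfl⟩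
    · obtain ⟨b, hb⟩ := hs (φ (d k))
      exact ⟨b, hb, fun h => absurd h hk⟩
  choose b hb hbi using hb
  have key : ∀ a : MvPolynomial σ F, π (MvPolynomial.aeval b a) = φ (MvPolynomial.aeval d a) := by
    intro a
    rw [MvPolynomial.comp_aeval_apply, MvPolynomial.comp_aeval_apply]
    simp_rw [hb]
  have hu' : IsUnit (MvPolynomial.aeval b (MvPolynomial.pderiv j p)) := by
    apply isUnit_of_sq_zero (π := π.toRingHom) hs hπ
    exact (key _).symm ▸ hu
  obtain ⟨w, hw⟩ := hu'.exists_right_inv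
  obtain ⟨e, he⟩ : ∃ e, e = -(MvPolynomial.aeval b p * w) := ⟨_, rfl⟩
  have heI : π e = 0 := by rw [he, map_neg, map_mul, key, h.aeval_eq_zero]; simp
  have hc : MvPolynomial.aeval (R := F) (b + Pi.single (M := fun _ => B) j e) p = 0 := by
    rw [aeval_add_single b j (hπ e heI), he]
    linear_combination -MvPolynomial.aeval b p * hw
  have hi : (b + Pi.single (M := fun _ => B) j e) i = 1 := by
    rw [Pi.add_apply, hbi i rfl, Pi.single_eq_of_ne hij, add_zero]
  refine ⟨h.lift _ hc hi, h.algHom_ext fun k => ?_⟩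
  have h3 : π (Pi.single (M := fun _ => B) j e k) = 0 := by
    by_cases hk : k = j
    · subst hk; simpa using heI
    · simp [Pi.single_eq_of_ne hk]
  simp [hb, h3]

lemma IsChart.formallySmooth_of_pderiv_notMem (h : IsChart p i d) {j : σ} (hij : i ≠ j)
    (P : Ideal D) [P.IsPrime]
    (hu : MvPolynomial.aeval (R := F) d (MvPolynomial.pderiv j p) ∉ P) :
    Algebra.FormallySmooth F (Localization.AtPrime P) :=
  formallySmooth_localization _ fun _ _ _ _ _ _ π hs hπ φ hφ =>
    h.exists_lift_of_isUnit_pderiv hij π hs hπ φ (hφ _ hu)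

lemma exists_lift_of_formallySmooth_localization (M : Submonoid D)
    [Algebra.FormallySmooth F (Localization M)]
    {B C : Type*} [CommRing B] [CommRing C] [Algebra F B] [Algebra F C] (π : B →ₐ[F] C)
    (hs : Function.Surjective π) (hπ : ∀ x y, π x = 0 → π y = 0 → x * y = 0)
    (φ : D →ₐ[F] C) (hφ : ∀ y : M, IsUnit (φ y)) : ∃ g : D →ₐ[F] B, π.comp g = φ := by
  have hπ' : IsNilpotent (RingHom.ker (π : B →+* C)) :=
    ⟨2, (pow_two _).trans (le_bot_iff.mp (Ideal.mul_le.mpr fun x hx y hy => hπ x y hx hy))⟩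
  refine ⟨(Algebra.FormallySmooth.liftOfSurjective (A := Localization M)
    (IsLocalization.liftAlgHom (M := M) (f := φ) hφ) π hs hπ').comp
      (IsScalarTower.toAlgHom F D _), ?_⟩
  rw [← AlgHom.comp_assoc, Algebra.FormallySmooth.comp_liftOfSurjective]
  ext y
  simp

-- An arc with constant term v sends y to a truncated polynomial whose constant term is the value of
-- y at v. That value is nonzero when y is outside P, because D / P sees y only through its value at
-- v.
open Polynomial in
lemma IsChart.isUnit_of_notMem (h : IsChart p i d) (P : Ideal D)
    (v w : σ → F) (hv : ∀ j, d j - algebraMap F D (v j) ∈ P)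
    {A₂ : Type*} [CommRing A₂] [Algebra F A₂] (q2 : F[X] →ₐ[F] A₂)
    (hq2 : ∀ f, q2 f = 0 ↔ X ^ 2 ∣ f) (φ : D →ₐ[F] A₂)
    (hφd : ∀ j, φ (d j) = q2 (C (v j) + C (w j) * X)) (y : D) (hy : y ∉ P) : IsUnit (φ y) := by
  obtain ⟨a, rfl⟩ := h.surjective y
  have h1 : MvPolynomial.eval v a ≠ 0 := by
    intro h0
    have h2 : MvPolynomial.aeval d a - algebraMap F D (MvPolynomial.eval v a) ∈ P := by
      rw [← Ideal.Quotient.eq]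
      change Ideal.Quotient.mkₐ F P _ = Ideal.Quotient.mkₐ F P _
      rw [MvPolynomial.comp_aeval_apply, AlgHom.commutes, ← MvPolynomial.coe_aeval_eq_eval,
        RingHom.coe_coe, ← MvPolynomial.aeval_algebraMap_apply]
      congr 2
      ext j
      exact Ideal.Quotient.eq.mpr (hv j)
    rw [h0, map_zero, sub_zero] at h2
    exact hy h2
  obtain ⟨r, hr⟩ : ∃ r, MvPolynomial.aeval (fun j => C (v j) + C (w j) * X) a =
      C (MvPolynomial.eval v a) + X * r := by
    have h2 : (X : F[X]) ∣ MvPolynomial.aeval (fun j => C (v j) + C (w j) * X) a -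
        C (MvPolynomial.eval v a) := by
      rw [X_dvd_iff, coeff_zero_eq_eval_zero, eval_sub, eval_C, sub_eq_zero,
        ← coe_aeval_eq_eval, ← MvPolynomial.coe_aeval_eq_eval]
      refine (MvPolynomial.comp_aeval_apply _ (aeval (R := F) (0 : F)) _).trans ?_
      simp
    obtain ⟨r, hr⟩ := h2
    exact ⟨r, by linear_combination hr⟩
  set c := MvPolynomial.eval v a
  have h3 : φ (MvPolynomial.aeval d a) = q2 (C c + X * r) := by
    rw [← hr, MvPolynomial.comp_aeval_apply, MvPolynomial.comp_aeval_apply, ← funext hφd]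
  -- The first two terms of the geometric series for 1 / (c + X r), exact modulo X^2.
  refine IsUnit.of_mul_eq_one (q2 (C c⁻¹ - C c⁻¹ ^ 2 * X * r)) ?_
  change φ (MvPolynomial.aeval d a) * _ = 1
  rw [h3, ← map_mul, ← sub_eq_zero, ← map_one q2, ← map_sub, hq2]
  have hcc : (C c * C c⁻¹ : F[X]) = 1 := by rw [← C_mul, mul_inv_cancel₀ h1, C_1]
  exact ⟨-(C c⁻¹ ^ 2 * r ^ 2), by linear_combination (1 - C c⁻¹ * X * r) * hcc⟩

-- The arc v + wX is a point with values in F[X]/(X^2) centred at P; formal smoothness lifts it to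
-- F[X]/(X^3). The two truncated rings enter only as targets of surjections with the right kernels.
open Polynomial in
lemma IsChart.exists_dvd_of_formallySmooth (h : IsChart p i d) (P : Ideal D) [P.IsPrime]
    (v w : σ → F) (hvi : v i = 1) (hwi : w i = 0)
    (hv : ∀ j, d j - algebraMap F D (v j) ∈ P)
    (hvw : (X ^ 2 : F[X]) ∣ MvPolynomial.aeval (fun j => C (v j) + C (w j) * X) p)
    {A₂ A₃ : Type*} [CommRing A₂] [CommRing A₃] [Algebra F A₂] [Algebra F A₃]
    (q2 : F[X] →ₐ[F] A₂) (q3 : F[X] →ₐ[F] A₃) (π : A₃ →ₐ[F] A₂)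
    (hπq : ∀ f, π (q3 f) = q2 f) (hs2 : Function.Surjective q2) (hs3 : Function.Surjective q3)
    (hq2 : ∀ f, q2 f = 0 ↔ X ^ 2 ∣ f) (hq3 : ∀ f, q3 f = 0 ↔ X ^ 3 ∣ f)
    [Algebra.FormallySmooth F (Localization.AtPrime P)] :
    ∃ u : σ → F[X],
      (X ^ 3 : F[X]) ∣ MvPolynomial.aeval (fun j => C (v j) + C (w j) * X + u j * X ^ 2) p := by
  have hs : Function.Surjective π := fun x => by
    obtain ⟨f, rfl⟩ := hs2 x
    exact ⟨q3 f, hπq f⟩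
  have hnil : ∀ x y, π x = 0 → π y = 0 → x * y = 0 := by
    intro x y hx hy
    obtain ⟨x, rfl⟩ := hs3 x
    obtain ⟨y, rfl⟩ := hs3 y
    rw [hπq, hq2] at hx hy
    obtain ⟨x, rfl⟩ := hx
    obtain ⟨y, rfl⟩ := hy
    rw [← map_mul, hq3]
    exact ⟨x * y * X, by ring⟩
  have h0 : MvPolynomial.aeval (R := F) (fun j => q2 (C (v j) + C (w j) * X)) p = 0 := by
    rwa [← MvPolynomial.comp_aeval_apply, hq2]
  have h1 : q2 (C (v i) + C (w i) * X) = 1 := by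
    rw [hvi, hwi, C_0, zero_mul, add_zero, C_1, map_one]
  obtain ⟨φ, hφd⟩ : ∃ φ : D →ₐ[F] A₂, ∀ j, φ (d j) = q2 (C (v j) + C (w j) * X) :=
    ⟨_, h.lift_coord _ h0 h1⟩
  have hφ : ∀ y : P.primeCompl, IsUnit (φ y) := by
    exact fun y => h.isUnit_of_notMem P v w hv q2 hq2 φ hφd y y.2
  obtain ⟨g, hg⟩ := exists_lift_of_formallySmooth_localization P.primeCompl π hs hnil φ hφ
  have hd : ∀ j, ∃ u : F[X], g (d j) = q3 (C (v j) + C (w j) * X + u * X ^ 2) := by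
    intro j
    obtain ⟨r, hr⟩ := hs3 (g (d j))
    have h1 : q2 (r - (C (v j) + C (w j) * X)) = 0 := by
      rw [map_sub, ← hφd, ← hπq, hr, ← AlgHom.comp_apply, hg, sub_self]
    obtain ⟨u, hu⟩ := (hq2 _).mp h1
    exact ⟨u, by rw [← hr]; congr 1; linear_combination hu⟩
  choose u hu using hd
  refine ⟨u, ?_⟩
  rw [← hq3, MvPolynomial.comp_aeval_apply, ← funext hu, ← MvPolynomial.comp_aeval_apply,
    h.aeval_eq_zero, map_zero]

open Polynomial in
/-- At a smooth point, first order solutions of the equation extend to second order. -/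
lemma IsChart.not_formallySmooth_of_node (h : IsChart p i d) (P : Ideal D) [P.IsPrime]
    (v w : σ → F) (hvi : v i = 1) (hwi : w i = 0)
    (hv : ∀ j, d j - algebraMap F D (v j) ∈ P)
    (hvw : (X ^ 2 : F[X]) ∣ MvPolynomial.aeval (fun j => C (v j) + C (w j) * X) p)
    (hw : ∀ u : σ → F[X],
      ¬ (X ^ 3 : F[X]) ∣ MvPolynomial.aeval (fun j => C (v j) + C (w j) * X + u j * X ^ 2) p) :
    ¬ Algebra.FormallySmooth F (Localization.AtPrime P) := by
  intro hsm
  have hle : Ideal.span {(X ^ 3 : F[X])} ≤ Ideal.span {(X ^ 2 : F[X])} := by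
    rw [Ideal.span_singleton_le_span_singleton]; exact ⟨X, by ring⟩
  obtain ⟨u, hu⟩ := h.exists_dvd_of_formallySmooth P v w hvi hwi hv hvw
    (Ideal.Quotient.mkₐ F (Ideal.span {(X ^ 2 : F[X])}))
    (Ideal.Quotient.mkₐ F (Ideal.span {(X ^ 3 : F[X])}))
    (Ideal.Quotient.factorₐ F hle) (fun f => rfl)
    Ideal.Quotient.mk_surjective Ideal.Quotient.mk_surjective
    (fun f => Ideal.Quotient.eq_zero_iff_mem.trans Ideal.mem_span_singleton)
    (fun f => Ideal.Quotient.eq_zero_iff_mem.trans Ideal.mem_span_singleton)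
  exact hw u hu

end Lifting
-- Smooth locus of a hypersurface in terms of formal smoothness of local rings
section
variable {F : Type u} [Field F]

lemma singularLocus_eq {X : Scheme.{u}} (f : X ⟶ Spec (.of F)) [LocallyOfFinitePresentation f] :
    singularLocus f = (f.smoothLocus : Set X)ᶜ := by
  ext x
  rw [singularLocus, Set.mem_ofPred_eq, Set.mem_compl_iff, not_iff_not]
  constructor
  · rintro ⟨U, hxU, hU⟩
    have := U.ι.preimage_smoothLocus_eq f
    rw [(U.ι ≫ f).smoothLocus_eq_top] at this
    have h2 : (⟨x, hxU⟩ : U) ∈ U.ι ⁻¹ᵁ f.smoothLocus := by rw [this]; trivial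
    exact h2
  · intro hx
    refine ⟨f.smoothLocus, hx, ?_⟩
    rw [← Scheme.Hom.smoothLocus_eq_top_iff, ← Scheme.Hom.preimage_smoothLocus_eq]
    ext y
    simp

lemma exists_eq_of_notMem {D : Type u} [CommRing D] (P : Spec (.of D)) {r : D}
    (hr : r ∉ (show PrimeSpectrum D from P).asIdeal) :
    ∃ Q, Spec.map (CommRingCat.ofHom (algebraMap D (Localization.Away r))) Q = P := by
  have : (show PrimeSpectrum D from P) ∈ (PrimeSpectrum.basicOpen r : Set (PrimeSpectrum D)) := hr
  rw [← PrimeSpectrum.localization_away_comap_range (Localization.Away r)] at this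
  exact this

/-- For a finitely presented algebra, formal smoothness of the local ring at P spreads to a basic
open neighbourhood of P; conversely smoothness on a basic open passes to the local rings of its
points. -/
lemma mem_smoothLocus_Spec {D : Type u} [CommRing D] [Algebra F D]
    [Algebra.FinitePresentation F D]
    [LocallyOfFinitePresentation (Spec.map (CommRingCat.ofHom (algebraMap F D)))]
    (P : Spec (.of D)) :
    P ∈ (Spec.map (CommRingCat.ofHom (algebraMap F D))).smoothLocus ↔
      Algebra.FormallySmooth F (Localization.AtPrime (show PrimeSpectrum D from P).asIdeal) := by
  have hcomp : ∀ r : D, Spec.map (CommRingCat.ofHom (algebraMap D (Localization.Away r))) ≫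
      Spec.map (CommRingCat.ofHom (algebraMap F D)) =
      Spec.map (CommRingCat.ofHom (algebraMap F (Localization.Away r))) := fun r => by
    rw [← Spec.map_comp, ← CommRingCat.ofHom_comp, ← IsScalarTower.algebraMap_eq]
  constructor
  · intro h
    obtain ⟨_, ⟨r, rfl⟩, hrP, hr⟩ := (PrimeSpectrum.isTopologicalBasis_basic_opens
      (R := D)).exists_subset_of_mem_open h
        (Spec.map (CommRingCat.ofHom (algebraMap F D))).smoothLocus.2
    have h2 := Scheme.Hom.preimage_smoothLocus_eq
      (Spec.map (CommRingCat.ofHom (algebraMap D (Localization.Away r))))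
      (Spec.map (CommRingCat.ofHom (algebraMap F D)))
    have h3 : Spec.map (CommRingCat.ofHom (algebraMap D (Localization.Away r))) ⁻¹ᵁ
        (Spec.map (CommRingCat.ofHom (algebraMap F D))).smoothLocus = ⊤ := by
      rw [← top_le_iff]
      rintro Q -
      apply hr
      change _ ∈ (PrimeSpectrum.basicOpen r : Set (PrimeSpectrum D))
      rw [← PrimeSpectrum.localization_away_comap_range (Localization.Away r)]
      exact ⟨Q, rfl⟩
    rw [h3] at h2
    have h4 := Scheme.Hom.smoothLocus_eq_top_iff.mp h2.symm
    rw [hcomp, HasRingHomProperty.Spec_iff (P := @Smooth), CommRingCat.hom_ofHom,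
      RingHom.smooth_algebraMap] at h4
    exact Algebra.basicOpen_subset_smoothLocus_iff_smooth.mpr h4 hrP
  · intro h
    obtain ⟨r, hrP, hr⟩ := Algebra.IsSmoothAt.exists_notMem_smooth F
      (show PrimeSpectrum D from P).asIdeal
    obtain ⟨Q, rfl⟩ := exists_eq_of_notMem P hrP
    rw [← RingHom.smooth_algebraMap] at hr
    have h4 : Smooth (Spec.map (CommRingCat.ofHom (algebraMap F (Localization.Away r)))) := by
      rw [HasRingHomProperty.Spec_iff (P := @Smooth)]
      exact hr
    rw [← hcomp] at h4
    have h5 := Scheme.Hom.smoothLocus_eq_top (Spec.map (CommRingCat.ofHom (algebraMap D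
      (Localization.Away r))) ≫ Spec.map (CommRingCat.ofHom (algebraMap F D)))
    rw [← Scheme.Hom.preimage_smoothLocus_eq] at h5
    have : Q ∈ (⊤ : (Spec (.of (Localization.Away r))).Opens) := trivial
    rw [← h5] at this
    exact this

section

variable {σ : Type} {p : MvPolynomial σ F} {D : Type u} [CommRing D] [Algebra F D]
  {i : σ} {d : σ → D}

lemma IsChart.finiteType [Finite σ] (h : IsChart p i d) : Algebra.FiniteType F D :=
  Algebra.FiniteType.of_surjective (MvPolynomial.aeval (R := F) d) h.surjective

/-- The tautological coordinate ring of a chart. -/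
abbrev ChartRing (p : MvPolynomial σ F) (i : σ) : Type u :=
  MvPolynomial σ F ⧸ Ideal.span {p, MvPolynomial.X i - 1}

lemma isChart_chartRing (p : MvPolynomial σ F) (i : σ) :
    IsChart (D := ChartRing p i) p i fun j => Ideal.Quotient.mk _ (MvPolynomial.X j) := by
  have : MvPolynomial.aeval (R := F) (fun j => Ideal.Quotient.mk
      (Ideal.span {p, MvPolynomial.X i - 1}) (MvPolynomial.X j)) = Ideal.Quotient.mkₐ F _ := by
    apply MvPolynomial.algHom_ext; intro j; simp
  refine ⟨?_, ?_, ?_, ?_⟩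
  · rw [this]; exact Ideal.Quotient.mk_surjective
  · rw [this]; exact fun a => Ideal.Quotient.eq_zero_iff_mem.mp
  · rw [this]; exact Ideal.Quotient.eq_zero_iff_mem.mpr (Ideal.subset_span (by simp))
  · rw [← sub_eq_zero, ← map_one (Ideal.Quotient.mk _), ← map_sub]
    exact Ideal.Quotient.eq_zero_iff_mem.mpr (Ideal.subset_span (by simp))

variable [Finite σ] [Fact (∃ d, p.IsHomogeneous d)]

instance : LocallyOfFinitePresentation (hypersurface.structure p) := by
  have hx : ∀ x : hypersurface p, ∃ i, ∃ P, (isChart_chartRing p i).chart P = x := by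
    intro x
    obtain ⟨i, hi⟩ := exists_coord_notMem x
    exact ⟨i, (isChart_chartRing p i).exists_chart_eq x hi⟩
  have hi : ∀ i, LocallyOfFinitePresentation
      ((isChart_chartRing p i).chart ≫ hypersurface.structure p) := by
    intro i
    rw [IsChart.chart_structure, HasRingHomProperty.Spec_iff (P := @LocallyOfFinitePresentation),
      CommRingCat.hom_ofHom, RingHom.finitePresentation_algebraMap]
    have := (isChart_chartRing p i).finiteType
    exact Algebra.FinitePresentation.of_finiteType.mp this
  choose i P hP using hx
  let 𝒰 : (hypersurface p).AffineOpenCover :=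
    { I₀ := hypersurface p
      X := fun x => .of (ChartRing p (i x))
      f := fun x => (isChart_chartRing p (i x)).chart
      idx := id
      covers := fun x => ⟨P x, hP x⟩ }
  have (x : 𝒰.openCover.I₀) : IsAffine (𝒰.openCover.X x) :=
    inferInstanceAs (IsAffine (Spec (.of (ChartRing p (i x)))))
  refine HasRingHomProperty.of_source_openCover (P := @LocallyOfFinitePresentation) 𝒰.openCover
    fun x => ?_
  exact HasRingHomProperty.appTop _ _ (hi (i x))

lemma IsChart.mem_singularLocus (h : IsChart p i d) (P : Spec (.of D)) :
    h.chart P ∈ singularLocus (hypersurface.structure p) ↔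
      ¬ Algebra.FormallySmooth F (Localization.AtPrime (show PrimeSpectrum D from P).asIdeal) := by
  have := h.finiteType
  have : Algebra.FinitePresentation F D := Algebra.FinitePresentation.of_finiteType.mp this
  have h2 : LocallyOfFinitePresentation (Spec.map (CommRingCat.ofHom (algebraMap F D))) := by
    rw [← h.chart_structure]; infer_instance
  rw [singularLocus_eq, Set.mem_compl_iff, ← mem_smoothLocus_Spec, not_iff_not]
  have h3 := h.chart.preimage_smoothLocus_eq (hypersurface.structure p)
  have : P ∈ h.chart ⁻¹ᵁ (hypersurface.structure p).smoothLocus ↔ P ∈ (Spec.map (CommRingCat.ofHom (algebraMap F D))).smoothLocus := by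
    rw [h3]
    simp only [h.chart_structure]
  exact this

end
end
-- The quartic form: partial derivatives and critical points
section
variable {F : Type u} [Field F] (l : F)

/-- The quartic as a function of its arguments in an `F`-algebra. -/
def quarticForm {R : Type*} [CommRing R] (l x y z w : R) : R :=
  (l - 1) * x ^ 2 * y ^ 2 - l * x ^ 2 * z ^ 2 + y ^ 2 * z ^ 2 + x ^ 2 * w ^ 2 -
    l * y ^ 2 * w ^ 2 + (l - 1) * z ^ 2 * w ^ 2

lemma aeval_quartic {R : Type*} [CommRing R] [Algebra F R] (c : Fin 4 → R) :
    MvPolynomial.aeval c (quartic l) =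
      quarticForm (algebraMap F R l) (c 0) (c 1) (c 2) (c 3) := by
  simp [quartic, quarticForm]

lemma pderiv_quartic_zero : MvPolynomial.pderiv 0 (quartic l) = 2 * MvPolynomial.X 0 *
    (MvPolynomial.C (l - 1) * MvPolynomial.X 1 ^ 2 - MvPolynomial.C l * MvPolynomial.X 2 ^ 2 +
      MvPolynomial.X 3 ^ 2) := by
  simp [quartic, Derivation.leibniz, Derivation.leibniz_pow, MvPolynomial.pderiv_X]
  ring

lemma pderiv_quartic_one : MvPolynomial.pderiv 1 (quartic l) = 2 * MvPolynomial.X 1 *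
    (MvPolynomial.C (l - 1) * MvPolynomial.X 0 ^ 2 + MvPolynomial.X 2 ^ 2 -
      MvPolynomial.C l * MvPolynomial.X 3 ^ 2) := by
  simp [quartic, Derivation.leibniz, Derivation.leibniz_pow, MvPolynomial.pderiv_X]
  ring

lemma pderiv_quartic_two : MvPolynomial.pderiv 2 (quartic l) = 2 * MvPolynomial.X 2 *
    (-MvPolynomial.C l * MvPolynomial.X 0 ^ 2 + MvPolynomial.X 1 ^ 2 +
      MvPolynomial.C (l - 1) * MvPolynomial.X 3 ^ 2) := by
  simp [quartic, Derivation.leibniz, Derivation.leibniz_pow, MvPolynomial.pderiv_X]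
  ring

lemma pderiv_quartic_three : MvPolynomial.pderiv 3 (quartic l) = 2 * MvPolynomial.X 3 *
    (MvPolynomial.X 0 ^ 2 - MvPolynomial.C l * MvPolynomial.X 1 ^ 2 +
      MvPolynomial.C (l - 1) * MvPolynomial.X 2 ^ 2) := by
  simp [quartic, Derivation.leibniz, Derivation.leibniz_pow, MvPolynomial.pderiv_X]
  ring

end
section
variable {F : Type u} [Field F] (l : F)

/-- Each equation says that a coordinate vanishes or that a row of the Gram matrix of q annihilates
the vector of squares. That matrix has zero diagonal, off-diagonal entries 1, -l and l - 1, kernel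
spanned by (1,1,1,1), and principal 3 × 3 minors ±2l(l-1). So if all coordinates are nonzero the
squares agree, and otherwise the nonvanishing minors leave at most one nonzero coordinate. -/
lemma critical_quarticForm {K : Type*} [Field K] {l x y z w : K} (h2 : (2:K) ≠ 0) (h0 : l ≠ 0)
    (h1 : l ≠ 1) (e0 : 2 * x * ((l - 1) * y ^ 2 - l * z ^ 2 + w ^ 2) = 0)
    (e1 : 2 * y * ((l - 1) * x ^ 2 + z ^ 2 - l * w ^ 2) = 0)
    (e2 : 2 * z * (- l * x ^ 2 + y ^ 2 + (l-1) * w ^ 2) = 0)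
    (e3 : 2 * w * (x ^ 2 - l * y ^ 2 + (l-1) * z ^ 2) = 0) :
    (y = 0 ∧ z = 0 ∧ w = 0) ∨ (x = 0 ∧ z = 0 ∧ w = 0) ∨ (x = 0 ∧ y = 0 ∧ w = 0) ∨
      (x = 0 ∧ y = 0 ∧ z = 0) ∨ (y ^ 2 = x ^ 2 ∧ z ^ 2 = x ^ 2 ∧ w ^ 2 = x ^ 2) := by
  have h1' : l - 1 ≠ 0 := sub_ne_zero.mpr h1
  simp only [mul_eq_zero, h2, false_or] at e0 e1 e2 e3
  by_cases hx : x = 0 <;> by_cases hy : y = 0 <;> by_cases hz : z = 0 <;> by_cases hw : w = 0 <;>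
    simp only [hx, hy, hz, hw, false_or, true_or] at * <;> grind

lemma critical_quartic {K : Type*} [Field K] [Algebra F K] (hF : (2 : F) ≠ 0) (h0 : l ≠ 0)
    (h1 : l ≠ 1) (c : Fin 4 → K) (hc : ∀ j, MvPolynomial.aeval c (MvPolynomial.pderiv j (quartic l)) = 0)
    {i : Fin 4} (hi : c i = 1) : (∀ j, j ≠ i → c j = 0) ∨ ∀ j, c j ^ 2 = 1 := by
  have e0 := hc 0
  have e1 := hc 1
  have e2 := hc 2
  have e3 := hc 3
  simp only [pderiv_quartic_zero, pderiv_quartic_one, pderiv_quartic_two, pderiv_quartic_three,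
    map_mul, map_add, map_sub, map_neg, map_pow, MvPolynomial.aeval_X, MvPolynomial.aeval_C,
    map_ofNat, map_one] at e0 e1 e2 e3
  have hinj := (algebraMap F K).injective
  have := critical_quarticForm (K := K) (fun h => hF (hinj (by rw [map_ofNat, h, map_zero])))
    ((map_ne_zero (algebraMap F K)).mpr h0)
    (fun h => h1 (hinj (by simpa using h))) e0 e1 e2 e3
  have h1 : c i ≠ 0 := by simp [hi]
  rw [or_iff_not_imp_right]
  intro h
  have h : ¬ (c 1 ^ 2 = c 0 ^ 2 ∧ c 2 ^ 2 = c 0 ^ 2 ∧ c 3 ^ 2 = c 0 ^ 2) := by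
    rintro ⟨g1, g2, g3⟩
    refine h fun j => ?_
    have : ∀ j, c j ^ 2 = c 0 ^ 2 := by
      intro j; fin_cases j <;> simp [g1, g2, g3]
    rw [this j, ← this i, hi, one_pow]
  intro j hj
  fin_cases i <;> fin_cases j <;> simp_all

end
-- Second order expansion of the quartic at a node
section Local
/-- The quadratic form whose pullback along squaring the coordinates is the quartic. -/
def squareForm {R : Type*} [CommRing R] (l a b c d : R) : R :=
  (l - 1) * a * b - l * a * c + b * c + a * d - l * b * d + (l - 1) * c * d

/-- The vector of squares is (1,1,1,1) plus a first order term 2 v w X. Since (1,1,1,1) is the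
vertex of the cone, it pairs to zero with everything, so the X^2 coefficient is q evaluated on the
first order term, and the u-terms enter only from X^3 on. -/
lemma quarticForm_expand_sign {R : Type*} [CommRing R] (l X : R) (v w u : Fin 4 → R)
    (hv : ∀ j, v j ^ 2 = 1) : X ^ 3 ∣
    quarticForm l (v 0 + w 0 * X + u 0 * X ^ 2) (v 1 + w 1 * X + u 1 * X ^ 2)
      (v 2 + w 2 * X + u 2 * X ^ 2) (v 3 + w 3 * X + u 3 * X ^ 2) -
    X ^ 2 * (4 * squareForm l (v 0 * w 0) (v 1 * w 1) (v 2 * w 2) (v 3 * w 3)) := by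
  have key : ∀ j, (v j + w j * X + u j * X ^ 2) ^ 2 = 1 + 2 * (v j * w j) * X +
      (w j ^ 2 + 2 * v j * u j) * X ^ 2 + (2 * w j * u j + u j ^ 2 * X) * X ^ 3 := fun j => by
    linear_combination hv j
  have hq : ∀ x y z w, quarticForm l x y z w = squareForm l (x ^ 2) (y ^ 2) (z ^ 2) (w ^ 2) := by
    intros; unfold quarticForm squareForm; ring
  rw [hq, key, key, key, key]
  generalize w 0 ^ 2 + 2 * v 0 * u 0 = C0
  generalize w 1 ^ 2 + 2 * v 1 * u 1 = C1
  generalize w 2 ^ 2 + 2 * v 2 * u 2 = C2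
  generalize w 3 ^ 2 + 2 * v 3 * u 3 = C3
  generalize 2 * w 0 * u 0 + u 0 ^ 2 * X = R0
  generalize 2 * w 1 * u 1 + u 1 ^ 2 * X = R1
  generalize 2 * w 2 * u 2 + u 2 ^ 2 * X = R2
  generalize 2 * w 3 * u 3 + u 3 ^ 2 * X = R3
  generalize v 0 * w 0 = B0
  generalize v 1 * w 1 = B1
  generalize v 2 * w 2 = B2
  generalize v 3 * w 3 = B3
  -- The polar form of q; the cofactor of X^3 is read off from q(2B X + C X^2 + R X^3).
  let b (a0 a1 a2 a3 b0 b1 b2 b3 : R) := squareForm l (a0 + b0) (a1 + b1) (a2 + b2) (a3 + b3) -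
    squareForm l a0 a1 a2 a3 - squareForm l b0 b1 b2 b3
  refine ⟨b B0 B1 B2 B3 (2 * C0) (2 * C1) (2 * C2) (2 * C3) +
    X * (b B0 B1 B2 B3 (2 * R0) (2 * R1) (2 * R2) (2 * R3) + squareForm l C0 C1 C2 C3) +
    X ^ 2 * b C0 C1 C2 C3 R0 R1 R2 R3 + X ^ 3 * squareForm l R0 R1 R2 R3, ?_⟩
  unfold b squareForm
  ring

/-- At (0:0:0:1) the form is w^2 times the quadric x^2 - l y^2 + (l-1) z^2, plus terms of degree
four in x, y, z. -/
lemma quarticForm_expand_coordinate {R : Type*} [CommRing R] (l X w0 w1 w2 u0 u1 u2 u3 : R) :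
    X ^ 3 ∣ quarticForm l (w0 * X + u0 * X ^ 2) (w1 * X + u1 * X ^ 2)
      (w2 * X + u2 * X ^ 2) (1 + u3 * X ^ 2) -
    X ^ 2 * (w0 ^ 2 - l * w1 ^ 2 + (l - 1) * w2 ^ 2) := by
  have : w0 ^ 2 - l * w1 ^ 2 + (l - 1) * w2 ^ 2 = quarticForm l w0 w1 w2 1 - quarticForm l w0 w1 w2 0 := by
    unfold quarticForm; ring
  refine ⟨2 * w0 * u0 - l * 2 * w1 * u1 + (l - 1) * (2 * w2 * u2) +
    X * (u0 ^ 2 - l * u1 ^ 2 + (l - 1) * u2 ^ 2 +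
      quarticForm l (w0 + u0 * X) (w1 + u1 * X) (w2 + u2 * X) 0 +
      ((w0 + u0 * X)^2 - l * (w1 + u1 * X)^2 + (l-1) * (w2 + u2 * X)^2) * (2 * u3 + u3 ^ 2 * X ^ 2)), ?_⟩
  unfold quarticForm
  ring

end Local
section
variable {F : Type u} [Field F] {l : F}

open Polynomial in
/-- Every node lies on the quartic as a double point: along a suitable line through it, the quartic
vanishes to order exactly two, and this is not affected by second order terms. -/
lemma exists_expansion_at_node (hF : (2 : F) ≠ 0) {v : Fin 4 → F} {i : Fin 4} (hi : v i = 1)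
    (hv : (∀ j, j ≠ i → v j = 0) ∨ ∀ j, v j ^ 2 = 1) :
    ∃ (w : Fin 4 → F) (e : F), w i = 0 ∧ e ≠ 0 ∧ ∀ u : Fin 4 → F[X], X ^ 3 ∣
      MvPolynomial.aeval (fun j => C (v j) + C (w j) * X + u j * X ^ 2) (quartic l) -
        X ^ 2 * C e := by
  simp only [aeval_quartic]
  rcases hv with hv | hv
  -- The coefficient of (X i)^2 (X (rev i))^2 in the quartic is 1 for every i. The four cases below
  -- differ by double transpositions of the coordinates, which preserve the quartic.
  · refine ⟨Pi.single (Fin.rev i) 1, 1, ?_, one_ne_zero, fun u => ?_⟩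
    · fin_cases i <;> simp [Fin.rev]
    fin_cases i
    · have h := quarticForm_expand_coordinate (algebraMap F F[X] l) X 1 0 0 (u 3) (u 2) (u 1) (u 0)
      simp [quarticForm] at *
      convert h using 1
      simp [hv, hi]
      ring
    · have h := quarticForm_expand_coordinate (algebraMap F F[X] l) X 1 0 0 (u 2) (u 3) (u 0) (u 1)
      simp [quarticForm] at *
      convert h using 1
      simp [hv, hi]
      ring
    · have h := quarticForm_expand_coordinate (algebraMap F F[X] l) X 1 0 0 (u 1) (u 0) (u 3) (u 2)
      simp [quarticForm] at *
      convert h using 1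
      simp [hv, hi]
      ring
    · have h := quarticForm_expand_coordinate (algebraMap F F[X] l) X 1 0 0 (u 0) (u 1) (u 2) (u 3)
      simp [quarticForm] at *
      convert h using 1
      simp [hv, hi]
  · have h4 : (4 : F) ≠ 0 := by
      have : (4 : F) = 2 * 2 := by norm_num
      rw [this]; exact mul_ne_zero hF hF
    have hn : ∀ j, v j ≠ 0 := fun j h => by simpa [h] using hv j
    -- The tangent direction must have zero i-th entry. The pairs {0, 3} and {1, 2} both have
    -- coefficient 1 in q, and one of them avoids i.
    by_cases hi' : i = 1 ∨ i = 2
    · refine ⟨Pi.single 0 1 + Pi.single 3 1, 4 * (v 0 * v 3), ?_, ?_, fun u => ?_⟩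
      · rcases hi' with rfl | rfl <;> simp
      · exact mul_ne_zero h4 (mul_ne_zero (hn _) (hn _))
      · convert quarticForm_expand_sign (algebraMap F F[X] l) X (fun j => C (v j))
          (fun j => C ((Pi.single 0 1 + Pi.single 3 1 : Fin 4 → F) j)) u
          (fun j => by rw [← C_pow, hv, C_1]) using 3
        simp [squareForm]
        exact Or.inl (map_ofNat C 4)
    · refine ⟨Pi.single 1 1 + Pi.single 2 1, 4 * (v 1 * v 2), ?_, ?_, fun u => ?_⟩
      · fin_cases i <;> simp_all
      · exact mul_ne_zero h4 (mul_ne_zero (hn _) (hn _))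
      · convert quarticForm_expand_sign (algebraMap F F[X] l) X (fun j => C (v j))
          (fun j => C ((Pi.single 1 1 + Pi.single 2 1 : Fin 4 → F) j)) u
          (fun j => by rw [← C_pow, hv, C_1]) using 3
        simp [squareForm]
        exact Or.inl (map_ofNat C 4)

variable {D : Type u} [CommRing D] [Algebra F D] {i : Fin 4} {d : Fin 4 → D}

open Polynomial in
lemma IsChart.not_formallySmooth_quartic (h : IsChart (quartic l) i d) (hF : (2 : F) ≠ 0)
    (P : Ideal D) [P.IsPrime]
    {v : Fin 4 → F} (hi : v i = 1) (hv : (∀ j, j ≠ i → v j = 0) ∨ ∀ j, v j ^ 2 = 1)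
    (hP : ∀ j, d j - algebraMap F D (v j) ∈ P) :
    ¬ Algebra.FormallySmooth F (Localization.AtPrime P) := by
  obtain ⟨w, e, hw, he, hu⟩ := exists_expansion_at_node (l := l) hF hi hv
  refine h.not_formallySmooth_of_node P v w hi hw hP ?_ fun u hdvd => he ?_
  · have h1 := hu 0
    have h2 : (X ^ 2 : F[X]) ∣ X ^ 3 := pow_dvd_pow _ (by norm_num)
    have := (dvd_sub_left (Dvd.intro _ rfl)).mp (h2.trans h1)
    simpa using this
  · have := (dvd_sub_right hdvd).mp (hu u)
    rw [X_pow_dvd_iff] at this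
    simpa [coeff_X_pow_mul'] using this 2 (by norm_num)

lemma IsChart.exists_node_of_not_formallySmooth (h : IsChart (quartic l) i d) (hF : (2 : F) ≠ 0)
    (h0 : l ≠ 0) (h1 : l ≠ 1) (P : Ideal D) [P.IsPrime]
    (hP : ¬ Algebra.FormallySmooth F (Localization.AtPrime P)) :
    ∃ v : Fin 4 → F, v i = 1 ∧ ((∀ j, j ≠ i → v j = 0) ∨ ∀ j, v j ^ 2 = 1) ∧
      ∀ j, d j - algebraMap F D (v j) ∈ P := by
  have hmem : ∀ j, j ≠ i → MvPolynomial.aeval d (MvPolynomial.pderiv j (quartic l)) ∈ P := by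
    intro j hj
    by_contra hn
    exact hP (h.formallySmooth_of_pderiv_notMem hj.symm P hn)
  -- The Jacobian criterion in the chart says nothing about the i-th derivative; Euler's relation
  -- expresses it through the others, since d i = 1 and the quartic vanishes on the chart.
  have hi : MvPolynomial.aeval d (MvPolynomial.pderiv i (quartic l)) ∈ P := by
    have e := congrArg (MvPolynomial.aeval d) (isHomogeneous_quartic l).sum_X_mul_pderiv
    rw [map_sum, map_nsmul, h.aeval_eq_zero, smul_zero,
      ← Finset.add_sum_erase _ _ (Finset.mem_univ i), map_mul, MvPolynomial.aeval_X, h.coord_eq_one,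
      one_mul] at e
    rw [eq_neg_of_add_eq_zero_left e]
    refine P.neg_mem (P.sum_mem fun j hj => ?_)
    rw [map_mul]
    exact P.mul_mem_left _ (hmem j (Finset.ne_of_mem_erase hj))
  have hall : ∀ j, MvPolynomial.aeval d (MvPolynomial.pderiv j (quartic l)) ∈ P := fun j => by
    by_cases hj : j = i
    · exact hj ▸ hi
    · exact hmem j hj
  -- P is an arbitrary prime, so the critical point lives in its residue field. It turns out to be
  -- F-rational because its coordinates are 0 or satisfy c^2 = 1, which factors modulo P.
  have hc := critical_quartic l (K := P.ResidueField) hF h0 h1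
    (fun j => algebraMap D P.ResidueField (d j)) (fun j => by
      refine (MvPolynomial.aeval_algebraMap_apply P.ResidueField d _).trans ?_
      rw [Ideal.algebraMap_residueField_eq_zero]
      exact hall j) (i := i) (by simp [h.coord_eq_one])
  simp only [Ideal.algebraMap_residueField_eq_zero, ← map_pow] at hc
  rcases hc with hc | hc
  · refine ⟨Pi.single i 1, by simp, Or.inl fun j hj => by simp [hj], fun j => ?_⟩
    by_cases hj : j = i
    · subst hj; simp [h.coord_eq_one]
    · simpa [hj] using hc j hj
  · have : ∀ j, ∃ e : F, e ^ 2 = 1 ∧ d j - algebraMap F D e ∈ P := by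
      intro j
      have h2 : (d j - 1) * (d j + 1) ∈ P := by
        rw [← Ideal.algebraMap_residueField_eq_zero]
        have := hc j
        rw [← sub_eq_zero, ← map_one (algebraMap D P.ResidueField), ← map_sub] at this
        convert this using 2; ring
      rcases (inferInstance : P.IsPrime).mem_or_mem h2 with h3 | h3
      · exact ⟨1, by simp, by simpa using h3⟩
      · exact ⟨-1, by simp, by simpa using h3⟩
    choose e he heP using this
    have hei : e i * e i = 1 := by rw [← sq, he]
    refine ⟨fun j => if j = i then 1 else e j, by simp, Or.inr fun j => ?_, fun j => ?_⟩
    · dsimp only; split_ifs <;> simp [he]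
    · dsimp only; split_ifs with hj
      · subst hj; simp [h.coord_eq_one]
      · exact heP j

/-- The normalization of the coordinates of a node in a chart. -/
lemma IsChart.exists_normalized (h : IsChart (quartic l) i d) (P : Ideal D) [P.IsPrime]
    {v : Fin 4 → F} (hv : v ∈ nodes F)
    (hP : ∀ j k, algebraMap F D (v j) * d k - algebraMap F D (v k) * d j ∈ P) :
    ∃ v : Fin 4 → F, v i = 1 ∧ ((∀ j, j ≠ i → v j = 0) ∨ ∀ j, v j ^ 2 = 1) ∧
      ∀ j, d j - algebraMap F D (v j) ∈ P := by
  have hne : v i ≠ 0 := by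
    intro h0
    have hj : ∀ j, v j = 0 := by
      intro j
      by_contra hj
      have := hP j i
      rw [h.coord_eq_one, h0, map_zero, zero_mul, sub_zero, mul_one] at this
      exact (inferInstance : P.IsPrime).ne_top (Ideal.eq_top_of_isUnit_mem _ this
        ((isUnit_iff_ne_zero.mpr hj).map (algebraMap F D)))
    rcases hv with ⟨k, rfl⟩ | hv
    · simpa using hj k
    · simpa [hj i] using hv i
  refine ⟨fun j => (v i)⁻¹ * v j, inv_mul_cancel₀ hne, ?_, fun j => ?_⟩
  · rcases hv with ⟨k, rfl⟩ | hv
    · left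
      intro j hj
      obtain rfl : i = k := by
        by_contra hik; simp [hik] at hne
      simp [hj]
    · right
      have : ∀ j, v j ^ 2 = 1 := fun j => by rcases hv j with h | h <;> simp [h]
      intro j; simp only [mul_pow, inv_pow, this]; simp
  · have := P.mul_mem_left (algebraMap F D (v i)⁻¹) (hP i j)
    rw [h.coord_eq_one, mul_sub, ← mul_assoc, ← map_mul, inv_mul_cancel₀ hne] at this
    simpa using this

theorem mem_singularLocus_quarticSurface_iff (hF : (2 : F) ≠ 0) (h0 : l ≠ 0) (h1 : l ≠ 1)
    (x : quarticSurface l) : x ∈ singularLocus (quarticSurface.structure l) ↔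
      ∃ v ∈ nodes F, HasCoords (quartic l) x v := by
  obtain ⟨i, hi⟩ := exists_coord_notMem x
  obtain ⟨P, rfl⟩ := (isChart_chartRing (quartic l) i).exists_chart_eq x hi
  have h := isChart_chartRing (quartic l) i
  have hprime := (show PrimeSpectrum (ChartRing (quartic l) i) from P).isPrime
  rw [h.mem_singularLocus]
  simp only [h.hasCoords_chart]
  constructor
  · intro hP
    obtain ⟨v, hvi, hv, hvP⟩ := h.exists_node_of_not_formallySmooth hF h0 h1 _ hP
    refine ⟨v, ?_, fun j k => ?_⟩
    · rcases hv with hv | hv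
      · refine Or.inl ⟨i, ?_⟩
        ext j
        by_cases hj : j = i
        · subst hj; simp [hvi]
        · simp [hj, hv j hj]
      · exact Or.inr fun j => sq_eq_one_iff.mp (hv j)
    · have := Ideal.sub_mem _ (Ideal.mul_mem_left _ (algebraMap F _ (v j)) (hvP k))
        (Ideal.mul_mem_left _ (algebraMap F _ (v k)) (hvP j))
      convert this using 1; ring
  · rintro ⟨v, hv, hvP⟩
    obtain ⟨v', h1', h2', h3'⟩ := h.exists_normalized _ hv hvP
    exact h.not_formallySmooth_quartic hF _ h1' h2' h3'

end
-- Recognizing the completion of a local ring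
section Completion

/-- A ring homomorphism to a complete ring identifies the target with the completion of the source
if it does so modulo all powers of the ideals. -/
lemma exists_adicCompletion_ringEquiv {O R : Type*} [CommRing O] [CommRing R] (m : Ideal O)
    (I : Ideal R) [IsAdicComplete I R] (φ : O →+* R) (hk : ∀ n, (I ^ n).comap φ = m ^ n)
    (hs : ∀ n r, ∃ o, r - φ o ∈ I ^ n) :
    ∃ e : AdicCompletion m O ≃+* R, ∀ o, e (algebraMap O _ o) = φ o := by
  let f (n : ℕ) : AdicCompletion m O →+* R ⧸ I ^ n :=
    (Ideal.quotientMap (I ^ n) φ (hk n).ge).comp (AdicCompletion.evalₐ m n).toRingHom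
  have hf0 (n : ℕ) (x : AdicCompletion m O) : f n x =
      Ideal.quotientMap (I ^ n) φ (hk n).ge (AdicCompletion.evalₐ m n x) := rfl
  have hf (n : ℕ) (x : AdicCompletion.AdicCauchySequence m O) :
      f n (AdicCompletion.mk m O x) = Ideal.Quotient.mk (I ^ n) (φ (x n)) := by
    rw [hf0, AdicCompletion.evalₐ_mk, Ideal.quotientMap_mk]
  have hcompat : ∀ {a b : ℕ} (hle : a ≤ b), (Ideal.Quotient.factorPow I hle).comp (f b) = f a := by
    intro a b hle
    ext x
    induction x using AdicCompletion.induction_on with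
    | _ x =>
    rw [RingHom.comp_apply, hf, hf]
    change Ideal.Quotient.mk (I ^ a) _ = _
    rw [Ideal.Quotient.mk_eq_mk_iff_sub_mem, ← map_sub, ← Ideal.mem_comap, hk]
    have := x.2 hle
    rw [SModEq.sub_mem, smul_eq_mul, Ideal.mul_top] at this
    rw [← neg_sub]
    exact neg_mem this
  have hmk (n : ℕ) (x : AdicCompletion m O) :
      Ideal.Quotient.mk (I ^ n) (IsAdicComplete.liftRingHom I f hcompat x) = f n x :=
    IsAdicComplete.mk_liftRingHom I f hcompat n x
  have heq : ∀ r s : R, (∀ n, Ideal.Quotient.mk (I ^ n) r = Ideal.Quotient.mk (I ^ n) s) → r = s := by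
    intro r s h
    rw [IsHausdorff.eq_iff_smodEq (I := I)]
    intro n
    rw [SModEq.sub_mem, smul_eq_mul, Ideal.mul_top, ← Ideal.Quotient.mk_eq_mk_iff_sub_mem]
    exact h n
  refine ⟨RingEquiv.ofBijective (IsAdicComplete.liftRingHom I f hcompat) ⟨?_, ?_⟩, ?_⟩
  · rw [injective_iff_map_eq_zero]
    intro x hx
    refine AdicCompletion.ext_evalₐ fun n => ?_
    have h := hmk n x
    rw [hx, map_zero] at h
    rw [map_zero]
    rw [hf0] at h
    exact (injective_iff_map_eq_zero _).mp
      (Ideal.quotientMap_injective' (H := (hk n).ge) (hk n).le) _ h.symm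
  · intro r
    choose o ho using fun n => hs n r
    refine ⟨AdicCompletion.mk m O (AdicCompletion.AdicCauchySequence.mk m O o fun n => ?_), ?_⟩
    · rw [SModEq.sub_mem, smul_eq_mul, Ideal.mul_top, ← hk, Ideal.mem_comap, map_sub]
      have := Ideal.sub_mem _ (Ideal.pow_le_pow_right (Nat.le_succ n) (ho (n + 1))) (ho n)
      rwa [sub_sub_sub_cancel_left] at this
    · refine heq _ _ fun n => ?_
      rw [hmk, hf, eq_comm, Ideal.Quotient.mk_eq_mk_iff_sub_mem]
      exact ho n
  · intro o
    refine heq _ _ fun n => ?_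
    change Ideal.Quotient.mk (I ^ n) (IsAdicComplete.liftRingHom I f hcompat _) = _
    rw [hmk]
    rw [hf0, AlgHom.commutes]
    exact Ideal.quotientMap_mk

/-- Successive approximation: an element of (mR)^n is an R-combination of images of elements of m^n,
and replacing its coefficients by approximations from O modulo mR leaves an error in the next power.
-/
lemma exists_sub_mem_pow {O R : Type*} [CommRing O] [CommRing R] (m : Ideal O) (φ : O →+* R)
    (hs : ∀ r, ∃ o, r - φ o ∈ m.map φ) (n : ℕ) (r : R) : ∃ o, r - φ o ∈ m.map φ ^ n := by
  have step : ∀ n, ∀ y ∈ (m ^ n).map φ, ∃ a ∈ m ^ n, y - φ a ∈ m.map φ ^ (n + 1) := by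
    intro n y hy
    induction hy using Submodule.span_induction with
    | mem y hy => obtain ⟨a, ha, rfl⟩ := hy; exact ⟨a, ha, by simp⟩
    | zero => exact ⟨0, by simp, by simp⟩
    | add x y _ _ hx hy =>
      obtain ⟨a, ha, ha'⟩ := hx
      obtain ⟨b, hb, hb'⟩ := hy
      refine ⟨a + b, add_mem ha hb, ?_⟩
      convert add_mem ha' hb' using 1
      rw [map_add]; ring
    | smul r y _ hy =>
      obtain ⟨a, ha, ha'⟩ := hy
      obtain ⟨b, hb⟩ := hs r
      refine ⟨b * a, Ideal.mul_mem_left _ _ ha, ?_⟩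
      have h1 := Ideal.mul_mem_mul hb (Ideal.mem_map_of_mem φ ha)
      rw [Ideal.map_pow, ← pow_succ'] at h1
      convert add_mem (Ideal.mul_mem_left _ r ha') h1 using 1
      rw [map_mul, smul_eq_mul]; ring
  induction n with
  | zero => exact ⟨0, by simp⟩
  | succ n ih =>
    obtain ⟨o, ho⟩ := ih
    rw [← Ideal.map_pow] at ho
    obtain ⟨a, -, ha⟩ := step n _ ho
    exact ⟨o + a, by rwa [map_add, ← sub_sub]⟩

/-- Precompleteness passes to quotients because completion preserves surjections; separatedness of
the quotient is Krull's intersection theorem. -/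
lemma isAdicComplete_quotient {S : Type*} [CommRing S] [IsNoetherianRing S] [IsLocalRing S]
    (I : Ideal S) [IsAdicComplete I S] (hI : I ≠ ⊤) (J : Ideal S) (hJ : J ≤ I) :
    IsAdicComplete (I.map (Ideal.Quotient.mk J)) (S ⧸ J) := by
  have hnt : Nontrivial (S ⧸ J) :=
    Ideal.Quotient.nontrivial_iff.mpr fun h => hI (top_le_iff.mp (h ▸ hJ))
  have hloc : IsLocalRing (S ⧸ J) :=
    IsLocalRing.of_surjective' (Ideal.Quotient.mk J) Ideal.Quotient.mk_surjective
  have h1 : IsHausdorff (I.map (Ideal.Quotient.mk J)) (S ⧸ J) := by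
    refine IsHausdorff.of_isLocalRing _ _ fun h => hI ?_
    have := congrArg (Ideal.comap (Ideal.Quotient.mk J)) h
    rwa [Ideal.comap_map_of_surjective _ Ideal.Quotient.mk_surjective, Ideal.comap_top,
      ← RingHom.ker_eq_comap_bot, Ideal.mk_ker, sup_eq_left.mpr hJ] at this
  have h2 : IsPrecomplete (I.map (algebraMap S (S ⧸ J))) (S ⧸ J) := by
    rw [IsPrecomplete.map_algebraMap_iff, ← AdicCompletion.of_surjective_iff]
    intro y
    obtain ⟨x, rfl⟩ := AdicCompletion.map_surjective I (f := (Ideal.Quotient.mkₐ S J).toLinearMap)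
      Ideal.Quotient.mk_surjective y
    obtain ⟨s, rfl⟩ := AdicCompletion.of_surjective I S x
    exact ⟨Ideal.Quotient.mk J s, by rw [AdicCompletion.map_of]; rfl⟩
  exact { h1, h2 with }

end Completion

/-! ### The maximal ideals of polynomials and power series at the origin -/

section PowerSeries
variable {F : Type*} [Field F] {σ : Type}

lemma mem_idealOfVars_iff (a : MvPolynomial σ F) :
    a ∈ MvPolynomial.idealOfVars σ F ↔ MvPolynomial.constantCoeff a = 0 := by
  rw [← pow_one (MvPolynomial.idealOfVars σ F), MvPolynomial.mem_pow_idealOfVars_iff']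
  simp [MvPolynomial.constantCoeff_eq, Finsupp.degree_eq_zero_iff]

instance : (MvPolynomial.idealOfVars σ F).IsMaximal := by
  have : MvPolynomial.idealOfVars σ F = RingHom.ker (MvPolynomial.constantCoeff (R := F)) := by
    ext a; exact mem_idealOfVars_iff a
  rw [this]
  exact RingHom.ker_isMaximal_of_surjective _ fun a => ⟨MvPolynomial.C a, by simp⟩

/-- The maximal ideal of the ring of formal power series. -/
abbrev powerSeriesIdeal (σ : Type) (F : Type*) [Field F] : Ideal (MvPowerSeries σ F) :=
  Ideal.span (Set.range MvPowerSeries.X)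

lemma map_coe_idealOfVars : (MvPolynomial.idealOfVars σ F).map
    (MvPolynomial.coeToMvPowerSeries.ringHom (R := F)) = powerSeriesIdeal σ F := by
  rw [Ideal.map_span, ← Set.range_comp]
  congr 2; ext1 j; simp

variable [Finite σ]

instance : (powerSeriesIdeal σ F).IsMaximal := by
  have h : Ideal.map (MvPowerSeries.toAdicCompletionAlgEquiv σ F).toRingEquiv
      (powerSeriesIdeal σ F) = (MvPolynomial.idealOfVars σ F).map (algebraMap ..) := by
    simp_rw [Ideal.map_span, ← Set.range_comp]
    congr 2; ext1
    simp [AdicCompletion.algebraMap_apply, ← MvPolynomial.coe_X, MvPowerSeries.toAdicCompletion_coe]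
  have h2 := AdicCompletion.isMaximal_map_of_le _ (MvPolynomial.idealOfVars σ F) le_rfl
    (MvPolynomial.idealOfVars_fg σ F)
  rw [← h] at h2
  have h3 := Ideal.comap_isMaximal_of_equiv (MvPowerSeries.toAdicCompletionAlgEquiv σ F).toRingEquiv
    (hp := h2)
  rwa [Ideal.comap_map_of_bijective] at h3
  exact (MvPowerSeries.toAdicCompletionAlgEquiv σ F).toRingEquiv.bijective

lemma mem_powerSeriesIdeal_iff (a : MvPowerSeries σ F) :
    a ∈ powerSeriesIdeal σ F ↔ MvPowerSeries.constantCoeff a = 0 := by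
  have : (powerSeriesIdeal σ F).IsMaximal := inferInstance
  rw [IsLocalRing.eq_maximalIdeal this,
    IsLocalRing.mem_maximalIdeal, mem_nonunits_iff, MvPowerSeries.isUnit_iff_constantCoeff,
    isUnit_iff_ne_zero, not_not]

/-- Truncation sends the n-th power of the power series ideal to zero and restricts on polynomials
to the quotient map modulo the n-th power of the ideal of variables. -/
lemma coe_mem_powerSeriesIdeal_pow_iff (a : MvPolynomial σ F) (n : ℕ) :
    (a : MvPowerSeries σ F) ∈ powerSeriesIdeal σ F ^ n ↔ a ∈ MvPolynomial.idealOfVars σ F ^ n := by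
  constructor
  · intro h
    have h2 : (powerSeriesIdeal σ F ^ n).map (MvPowerSeries.truncTotalAlgHom σ F n).toRingHom ≤ ⊥ := by
      rw [← map_coe_idealOfVars, Ideal.map_pow, Ideal.map_map, ← Ideal.map_pow, Ideal.map_le_iff_le_comap]
      intro b hb
      have := (MvPowerSeries.truncTotalAlgHom σ F n).commutes b
      exact this.trans (Ideal.Quotient.eq_zero_iff_mem.mpr hb)
    have h3 := h2 (Ideal.mem_map_of_mem _ h)
    exact Ideal.Quotient.eq_zero_iff_mem.mp
      (((MvPowerSeries.truncTotalAlgHom σ F n).commutes a).symm.trans h3)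
  · intro h
    rw [← map_coe_idealOfVars, ← Ideal.map_pow]
    exact Ideal.mem_map_of_mem _ h

end PowerSeries

/-! ### Completed local ring of a hypersurface; formal inverse functions -/

section HypersurfaceCompletion
variable {F : Type*} [Field F] {σ : Type}

lemma constantCoeff_coe (a : MvPolynomial σ F) :
    MvPowerSeries.constantCoeff (a : MvPowerSeries σ F) = MvPolynomial.constantCoeff a := by
  rw [← MvPowerSeries.coeff_zero_eq_constantCoeff_apply, MvPolynomial.coeff_coe]
  rfl

variable [Finite σ]

/-- The completed local ring of an affine hypersurface at the origin. -/
lemma exists_adicCompletion_hypersurface (f : MvPolynomial σ F)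
    (hf : MvPolynomial.constantCoeff f = 0) (P : Ideal (MvPolynomial σ F ⧸ Ideal.span {f}))
    [P.IsPrime] (hP : P = (MvPolynomial.idealOfVars σ F).map (Ideal.Quotient.mk _))
    (O : Type*) [CommRing O] [IsLocalRing O] [Algebra (MvPolynomial σ F ⧸ Ideal.span {f}) O]
    [IsLocalization.AtPrime O P] :
    ∃ e : AdicCompletion (IsLocalRing.maximalIdeal O) O ≃+*
      MvPowerSeries σ F ⧸ Ideal.span {(f : MvPowerSeries σ F)},
      ∀ a : MvPolynomial σ F, e (algebraMap O _ (algebraMap _ O (Ideal.Quotient.mk (Ideal.span {f}) a))) =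
        Ideal.Quotient.mk (Ideal.span {(f : MvPowerSeries σ F)}) (a : MvPowerSeries σ F) := by
  let J : Ideal (MvPowerSeries σ F) := Ideal.span {(f : MvPowerSeries σ F)}
  let φ₀ : MvPolynomial σ F →+* MvPowerSeries σ F := MvPolynomial.coeToMvPowerSeries.ringHom
  have hfJ : Ideal.span {f} ≤ J.comap φ₀ := by
    rw [Ideal.span_singleton_le_iff_mem]; exact Ideal.mem_span_singleton_self _
  let φ₁ : MvPolynomial σ F ⧸ Ideal.span {f} →+* MvPowerSeries σ F ⧸ J :=
    Ideal.quotientMap J φ₀ hfJ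
  have hφ₁ : ∀ a, φ₁ (Ideal.Quotient.mk _ a) = Ideal.Quotient.mk J (a : MvPowerSeries σ F) :=
    fun a => rfl
  have hJ : J ≤ powerSeriesIdeal σ F := by
    rw [Ideal.span_singleton_le_iff_mem, mem_powerSeriesIdeal_iff, constantCoeff_coe, hf]
  have hcomplete := isAdicComplete_quotient (powerSeriesIdeal σ F) (Ideal.IsPrime.ne_top') J hJ
  have hmk : ∀ a, Ideal.Quotient.mk (Ideal.span {f}) a ∈ P ↔ MvPolynomial.constantCoeff a = 0 := by
    intro a
    have : Ideal.Quotient.mk (Ideal.span {f}) a ∈ P ↔ a ∈ MvPolynomial.idealOfVars σ F := by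
      have hle : RingHom.ker (Ideal.Quotient.mk (Ideal.span {f})) ≤ MvPolynomial.idealOfVars σ F := by
        rw [Ideal.mk_ker, Ideal.span_singleton_le_iff_mem, mem_idealOfVars_iff, hf]
      rw [hP, ← Ideal.mem_comap, Ideal.comap_map_of_surjective _ Ideal.Quotient.mk_surjective,
        ← RingHom.ker_eq_comap_bot, sup_eq_left.mpr hle]
    rw [this, mem_idealOfVars_iff]
  have hunit : ∀ s : P.primeCompl, IsUnit (φ₁ s) := by
    rintro ⟨s, hs⟩
    obtain ⟨a, rfl⟩ := Ideal.Quotient.mk_surjective s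
    have h1 : ¬ MvPolynomial.constantCoeff a = 0 := fun h => hs ((hmk a).mpr h)
    change IsUnit (Ideal.Quotient.mk J (a : MvPowerSeries σ F))
    refine IsUnit.map _ (MvPowerSeries.isUnit_iff_constantCoeff.mpr ?_)
    rw [constantCoeff_coe]
    exact isUnit_iff_ne_zero.mpr h1
  let φ : O →+* MvPowerSeries σ F ⧸ J := IsLocalization.lift (M := P.primeCompl) hunit
  have hφ : ∀ d, φ (algebraMap _ O d) = φ₁ d := fun d => IsLocalization.lift_eq hunit d
  have hm : IsLocalRing.maximalIdeal O = P.map (algebraMap _ O) :=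
    (IsLocalization.AtPrime.map_eq_maximalIdeal P O).symm
  have hI : (IsLocalRing.maximalIdeal O).map φ =
      (powerSeriesIdeal σ F).map (Ideal.Quotient.mk J) := by
    rw [hm, hP, Ideal.map_map, Ideal.map_map, Ideal.map_span, Ideal.map_span, ← Set.range_comp,
      ← Set.range_comp]
    congr 2
    ext1 j
    change φ (algebraMap _ O (Ideal.Quotient.mk _ (MvPolynomial.X j))) = _
    rw [hφ, hφ₁, MvPolynomial.coe_X]
    rfl
  have hs1 : ∀ r, ∃ o, r - φ o ∈ (IsLocalRing.maximalIdeal O).map φ := by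
    intro r
    obtain ⟨s, rfl⟩ := Ideal.Quotient.mk_surjective r
    refine ⟨algebraMap _ O (Ideal.Quotient.mk (Ideal.span {f}) (MvPolynomial.C (MvPowerSeries.constantCoeff s))), ?_⟩
    rw [hφ, hφ₁, hI, ← map_sub]
    refine Ideal.mem_map_of_mem _ ?_
    rw [mem_powerSeriesIdeal_iff]
    simp
  have hk : ∀ n, ((powerSeriesIdeal σ F).map (Ideal.Quotient.mk J) ^ n).comap φ =
      IsLocalRing.maximalIdeal O ^ n := by
    intro n
    apply le_antisymm
    · intro o ho
      obtain ⟨d, s, rfl⟩ := IsLocalization.exists_mk'_eq P.primeCompl o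
      have hd : φ₁ d ∈ (powerSeriesIdeal σ F).map (Ideal.Quotient.mk J) ^ n := by
        have h1 : φ (algebraMap _ O d) = φ (IsLocalization.mk' O d s) * φ (algebraMap _ O s.1) := by
          rw [← map_mul, IsLocalization.mk'_spec]
        rw [← hφ, h1]
        exact Ideal.mul_mem_right _ _ ho
      have hdP : d ∈ P ^ n := by
        obtain ⟨a, rfl⟩ := Ideal.Quotient.mk_surjective d
        rw [hφ₁, ← Ideal.map_pow, Ideal.mem_map_iff_of_surjective _ Ideal.Quotient.mk_surjective] at hd
        obtain ⟨b, hb, hba⟩ := hd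
        rw [Ideal.Quotient.mk_eq_mk_iff_sub_mem] at hba
        obtain ⟨r, hr⟩ := Ideal.mem_span_singleton'.mp hba
        have hr' : ∀ r : MvPowerSeries σ F, ∃ o : MvPolynomial σ F,
            r - φ₀ o ∈ (MvPolynomial.idealOfVars σ F).map φ₀ := by
          intro r
          refine ⟨MvPolynomial.C (MvPowerSeries.constantCoeff r), ?_⟩
          rw [map_coe_idealOfVars, mem_powerSeriesIdeal_iff]
          simp [φ₀]
        -- Here a = b - r f with b in the n-th power and r only a power series. Replacing r by a
        -- polynomial c with r - c in the n-th power, a + c f is a polynomial in the n-th power with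
        -- the same class as a modulo f.
        obtain ⟨c, hc⟩ := exists_sub_mem_pow _ φ₀ hr' n r
        rw [map_coe_idealOfVars] at hc
        have h2 : a + c * f ∈ MvPolynomial.idealOfVars σ F ^ n := by
          rw [← coe_mem_powerSeriesIdeal_pow_iff]
          have := Ideal.sub_mem _ hb (Ideal.mul_mem_right (f : MvPowerSeries σ F) _ hc)
          convert this using 1
          simp only [φ₀, MvPolynomial.coeToMvPowerSeries.ringHom_apply, MvPolynomial.coe_add,
            MvPolynomial.coe_mul]
          linear_combination hr
        have h3 := Ideal.mem_map_of_mem (Ideal.Quotient.mk (Ideal.span {f})) h2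
        rw [Ideal.map_pow, ← hP, map_add, Ideal.Quotient.eq_zero_iff_mem.mpr
          (Ideal.mul_mem_left _ c (Ideal.mem_span_singleton_self f)), add_zero] at h3
        exact h3
      rw [IsLocalization.mk'_eq_mul_mk'_one, hm, ← Ideal.map_pow]
      exact Ideal.mul_mem_right _ _ (Ideal.mem_map_of_mem _ hdP)
    · rw [← hI, ← Ideal.map_pow]
      exact Ideal.le_comap_map
  have hs : ∀ n r, ∃ o, r - φ o ∈ (powerSeriesIdeal σ F).map (Ideal.Quotient.mk J) ^ n := by
    intro n r
    rw [← hI]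
    exact exists_sub_mem_pow _ φ hs1 n r
  obtain ⟨e, he⟩ := exists_adicCompletion_ringEquiv (IsLocalRing.maximalIdeal O)
    ((powerSeriesIdeal σ F).map (Ideal.Quotient.mk J)) φ hk hs
  exact ⟨e, fun a => by rw [he, hφ, hφ₁]⟩

/-- The kernels of the iterates stabilize at some n; an element of ker ψ is ψ^n(y), and then y lies
in ker ψ^(n+1) = ker ψ^n. -/
lemma injective_of_surjective_ringEnd {S : Type*} [CommRing S] [IsNoetherianRing S] (ψ : S →+* S)
    (hψ : Function.Surjective ψ) : Function.Injective ψ := by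
  let k : ℕ →o Ideal S := ⟨fun n => RingHom.ker (ψ ^ n), monotone_nat_of_le_succ fun n x hx => by
    rw [RingHom.mem_ker] at hx ⊢
    rw [pow_succ', RingHom.mul_def, RingHom.comp_apply, hx, map_zero]⟩
  obtain ⟨n, hn⟩ := monotone_stabilizes_iff_noetherian.mpr ‹IsNoetherianRing S› k
  rw [injective_iff_map_eq_zero]
  intro x hx
  have hsurj : Function.Surjective (ψ ^ n) := by
    rw [RingHom.coe_pow]; exact hψ.iterate n
  obtain ⟨y, rfl⟩ := hsurj x
  have : y ∈ k (n + 1) := by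
    change y ∈ RingHom.ker (ψ ^ (n + 1))
    rw [RingHom.mem_ker, pow_succ', RingHom.mul_def, RingHom.comp_apply, hx]
  rw [← hn (n + 1) (Nat.le_succ n)] at this
  exact this

/-- The formal inverse function theorem. -/
lemma exists_powerSeries_algEquiv (g : σ → MvPowerSeries σ F)
    (hg : ∀ i, g i ∈ powerSeriesIdeal σ F)
    (hX : ∀ i, MvPowerSeries.X i ∈ Ideal.span (Set.range g)) :
    ∃ Ψ : MvPowerSeries σ F ≃ₐ[F] MvPowerSeries σ F, ∀ i, Ψ (MvPowerSeries.X i) = g i := by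
  have hs : MvPowerSeries.HasSubst g := MvPowerSeries.hasSubst_of_constantCoeff_zero fun s =>
    (mem_powerSeriesIdeal_iff _).mp (hg s)
  let ψ : MvPowerSeries σ F →ₐ[F] MvPowerSeries σ F := MvPowerSeries.substAlgHom hs
  have hψ : ∀ i, ψ (MvPowerSeries.X i) = g i := fun i => MvPowerSeries.substAlgHom_X hs i
  have hmap : (powerSeriesIdeal σ F).map ψ.toRingHom = powerSeriesIdeal σ F := by
    rw [Ideal.map_span, ← Set.range_comp]
    have : ⇑ψ.toRingHom ∘ MvPowerSeries.X = g := funext hψ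
    rw [this]
    apply le_antisymm
    · rw [Ideal.span_le]; rintro _ ⟨i, rfl⟩; exact hg i
    · rw [Ideal.span_le]; rintro _ ⟨i, rfl⟩; exact hX i
  -- Modulo the maximal ideal only constants survive and ψ fixes them. As ψ maps the maximal ideal
  -- onto generators of itself, completeness upgrades this to surjectivity, and injectivity then
  -- comes from the Noetherian property.
  have hsurj : Function.Surjective ψ.toRingHom := by
    have : IsHausdorff ((powerSeriesIdeal σ F).map ψ.toRingHom) (MvPowerSeries σ F) := by
      rw [hmap]; infer_instance
    refine surjective_of_mk_map_comp_surjective (I := powerSeriesIdeal σ F) ψ.toRingHom fun r => ?_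
    obtain ⟨s, rfl⟩ := Ideal.Quotient.mk_surjective r
    refine ⟨algebraMap F _ (MvPowerSeries.constantCoeff s), ?_⟩
    change Ideal.Quotient.mk _ (ψ (algebraMap F _ _)) = _
    rw [AlgHom.commutes, Ideal.Quotient.mk_eq_mk_iff_sub_mem, hmap, mem_powerSeriesIdeal_iff]
    simp [MvPowerSeries.algebraMap_apply]
  exact ⟨AlgEquiv.ofBijective ψ ⟨injective_of_surjective_ringEnd ψ.toRingHom hsurj, hsurj⟩, hψ⟩

end HypersurfaceCompletion

/-! ### Explicit formal coordinates at the two kinds of nodes -/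

section NormalForm
variable {F : Type*} [Field F]

/-- If a quadric cone becomes a unit multiple of `f` after a formal change of coordinates, then `f`
defines an `A₁` singularity. -/
lemma exists_ringEquiv_of_eq_mul {f : MvPowerSeries (Fin 3) F} (g : Fin 3 → MvPowerSeries (Fin 3) F)
    (hg : ∀ i, MvPowerSeries.constantCoeff (g i) = 0)
    (hX : ∀ i, MvPowerSeries.X i ∈ Ideal.span (Set.range g)) {u : MvPowerSeries (Fin 3) F}
    (hu : IsUnit u) (hf : g 0 * g 1 - g 2 ^ 2 = u * f) :
    ∃ e : (MvPowerSeries (Fin 3) F ⧸ Ideal.span {f}) ≃+* MvPowerSeries (Fin 3) F ⧸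
      Ideal.span {(MvPowerSeries.X 0 * MvPowerSeries.X 1 - MvPowerSeries.X 2 ^ 2 :
        MvPowerSeries (Fin 3) F)},
      ∀ a : F, e (Ideal.Quotient.mk _ (MvPowerSeries.C a)) = Ideal.Quotient.mk _ (MvPowerSeries.C a) := by
  obtain ⟨Ψ, hΨ⟩ := exists_powerSeries_algEquiv g (fun i => (mem_powerSeriesIdeal_iff _).mpr (hg i)) hX
  have h : Ideal.span {f} = (Ideal.span {(MvPowerSeries.X 0 * MvPowerSeries.X 1 -
      MvPowerSeries.X 2 ^ 2 : MvPowerSeries (Fin 3) F)}).map (Ψ : _ →+* MvPowerSeries (Fin 3) F) := by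
    rw [Ideal.map_span, Set.image_singleton]
    simp only [RingHom.coe_coe, map_sub, map_mul, map_pow, hΨ, hf]
    exact (Ideal.span_singleton_mul_left_unit hu f).symm
  refine ⟨(Ideal.quotientEquiv _ _ Ψ.toRingEquiv h).symm, fun a => ?_⟩
  rw [RingEquiv.symm_apply_eq]
  change _ = Ideal.Quotient.mk _ (Ψ (MvPowerSeries.C a))
  congr 1
  exact (Ψ.commutes a).symm

/-- In the parameters s i = (1 + X i)^2 - 1, which are units times the variables as 2 ≠ 0, the
equation is exactly the quadratic form Q = (l-1) s₀s₁ - l s₀s₂ + s₁s₂, because q is invariant under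
translation by its vertex. The normal form comes from ((l-1)s₁ - l s₂)(l s₀ - s₁) = l Q - (l-1)
s₁^2. -/
lemma exists_ringEquiv_sign_node (hF : (2 : F) ≠ 0) {l : F} (h0 : l ≠ 0) (h1 : l ≠ 1) :
    ∃ e : (MvPowerSeries (Fin 3) F ⧸ Ideal.span {quarticForm (MvPowerSeries.C l : MvPowerSeries (Fin 3) F)
        (1 + MvPowerSeries.X 0) (1 + MvPowerSeries.X 1) (1 + MvPowerSeries.X 2) 1}) ≃+*
      MvPowerSeries (Fin 3) F ⧸ Ideal.span {(MvPowerSeries.X 0 * MvPowerSeries.X 1 -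
        MvPowerSeries.X 2 ^ 2 : MvPowerSeries (Fin 3) F)},
      ∀ a : F, e (Ideal.Quotient.mk _ (MvPowerSeries.C a)) = Ideal.Quotient.mk _ (MvPowerSeries.C a) := by
  have h1' : l - 1 ≠ 0 := sub_ne_zero.mpr h1
  let L : MvPowerSeries (Fin 3) F := MvPowerSeries.C l
  let K : MvPowerSeries (Fin 3) F := MvPowerSeries.C (l - 1)⁻¹
  have hL : IsUnit L := (isUnit_iff_ne_zero.mpr h0).map _
  have hK : IsUnit K := (isUnit_iff_ne_zero.mpr (inv_ne_zero h1')).map _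
  have hKL : K * (L - 1) = 1 := by
    rw [← map_one MvPowerSeries.C, ← map_sub, ← map_mul, inv_mul_cancel₀ h1']
  let s (i : Fin 3) : MvPowerSeries (Fin 3) F := (2 + MvPowerSeries.X i) * MvPowerSeries.X i
  let g : Fin 3 → MvPowerSeries (Fin 3) F :=
    ![(L - 1) * s 1 - L * s 2, -(K * (L * s 0 - s 1)), s 1]
  refine exists_ringEquiv_of_eq_mul g ?_ ?_ (u := -(L * K)) (hL.mul hK).neg ?_
  · intro i; fin_cases i <;> simp [g, s]
  · have hg : ∀ i, g i ∈ Ideal.span (Set.range g) := fun i => Ideal.subset_span ⟨i, rfl⟩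
    have e1 : s 1 ∈ Ideal.span (Set.range g) := hg 2
    have e2 : s 2 ∈ Ideal.span (Set.range g) := by
      rw [← Ideal.unit_mul_mem_iff_mem _ hL]
      convert sub_mem (Ideal.mul_mem_left _ (L - 1) e1) (hg 0) using 1
      simp [g]
    have e0 : s 0 ∈ Ideal.span (Set.range g) := by
      rw [← Ideal.unit_mul_mem_iff_mem _ (hK.mul hL)]
      convert sub_mem (Ideal.mul_mem_left _ K e1) (hg 1) using 1
      simp [g]; ring
    have h2 : ∀ i, IsUnit (2 + MvPowerSeries.X i : MvPowerSeries (Fin 3) F) := by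
      intro i
      rw [MvPowerSeries.isUnit_iff_constantCoeff]
      rw [map_add, map_ofNat, MvPowerSeries.constantCoeff_X, add_zero]
      exact isUnit_iff_ne_zero.mpr hF
    intro i
    rw [← Ideal.unit_mul_mem_iff_mem _ (h2 i)]
    fin_cases i
    exacts [e0, e1, e2]
  · simp only [g, s, quarticForm, Matrix.cons_val]
    change _ = -(L * K) * ((L - 1) * (1 + MvPowerSeries.X 0) ^ 2 * (1 + MvPowerSeries.X 1) ^ 2 -
      L * (1 + MvPowerSeries.X 0) ^ 2 * (1 + MvPowerSeries.X 2) ^ 2 +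
      (1 + MvPowerSeries.X 1) ^ 2 * (1 + MvPowerSeries.X 2) ^ 2 + (1 + MvPowerSeries.X 0) ^ 2 * 1 ^ 2 -
      L * (1 + MvPowerSeries.X 1) ^ 2 * 1 ^ 2 + (L - 1) * (1 + MvPowerSeries.X 2) ^ 2 * 1 ^ 2)
    linear_combination ((2 + MvPowerSeries.X 1) * MvPowerSeries.X 1) ^ 2 * hKL

/-- The tangent cone x^2 - l y^2 + (l-1) z^2 contains (1:1:1), and it equals (x - z - l(y-z))(x + z
+ l(y-z)) + l(l-1)(y-z)^2. The full equation has the same shape with unit factors E and N inserted,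
so the quartic terms need no further approximation. -/
lemma exists_ringEquiv_coordinate_node (hF : (2 : F) ≠ 0) {l : F} (h0 : l ≠ 0) (h1 : l ≠ 1) :
    ∃ e : (MvPowerSeries (Fin 3) F ⧸ Ideal.span {quarticForm (MvPowerSeries.C l : MvPowerSeries (Fin 3) F)
        (MvPowerSeries.X 0) (MvPowerSeries.X 1) (MvPowerSeries.X 2) 1}) ≃+*
      MvPowerSeries (Fin 3) F ⧸ Ideal.span {(MvPowerSeries.X 0 * MvPowerSeries.X 1 -
        MvPowerSeries.X 2 ^ 2 : MvPowerSeries (Fin 3) F)},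
      ∀ a : F, e (Ideal.Quotient.mk _ (MvPowerSeries.C a)) = Ideal.Quotient.mk _ (MvPowerSeries.C a) := by
  have h1' : l * (l - 1) ≠ 0 := mul_ne_zero h0 (sub_ne_zero.mpr h1)
  let L : MvPowerSeries (Fin 3) F := MvPowerSeries.C l
  let K : MvPowerSeries (Fin 3) F := MvPowerSeries.C (l * (l - 1))⁻¹
  have hK : IsUnit K := (isUnit_iff_ne_zero.mpr (inv_ne_zero h1')).map _
  have hKL : K * (L * (L - 1)) = 1 := by
    rw [← map_one MvPowerSeries.C, ← map_sub, ← map_mul, ← map_mul, inv_mul_cancel₀ h1']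
  obtain ⟨x, hx⟩ : ∃ x : MvPowerSeries (Fin 3) F, x = MvPowerSeries.X 0 := ⟨_, rfl⟩
  obtain ⟨y, hy⟩ : ∃ x : MvPowerSeries (Fin 3) F, x = MvPowerSeries.X 1 := ⟨_, rfl⟩
  obtain ⟨z, hz⟩ : ∃ x : MvPowerSeries (Fin 3) F, x = MvPowerSeries.X 2 := ⟨_, rfl⟩
  obtain ⟨E, hE⟩ : ∃ E, E = 1 - z ^ 2 + (L - 1) * ((y - z) * (y + z)) := ⟨_, rfl⟩
  obtain ⟨N, hN⟩ : ∃ N, N = E + (y + z) ^ 2 := ⟨_, rfl⟩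
  have hEu : IsUnit E := by
    rw [MvPowerSeries.isUnit_iff_constantCoeff]; simp [hE, hy, hz]
  have hNu : IsUnit N := by
    rw [MvPowerSeries.isUnit_iff_constantCoeff]; simp [hN, hE, hy, hz]
  let g : Fin 3 → MvPowerSeries (Fin 3) F :=
    ![x - z - L * (y - z), -(K * E * N * (x + z + L * (y - z))), N * (y - z)]
  refine exists_ringEquiv_of_eq_mul g ?_ ?_ (u := -(K * N)) (hK.mul hNu).neg ?_
  · intro i; fin_cases i <;> simp [g, hx, hy, hz]
  · have hg : ∀ i, g i ∈ Ideal.span (Set.range g) := fun i => Ideal.subset_span ⟨i, rfl⟩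
    have e1 : y - z ∈ Ideal.span (Set.range g) := by
      rw [← Ideal.unit_mul_mem_iff_mem _ hNu]; exact hg 2
    have e2 : x + z + L * (y - z) ∈ Ideal.span (Set.range g) := by
      rw [← Ideal.unit_mul_mem_iff_mem _ ((hK.mul hEu).mul hNu), ← neg_mem_iff]; exact hg 1
    have e3 : z ∈ Ideal.span (Set.range g) := by
      have h2 : IsUnit (2 : MvPowerSeries (Fin 3) F) := by
        have := (isUnit_iff_ne_zero.mpr hF).map (MvPowerSeries.C (σ := Fin 3) (R := F))
        rwa [map_ofNat] at this
      rw [← Ideal.unit_mul_mem_iff_mem _ h2]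
      convert sub_mem (sub_mem e2 (hg 0)) (Ideal.mul_mem_left _ (2 * L) e1) using 1
      simp [g]; ring
    have e4 : y ∈ Ideal.span (Set.range g) := by simpa using add_mem e1 e3
    have e5 : x ∈ Ideal.span (Set.range g) := by
      convert add_mem (add_mem (hg 0) e3) (Ideal.mul_mem_left _ L e1) using 1
      simp [g]; ring
    intro i
    fin_cases i
    exacts [hx ▸ e5, hy ▸ e4, hz ▸ e3]
  · simp only [g, quarticForm, Matrix.cons_val, ← hx, ← hy, ← hz]
    change _ = -(K * N) * ((L - 1) * x ^ 2 * y ^ 2 - L * x ^ 2 * z ^ 2 +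
      y ^ 2 * z ^ 2 + x ^ 2 * 1 ^ 2 - L * y ^ 2 * 1 ^ 2 + (L - 1) * z ^ 2 * 1 ^ 2)
    have key : (L - 1) * x ^ 2 * y ^ 2 - L * x ^ 2 * z ^ 2 +
        y ^ 2 * z ^ 2 + x ^ 2 * 1 ^ 2 - L * y ^ 2 * 1 ^ 2 + (L - 1) * z ^ 2 * 1 ^ 2 =
        (x - z - L * (y - z)) * (E * (x + z + L * (y - z))) + L * (L - 1) * ((y - z) ^ 2 * N) := by
      rw [hN, hE]; ring
    rw [key]
    linear_combination (N * (y - z)) ^ 2 * hKL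

end NormalForm

/-! ### Local rings of a scheme through an affine chart -/

section Stalks
variable {F : Type u} [Field F] {X : Scheme.{u}} (f : X ⟶ Spec (.of F)) {D : Type u} [CommRing D]
  [Algebra F D] (j : Spec (.of D) ⟶ X) [IsOpenImmersion j] (P : Spec (.of D))

/-- The map from the coordinate ring of an affine open to a local ring. -/
def toStalkOfChart : D →+* X.presheaf.stalk (j P) :=
  ((Scheme.ΓSpecIso (.of D)).inv ≫ (Spec (.of D)).presheaf.germ ⊤ P trivial ≫
    inv (j.stalkMap P)).hom

lemma isLocalization_toStalkOfChart :
    letI := (toStalkOfChart j P).toAlgebra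
    IsLocalization.AtPrime (X.presheaf.stalk (j P)) (show PrimeSpectrum D from P).asIdeal := by
  let := (toStalkOfChart j P).toAlgebra
  let : Algebra D ((Spec (.of D)).presheaf.stalk P) := StructureSheaf.stalkAlgebra D P
  have h : IsLocalization.AtPrime ((Spec (.of D)).presheaf.stalk P)
      (show PrimeSpectrum D from P).asIdeal := StructureSheaf.IsLocalization.to_stalk D P
  let e : (Spec (.of D)).presheaf.stalk P ≃ₐ[D] X.presheaf.stalk (j P) :=
    { (asIso (j.stalkMap P)).symm.commRingCatIsoToRingEquiv with
      commutes' := fun d => rfl }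
  exact IsLocalization.isLocalization_of_algEquiv _ e

lemma scalarsToStalk_eq (hj : j ≫ f = Spec.map (CommRingCat.ofHom (algebraMap F D))) (a : F) :
    scalarsToStalk f (j P) a = toStalkOfChart j P (algebraMap F D a) := by
  have : (Scheme.ΓSpecIso (.of F)).inv ≫ f.appTop ≫ X.presheaf.germ ⊤ (j P) trivial =
      CommRingCat.ofHom (algebraMap F D) ≫ (Scheme.ΓSpecIso (.of D)).inv ≫
        (Spec (.of D)).presheaf.germ ⊤ P trivial ≫ inv (j.stalkMap P) := by
    rw [← cancel_mono (j.stalkMap P)]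
    simp only [Category.assoc, IsIso.inv_hom_id, Category.comp_id]
    have h1 := j.germ_stalkMap ⊤ P trivial
    rw [h1]
    have h2 := Scheme.ΓSpecIso_inv_naturality (CommRingCat.ofHom (algebraMap F D))
    rw [reassoc_of% h2, ← hj]
    simp
    rfl
  exact congrArg (fun g => g.hom a) this

end Stalks

/-! ### Charts in coordinates centred at a node, and the A₁ property -/

section AffineCoordinates
variable {F : Type u} [Field F] {σ τ : Type} {p : MvPolynomial σ F} {i : σ}

/-- The families c and e are inverse parametrizations of the affine space X i = 1. The freedom in c
allows the origin to be placed at the node, which the completion at the ideal of variables needs. -/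
lemma isChart_of_affineCoordinates {c : σ → MvPolynomial τ F} {e : τ → MvPolynomial σ F}
    (hce : ∀ k, MvPolynomial.aeval c (e k) = MvPolynomial.X k)
    (hec : ∀ j, MvPolynomial.aeval e (c j) - MvPolynomial.X j ∈
      Ideal.span {(MvPolynomial.X i - 1 : MvPolynomial σ F)}) (hi : c i = 1) :
    IsChart (D := MvPolynomial τ F ⧸ Ideal.span {MvPolynomial.aeval c p}) p i
      fun j => Ideal.Quotient.mk _ (c j) := by
  have hq : MvPolynomial.aeval (R := F)
      (fun j => Ideal.Quotient.mk (Ideal.span {MvPolynomial.aeval c p}) (c j)) =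
      (Ideal.Quotient.mkₐ F _).comp (MvPolynomial.aeval c) := by
    apply MvPolynomial.algHom_ext; intro j; simp [-MvPolynomial.aeval_eq_bind₁]
  have hmod : ∀ a, MvPolynomial.aeval e (MvPolynomial.aeval c a) - a ∈
      Ideal.span {(MvPolynomial.X i - 1 : MvPolynomial σ F)} := by
    intro a
    have h : ((Ideal.Quotient.mkₐ F (Ideal.span {(MvPolynomial.X i - 1 : MvPolynomial σ F)})).comp
        (MvPolynomial.aeval e)).comp (MvPolynomial.aeval c) = Ideal.Quotient.mkₐ F _ := by
      apply MvPolynomial.algHom_ext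
      intro j
      simp only [AlgHom.comp_apply, MvPolynomial.aeval_X]
      exact Ideal.Quotient.mk_eq_mk_iff_sub_mem _ _ |>.mpr (hec j)
    rw [← Ideal.Quotient.mk_eq_mk_iff_sub_mem]
    exact AlgHom.congr_fun h a
  have hle : Ideal.span {(MvPolynomial.X i - 1 : MvPolynomial σ F)} ≤
      Ideal.span {p, MvPolynomial.X i - 1} := Ideal.span_mono (by simp)
  refine ⟨?_, ?_, ?_, ?_⟩
  · rw [hq]
    refine Ideal.Quotient.mk_surjective.comp (g := Ideal.Quotient.mk _) fun a => ?_
    refine ⟨MvPolynomial.aeval e a, ?_⟩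
    have : (MvPolynomial.aeval c).comp (MvPolynomial.aeval e) = AlgHom.id F _ := by
      apply MvPolynomial.algHom_ext; intro k; simp [hce, -MvPolynomial.aeval_eq_bind₁]
    exact AlgHom.congr_fun this a
  · intro a ha
    rw [hq] at ha
    obtain ⟨r, hr⟩ := Ideal.mem_span_singleton'.mp (Ideal.Quotient.eq_zero_iff_mem.mp ha)
    have h1 := hle (hmod a)
    have h2 := hle (hmod p)
    have hr' := congrArg (MvPolynomial.aeval e) hr
    rw [map_mul] at hr'
    rw [AlgHom.coe_toRingHom] at hr'
    have h3 : MvPolynomial.aeval e (MvPolynomial.aeval c p) ∈ Ideal.span {p, MvPolynomial.X i - 1} := by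
      simpa using add_mem h2 (Ideal.subset_span (by simp) : p ∈ Ideal.span {p, MvPolynomial.X i - 1})
    have h4 := sub_mem (Ideal.mul_mem_left _ (MvPolynomial.aeval e r) h3) h1
    rw [hr'] at h4
    simpa using h4
  · rw [hq]
    exact Ideal.Quotient.eq_zero_iff_mem.mpr (Ideal.mem_span_singleton_self _)
  · rw [hi, map_one]

end AffineCoordinates

section A1
variable {F : Type u} [Field F] {σ : Type} {p : MvPolynomial σ F}
  [Fact (∃ d, p.IsHomogeneous d)] {i : σ}

lemma HasCoords.smul {x : hypersurface p} {v : σ → F} (h : HasCoords p x v) (a : F) :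
    HasCoords p x fun j => a * v j := by
  intro j k
  have := Ideal.mul_mem_left _ (Ideal.Quotient.mk (Ideal.span {p}) (MvPolynomial.C a)) (h j k)
  rw [← map_mul] at this
  have e : MvPolynomial.C a * (MvPolynomial.C (v j) * MvPolynomial.X k -
      MvPolynomial.C (v k) * MvPolynomial.X j) = MvPolynomial.C (a * v j) * MvPolynomial.X k -
      MvPolynomial.C (a * v k) * (MvPolynomial.X j : MvPolynomial σ F) := by
    simp only [map_mul]; ring
  rw [e] at this
  exact this

lemma exists_isA1Singularity {c : σ → MvPolynomial (Fin 3) F} {e : Fin 3 → MvPolynomial σ F}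
    (hce : ∀ k, MvPolynomial.aeval c (e k) = MvPolynomial.X k)
    (hec : ∀ j, MvPolynomial.aeval e (c j) - MvPolynomial.X j ∈
      Ideal.span {(MvPolynomial.X i - 1 : MvPolynomial σ F)}) (hi : c i = 1)
    {f : MvPolynomial (Fin 3) F} (hf : MvPolynomial.aeval c p = f)
    (hf0 : MvPolynomial.constantCoeff f = 0)
    (h : ∃ e : (MvPowerSeries (Fin 3) F ⧸ Ideal.span {(f : MvPowerSeries (Fin 3) F)}) ≃+*
      MvPowerSeries (Fin 3) F ⧸ Ideal.span {(MvPowerSeries.X 0 * MvPowerSeries.X 1 -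
        MvPowerSeries.X 2 ^ 2 : MvPowerSeries (Fin 3) F)},
      ∀ a : F, e (Ideal.Quotient.mk _ (MvPowerSeries.C a)) = Ideal.Quotient.mk _ (MvPowerSeries.C a)) :
    ∃ x : hypersurface p, HasCoords p x (fun j => MvPolynomial.constantCoeff (c j)) ∧
      IsA1Singularity (hypersurface.structure p) x := by
  subst hf
  set f := MvPolynomial.aeval c p with hf
  have hchart : IsChart (D := MvPolynomial (Fin 3) F ⧸ Ideal.span {f}) p i
      fun j => Ideal.Quotient.mk _ (c j) := isChart_of_affineCoordinates hce hec hi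
  let P : Ideal (MvPolynomial (Fin 3) F ⧸ Ideal.span {f}) :=
    (MvPolynomial.idealOfVars (Fin 3) F).map (Ideal.Quotient.mk _)
  have hmax : P.IsMaximal := Ideal.IsMaximal.map_of_surjective_of_ker_le
    Ideal.Quotient.mk_surjective (by
      rw [Ideal.mk_ker, Ideal.span_singleton_le_iff_mem, mem_idealOfVars_iff, hf0])
  let Q : Spec (.of (MvPolynomial (Fin 3) F ⧸ Ideal.span {f})) :=
    (⟨P, hmax.isPrime⟩ : PrimeSpectrum (MvPolynomial (Fin 3) F ⧸ Ideal.span {f}))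
  refine ⟨hchart.chart Q, ?_, ?_⟩
  · rw [hchart.hasCoords_chart]
    intro j k
    have : MvPolynomial.C (MvPolynomial.constantCoeff (c j)) * c k -
        MvPolynomial.C (MvPolynomial.constantCoeff (c k)) * c j ∈
        MvPolynomial.idealOfVars (Fin 3) F := by
      rw [mem_idealOfVars_iff]; simp [mul_comm]
    exact Ideal.mem_map_of_mem (Ideal.Quotient.mk (Ideal.span {f})) this
  · let := (toStalkOfChart hchart.chart Q).toAlgebra
    have hloc : IsLocalization.AtPrime ((hypersurface p).presheaf.stalk (hchart.chart Q)) P :=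
      isLocalization_toStalkOfChart hchart.chart Q
    obtain ⟨e₁, he₁⟩ := exists_adicCompletion_hypersurface f hf0 P rfl
      ((hypersurface p).presheaf.stalk (hchart.chart Q))
    obtain ⟨e₂, he₂⟩ := h
    refine ⟨e₁.trans e₂, fun a => ?_⟩
    rw [scalarsToStalk_eq _ _ _ hchart.chart_structure, RingEquiv.trans_apply]
    have := he₁ (MvPolynomial.C a)
    rw [MvPolynomial.coe_C] at this
    rw [← he₂, ← this]
    rfl

end A1

/-! ### The twelve nodes are A₁ singularities -/

section Nodes
variable {F : Type u} [Field F] {l : F}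

lemma map_quarticForm {R S : Type*} [CommRing R] [CommRing S] (φ : R →+* S) (l x y z w : R) :
    φ (quarticForm l x y z w) = quarticForm (φ l) (φ x) (φ y) (φ z) (φ w) := by
  simp [quarticForm]

lemma coe_quarticForm (x y z w : MvPolynomial (Fin 3) F) :
    ((quarticForm (MvPolynomial.C l) x y z w : MvPolynomial (Fin 3) F) : MvPowerSeries (Fin 3) F) =
      quarticForm (MvPowerSeries.C l) (x : MvPowerSeries (Fin 3) F) y z w := by
  refine (map_quarticForm MvPolynomial.coeToMvPowerSeries.ringHom _ x y z w).trans ?_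
  simp only [MvPolynomial.coeToMvPowerSeries.ringHom_apply, MvPolynomial.coe_C]

-- Double transpositions of the coordinates preserve the quartic and act transitively on the
-- coordinate points, so one normal form serves all four.
open MvPolynomial in
lemma exists_coordinate_node (hF : (2 : F) ≠ 0) (h0 : l ≠ 0) (h1 : l ≠ 1) (i : Fin 4) :
    ∃ x : quarticSurface l, HasCoords (quartic l) x (Pi.single i 1) ∧
      IsA1Singularity (quarticSurface.structure l) x := by
  have key : ∀ (c : Fin 4 → MvPolynomial (Fin 3) F) (e : Fin 3 → MvPolynomial (Fin 4) F),
      (∀ k, aeval c (e k) = X k) →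
      (∀ j, aeval e (c j) - X j ∈ Ideal.span {(X i - 1 : MvPolynomial (Fin 4) F)}) → c i = 1 →
      quarticForm (C l) (c 0) (c 1) (c 2) (c 3) = quarticForm (C l) (X 0) (X 1) (X 2) 1 →
      (∀ j, constantCoeff (c j) = (Pi.single i 1 : Fin 4 → F) j) →
      ∃ x : quarticSurface l, HasCoords (quartic l) x (Pi.single i 1) ∧
        IsA1Singularity (quarticSurface.structure l) x := by
    intro c e hce hec hi hq hv
    rw [← funext hv]
    refine exists_isA1Singularity hce hec hi (f := quarticForm (C l) (X 0) (X 1) (X 2) 1)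
      ?_ ?_ ?_
    · rw [aeval_quartic, ← hq]; rfl
    · simp [quarticForm]
    · rw [coe_quarticForm, coe_X, coe_X, coe_X, coe_one]
      exact exists_ringEquiv_coordinate_node hF h0 h1
  have hone : ∀ i : Fin 4, (1 - X i : MvPolynomial (Fin 4) F) ∈ Ideal.span {(X i - 1 : MvPolynomial (Fin 4) F)} := by
    intro i
    rw [← neg_mem_iff, neg_sub]
    exact Ideal.mem_span_singleton_self _
  fin_cases i
  · refine key ![1, X 2, X 1, X 0] ![X 3, X 2, X 1] ?_ ?_ rfl ?_ ?_
    · intro k; fin_cases k <;> simp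
    · intro j; fin_cases j <;> simp [hone]
    · simp [quarticForm]; ring
    · intro j; fin_cases j <;> simp
  · refine key ![X 2, 1, X 0, X 1] ![X 2, X 3, X 0] ?_ ?_ rfl ?_ ?_
    · intro k; fin_cases k <;> simp
    · intro j; fin_cases j <;> simp [hone]
    · simp [quarticForm]; ring
    · intro j; fin_cases j <;> simp
  · refine key ![X 1, X 0, 1, X 2] ![X 1, X 0, X 3] ?_ ?_ rfl ?_ ?_
    · intro k; fin_cases k <;> simp
    · intro j; fin_cases j <;> simp [hone]
    · simp [quarticForm]; ring
    · intro j; fin_cases j <;> simp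
  · refine key ![X 0, X 1, X 2, 1] ![X 0, X 1, X 2] ?_ ?_ rfl ?_ ?_
    · intro k; fin_cases k <;> simp
    · intro j; fin_cases j <;> simp [hone]
    · simp [quarticForm]
    · intro j; fin_cases j <;> simp

-- The quartic is even in each variable, so after the substitution v j (1 + X j) the signs disappear
-- and the equation is the one at (1:1:1:1).
open MvPolynomial in
lemma exists_sign_node (hF : (2 : F) ≠ 0) (h0 : l ≠ 0) (h1 : l ≠ 1) {v : Fin 4 → F}
    (hv3 : v 3 = 1) (hv : ∀ j, v j ^ 2 = 1) :
    ∃ x : quarticSurface l, HasCoords (quartic l) x v ∧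
      IsA1Singularity (quarticSurface.structure l) x := by
  have hvC : ∀ j (R : Type) , (C (v j) ^ 2 : MvPolynomial R F) = 1 := fun j R => by
    rw [← C_pow, hv, C_1]
  have hvC' : ∀ j (R : Type) (a : MvPolynomial R F), C (v j) * (C (v j) * a) = a := fun j R a => by
    rw [← mul_assoc, ← sq, hvC, one_mul]
  let c : Fin 4 → MvPolynomial (Fin 3) F :=
    ![C (v 0) * (1 + X 0), C (v 1) * (1 + X 1), C (v 2) * (1 + X 2), 1]
  let e : Fin 3 → MvPolynomial (Fin 4) F :=
    ![C (v 0) * X 0 - 1, C (v 1) * X 1 - 1, C (v 2) * X 2 - 1]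
  have hone : (1 - X 3 : MvPolynomial (Fin 4) F) ∈
      Ideal.span {(X 3 - 1 : MvPolynomial (Fin 4) F)} := by
    rw [← neg_mem_iff, neg_sub]
    exact Ideal.mem_span_singleton_self _
  have hcv : (fun j => constantCoeff (c j)) = v := by
    ext j; fin_cases j <;> simp [c, hv3]
  rw [← hcv]
  refine exists_isA1Singularity (i := 3) (c := c) (e := e) ?_ ?_ rfl
    (f := quarticForm (C l) (1 + X 0) (1 + X 1) (1 + X 2) 1) ?_ ?_ ?_
  · intro k
    fin_cases k <;> simp [c, e, algebraMap_eq, hvC']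
  · intro j
    fin_cases j <;> simp [c, e, algebraMap_eq, hvC', hone]
  · rw [aeval_quartic]
    simp [c, quarticForm, mul_pow, hvC, algebraMap_eq]
  · simp [quarticForm]
  · rw [coe_quarticForm]
    rw [coe_add, coe_add, coe_add, coe_X, coe_X, coe_X, coe_one]
    exact exists_ringEquiv_sign_node hF h0 h1

theorem exists_isA1Singularity_of_mem_nodes (hF : (2 : F) ≠ 0) (h0 : l ≠ 0) (h1 : l ≠ 1)
    {v : Fin 4 → F} (hv : v ∈ nodes F) : ∃ x : quarticSurface l, HasCoords (quartic l) x v ∧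
      IsA1Singularity (quarticSurface.structure l) x := by
  rcases hv with ⟨i, rfl⟩ | hv
  · exact exists_coordinate_node hF h0 h1 i
  · have hv' : ∀ j, v j ^ 2 = 1 := fun j => sq_eq_one_iff.mpr (hv j)
    have h3 : v 3 * v 3 = 1 := by rw [← sq, hv']
    -- Scaling by v 3 = ±1 makes the last coordinate 1.
    obtain ⟨x, hx, hA⟩ := exists_sign_node hF h0 h1 (v := fun j => v 3 * v j) h3
      (fun j => by simp only [mul_pow, hv', one_mul])
    refine ⟨x, ?_, hA⟩
    convert hx.smul (v 3) using 2 with j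
    rw [← mul_assoc, h3, one_mul]

end Nodes

/-! ### The birational correspondence between the quartic and the double plane, over any ring -/

section Correspondence
variable {R : Type*} [CommRing R]

/-- A point of the affine chart `w = 1` of the quartic outside certain lines. -/
structure QuarticPoint (l x y z : R) : Prop where
  eq : quarticForm l x y z 1 = 0
  x_sub : IsUnit (x - 1)
  x_add : IsUnit (x + 1)
  y_sub : IsUnit (y - 1)
  y_add : IsUnit (y + 1)
  z_sub : IsUnit (z - 1)
  z_add : IsUnit (z + 1)
  z_sub_y : IsUnit (z - y)
  z_sub_x : IsUnit (z - x)
  x_sub_y : IsUnit (x - y)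
  z_sub_x_sub_y : IsUnit (z - x - y + 1)

/-- The denominator of the parametrization of the quartic. -/
def denom (l s X : R) : R := X * (l - s) * (X - s)

/-- The numerator of the parametrization of the quartic. -/
def numer (l s X t : R) : R := t - X * (l - s) * (1 - s)

/-- A point of the surface `t ^ 2 = f (s) f (X)`, where `f (s) = s (s - 1) (s - l)`, outside
certain curves. -/
structure DoublePlanePoint (l s X t : R) : Prop where
  eq : t ^ 2 = s * (s - 1) * (s - l) * (X * (X - 1) * (X - l))
  s_unit : IsUnit s
  l_sub_s : IsUnit (l - s)
  X_unit : IsUnit X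
  X_sub_s : IsUnit (X - s)
  numer_unit : IsUnit (numer l s X t)
  P : IsUnit (denom l s X + numer l s X t * X)
  Q : IsUnit (denom l s X + numer l s X t)
  D : IsUnit ((l - s) * (denom l s X + numer l s X t * X) ^ 2 - (l - 1) * s * denom l s X ^ 2)
  D' : IsUnit ((l - s) * (denom l s X + numer l s X t * X) - (l - 1) * s * denom l s X)

/-- The correspondence between the two surfaces. -/
structure Corresponds (l x y z s X t : R) : Prop where
  s_eq : s * (x ^ 2 - 1) = y ^ 2 - 1
  X_eq : X * (z - y) * (x + 1) = (z - x) * (y + 1)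
  numer_eq : numer l s X t * (y + 1) = denom l s X * (z - y)

variable {l x y z s X t : R}

lemma Corresponds.unique_right {s' X' t' : R} (hK : QuarticPoint l x y z)
    (h : Corresponds l x y z s X t) (h' : Corresponds l x y z s' X' t') :
    s = s' ∧ X = X' ∧ t = t' := by
  have h1 : s = s' := by
    refine (hK.x_sub.mul hK.x_add).mul_right_cancel ?_
    linear_combination h.s_eq - h'.s_eq
  have h2 : X = X' := by
    refine (hK.z_sub_y.mul hK.x_add).mul_right_cancel ?_
    linear_combination h.X_eq - h'.X_eq
  subst h1 h2
  refine ⟨rfl, rfl, hK.y_add.mul_right_cancel ?_⟩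
  have h3 := h.numer_eq
  have h4 := h'.numer_eq
  unfold numer at h3 h4
  linear_combination h3 - h4

/-- With ρ = numer / denom = (z-y)/(y+1), the equation for X gives ρX = (z-x)/(x+1); adding 1 gives
the slope (z+1)/(x+1) of the projection from (-1, -1, -1). -/
lemma Corresponds.P_mul (hK : QuarticPoint l x y z) (h : Corresponds l x y z s X t) :
    (denom l s X + numer l s X t * X) * (x + 1) = denom l s X * (z + 1) := by
  refine hK.y_add.mul_right_cancel ?_
  linear_combination X * (x + 1) * h.numer_eq + denom l s X * h.X_eq

/-- The quartic is q(x^2-1, y^2-1, z^2-1, 0); with y^2 - 1 = s(x^2 - 1) it is divisible by x^2 - 1,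
and what remains is the second quadric through the fibre over s. -/
lemma Corresponds.l_sub_s_mul (hK : QuarticPoint l x y z) (h : Corresponds l x y z s X t) :
    (l - s) * (z ^ 2 - 1) = (l - 1) * s * (x ^ 2 - 1) := by
  refine (hK.x_sub.mul hK.x_add).mul_right_cancel ?_
  have h1 := hK.eq
  unfold quarticForm at h1
  linear_combination - h1 + ((l - 1) * (x ^ 2 - 1) + (z ^ 2 - 1)) * (- h.s_eq)

lemma Corresponds.D_mul (hK : QuarticPoint l x y z) (h : Corresponds l x y z s X t) :
    ((l - s) * (denom l s X + numer l s X t * X) ^ 2 - (l - 1) * s * denom l s X ^ 2) *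
      ((x ^ 2 - 1) * (x + 1)) = denom l s X ^ 2 * (2 * (l - s) * (z + 1) * (x - z)) := by
  have h1 := h.l_sub_s_mul hK
  have h2 := h.P_mul hK
  linear_combination (l - s) * (x - 1) * ((denom l s X + numer l s X t * X) * (x + 1) +
    denom l s X * (z + 1)) * h2 + denom l s X ^ 2 * (x + 1) * h1

lemma Corresponds.D'_mul (hK : QuarticPoint l x y z) (h : Corresponds l x y z s X t) :
    ((l - s) * (denom l s X + numer l s X t * X) - (l - 1) * s * denom l s X) * (x ^ 2 - 1) =
      denom l s X * ((l - s) * (z + 1) * (x - z)) := by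
  have h1 := h.l_sub_s_mul hK
  have h2 := h.P_mul hK
  linear_combination (l - s) * (x - 1) * h2 + denom l s X * h1

/-- A line through the base point (-1, -1, -1) meets the fibre over s in at most one further point
in the open set considered; algebraically, x - 1 solves a linear equation with unit leading
coefficient. -/
lemma Corresponds.unique_left {x' y' z' : R}
    (hK : QuarticPoint l x y z) (hK' : QuarticPoint l x' y' z') (hT : DoublePlanePoint l s X t)
    (h : Corresponds l x y z s X t) (h' : Corresponds l x' y' z' s X t) :
    x = x' ∧ y = y' ∧ z = z' := by
  have hn : IsUnit (denom l s X) := (hT.X_unit.mul hT.l_sub_s).mul hT.X_sub_s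
  -- both `x - 1` and `x' - 1` are determined by the same linear equation
  have key : ∀ {x y z : R}, QuarticPoint l x y z → Corresponds l x y z s X t →
      ((l - s) * (denom l s X + numer l s X t * X) ^ 2 - (l - 1) * s * denom l s X ^ 2) * (x - 1) =
        - (2 * numer l s X t * X) * (l - s) * (denom l s X + numer l s X t * X) := by
    intro x y z hK h
    refine ((hK.x_add).mul hK.x_add).mul_right_cancel ?_
    have e1 := h.D_mul hK
    have e2 := h.P_mul hK
    linear_combination e1 + 2 * numer l s X t * X * (l - s) * (x + 1) * e2 +
      2 * denom l s X * (l - s) * (z + 1) * e2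
  have hx : x = x' := by
    have := hT.D.mul_left_cancel ((key hK h).trans (key hK' h').symm)
    linear_combination this
  subst hx
  have hz : z = z' := by
    have := hn.mul_left_cancel ((h.P_mul hK).symm.trans (h'.P_mul hK'))
    linear_combination this
  subst hz
  refine ⟨rfl, ?_, rfl⟩
  refine hT.Q.mul_left_cancel ?_
  linear_combination h.numer_eq - h'.numer_eq

lemma QuarticPoint.exists_corresponds (h2 : IsUnit (2 : R)) (hl : IsUnit (l - 1))
    (hK : QuarticPoint l x y z) :
    ∃ s X t, DoublePlanePoint l s X t ∧ Corresponds l x y z s X t := by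
  obtain ⟨ix, hix⟩ := (hK.x_sub.mul hK.x_add).exists_right_inv
  obtain ⟨iX, hiX⟩ := (hK.z_sub_y.mul hK.x_add).exists_right_inv
  obtain ⟨iy, hiy⟩ := hK.y_add.exists_right_inv
  obtain ⟨s, hs⟩ : ∃ s, s = (y ^ 2 - 1) * ix := ⟨_, rfl⟩
  obtain ⟨X, hX⟩ : ∃ X, X = (z - x) * (y + 1) * iX := ⟨_, rfl⟩
  obtain ⟨ρ, hρ⟩ : ∃ ρ, ρ = (z - y) * iy := ⟨_, rfl⟩
  have hs1 : s * (x ^ 2 - 1) = y ^ 2 - 1 := by rw [hs]; linear_combination (y ^ 2 - 1) * hix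
  have hX1 : X * (z - y) * (x + 1) = (z - x) * (y + 1) := by
    rw [hX]; linear_combination (z - x) * (y + 1) * hiX
  have hρ1 : ρ * (y + 1) = z - y := by rw [hρ]; linear_combination (z - y) * hiy
  -- Half the derivative of the quadratic equation for ρ, that is, the square root of its reduced
  -- discriminant.
  let t := X * (l - s) * ((X - s) * ρ + (1 - s))
  have hnum : numer l s X t = denom l s X * ρ := by simp only [numer, denom, t]; ring
  have hC : Corresponds l x y z s X t := ⟨hs1, hX1, by rw [hnum]; linear_combination denom l s X * hρ1⟩
  have hsu : IsUnit s := by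
    refine isUnit_of_mul_isUnit_left (y := x ^ 2 - 1) ?_
    rw [hs1, show y ^ 2 - 1 = (y - 1) * (y + 1) by ring]
    exact hK.y_sub.mul hK.y_add
  have hx2 : IsUnit (x ^ 2 - 1) := by
    rw [show x ^ 2 - 1 = (x - 1) * (x + 1) by ring]; exact hK.x_sub.mul hK.x_add
  have hau : IsUnit (l - s) := by
    refine isUnit_of_mul_isUnit_left (y := z ^ 2 - 1) ?_
    rw [hC.l_sub_s_mul hK]
    exact (hl.mul hsu).mul hx2
  have hXu : IsUnit X := by
    refine isUnit_of_mul_isUnit_left (y := (z - y) * (x + 1)) ?_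
    rw [← mul_assoc, hX1]
    exact hK.z_sub_x.mul hK.y_add
  have hXsu : IsUnit (X - s) := by
    refine isUnit_of_mul_isUnit_left (y := (z - y) * (x ^ 2 - 1)) ?_
    have : (X - s) * ((z - y) * (x ^ 2 - 1)) = (y + 1) * ((x - y) * (z - x - y + 1)) := by
      linear_combination (x - 1) * hX1 - (z - y) * hs1
    rw [this]
    exact hK.y_add.mul (hK.x_sub_y.mul hK.z_sub_x_sub_y)
  have hρu : IsUnit ρ := isUnit_of_mul_isUnit_left (hρ1 ▸ hK.z_sub_y)
  have hn : IsUnit (denom l s X) := (hXu.mul hau).mul hXsu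
  have hxz : IsUnit (x - z) := by rw [← neg_sub]; exact hK.z_sub_x.neg
  refine ⟨s, X, t, ⟨?_, hsu, hau, hXu, hXsu, hnum ▸ hn.mul hρu, ?_, ?_, ?_, ?_⟩, hC⟩
  · -- the defining equation of the double plane
    have e1 : (s * (l - s) * (1 + ρ) ^ 2 - (l - 1) * s) * ((x ^ 2 - 1) * (y + 1)) =
        2 * (l - s) * (z + 1) * (y - z) := by
      refine hsu.mul_left_cancel ?_
      have hβ := hC.l_sub_s_mul hK
      linear_combination ((s * (l - s) * (1 + ρ) ^ 2 - (l - 1) * s) * (y + 1)) * hs1 +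
        s * (l - s) * (y - 1) * ((1 + ρ) * (y + 1) + (z + 1)) * hρ1 + s * (y + 1) * hβ +
        (l - 1) * s * (y + 1) * hs1
    have e2 : ((l - s) * (1 + ρ * X) ^ 2 - (l - 1) * s) * ((x ^ 2 - 1) * (x + 1)) =
        2 * (l - s) * (z + 1) * (x - z) := by
      refine (hn.pow 2).mul_left_cancel ?_
      have := hC.D_mul hK
      rw [hnum] at this
      linear_combination this
    -- The plane cubic obtained by projection. As an equation in ρ it is quadratic with leading
    -- coefficient ± `denom`; multiplying by it completes the square.
    have e3 : X * (s * (l - s) * (1 + ρ) ^ 2 - (l - 1) * s) =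
        (l - s) * (1 + ρ * X) ^ 2 - (l - 1) * s := by
      refine ((hx2.mul hK.y_add).mul hK.x_add).mul_right_cancel ?_
      linear_combination X * (x + 1) * e1 - (y + 1) * e2 - 2 * (l - s) * (z + 1) * hX1
    linear_combination (-X * (l - s) * (X - s)) * e3
  · refine isUnit_of_mul_isUnit_left (y := x + 1) ?_
    rw [hC.P_mul hK]
    exact hn.mul hK.z_add
  · refine isUnit_of_mul_isUnit_left (y := y + 1) ?_
    have : (denom l s X + numer l s X t) * (y + 1) = denom l s X * (z + 1) := by
      linear_combination hC.numer_eq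
    rw [this]
    exact hn.mul hK.z_add
  · refine isUnit_of_mul_isUnit_left (y := (x ^ 2 - 1) * (x + 1)) ?_
    rw [hC.D_mul hK]
    exact (hn.pow 2).mul (((h2.mul hau).mul hK.z_add).mul hxz)
  · refine isUnit_of_mul_isUnit_left (y := x ^ 2 - 1) ?_
    rw [hC.D'_mul hK]
    exact hn.mul ((hau.mul hK.z_add).mul hxz)

/-- The inverse map. The slopes P = (z+1)/(x+1) and Q = (z+1)/(y+1) are known, and on the fibre x^2
- 1, y^2 - 1, z^2 - 1 are to be k(z+1) times a, sa, c. So x - 1 = kaP, y - 1 = ksaQ, z - 1 = kc, and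
only the scalar k is left to find. -/
lemma DoublePlanePoint.exists_corresponds (h2 : IsUnit (2 : R)) (hl : IsUnit (l - 1))
    (hT : DoublePlanePoint l s X t) :
    ∃ x y z, QuarticPoint l x y z ∧ Corresponds l x y z s X t := by
  have hn : IsUnit (denom l s X) := (hT.X_unit.mul hT.l_sub_s).mul hT.X_sub_s
  obtain ⟨i, hi⟩ := hn.exists_right_inv
  obtain ⟨ρ, hρ⟩ : ∃ ρ, ρ = numer l s X t * i := ⟨_, rfl⟩
  have hnρ : numer l s X t = denom l s X * ρ := by
    rw [hρ]; linear_combination - numer l s X t * hi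
  obtain ⟨a, ha⟩ : ∃ a, a = l - s := ⟨_, rfl⟩
  obtain ⟨c, hc⟩ : ∃ c, c = (l - 1) * s := ⟨_, rfl⟩
  obtain ⟨P, hP⟩ : ∃ P, P = 1 + ρ * X := ⟨_, rfl⟩
  obtain ⟨Q, hQ⟩ : ∃ Q, Q = 1 + ρ := ⟨_, rfl⟩
  obtain ⟨D, hD⟩ : ∃ D, D = a * P ^ 2 - c := ⟨_, rfl⟩
  have hρu : IsUnit ρ := isUnit_of_mul_isUnit_right (hnρ ▸ hT.numer_unit)
  have hau : IsUnit a := ha ▸ hT.l_sub_s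
  have hcu : IsUnit c := hc ▸ hl.mul hT.s_unit
  have hPu : IsUnit P := by
    refine isUnit_of_mul_isUnit_right (x := denom l s X) ?_
    convert hT.P using 1
    rw [hP, hnρ]; ring
  have hQu : IsUnit Q := by
    refine isUnit_of_mul_isUnit_right (x := denom l s X) ?_
    convert hT.Q using 1
    rw [hQ, hnρ]; ring
  have hDu : IsUnit D := by
    refine isUnit_of_mul_isUnit_right (x := denom l s X ^ 2) ?_
    convert hT.D using 1
    rw [hD, hP, hnρ, ha, hc]; ring
  have hD'u : IsUnit (a * P - c) := by
    refine isUnit_of_mul_isUnit_right (x := denom l s X) ?_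
    convert hT.D' using 1
    rw [hP, hnρ, ha, hc]; ring
  have ht : t = X * a * ((X - s) * ρ + (1 - s)) := by
    have := hnρ
    unfold numer denom at this
    rw [ha]
    linear_combination this
  -- The equation of the double plane is `denom` times the plane cubic, and `denom` is a unit.
  have e3 : X * (s * a * Q ^ 2 - c) = D := by
    refine hn.mul_left_cancel ?_
    have := hT.eq
    rw [ht] at this
    rw [hD, hP, hQ, hc]
    rw [ha] at this ⊢
    unfold denom
    linear_combination - this
  obtain ⟨iD, hiD⟩ := hDu.exists_right_inv
  -- Forced by P (x + 1) = z + 1: substituting x = 1 + kaP and z = 1 + kc gives k (aP^2 - c) = 2 -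
  -- 2P = -2ρX. The slope Q gives the same k by the cubic relation.
  obtain ⟨k, hk⟩ : ∃ k, k = -(2 * (ρ * X)) * iD := ⟨_, rfl⟩
  have hkD : k * D = -(2 * (ρ * X)) := by rw [hk]; linear_combination -(2 * (ρ * X)) * hiD
  have hku : IsUnit k := isUnit_of_mul_isUnit_left (hkD ▸ (h2.mul (hρu.mul hT.X_unit)).neg)
  obtain ⟨x, hx⟩ : ∃ x, x = 1 + k * a * P := ⟨_, rfl⟩
  obtain ⟨y, hy⟩ : ∃ y, y = 1 + k * (s * a) * Q := ⟨_, rfl⟩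
  obtain ⟨z, hz⟩ : ∃ z, z = 1 + k * c := ⟨_, rfl⟩
  have hPx : P * (x + 1) = z + 1 := by
    rw [hx, hz]
    linear_combination hkD - k * hD + 2 * hP
  have hQy : Q * (y + 1) = z + 1 := by
    refine hT.X_unit.mul_left_cancel ?_
    rw [hy, hz]
    linear_combination hkD + k * e3 + 2 * X * hQ
  -- Up to units z + 1 equals aP - c, which is why `D'` is among the inverted functions.
  have hzu : IsUnit (z + 1) := by
    refine isUnit_of_mul_isUnit_right (x := D) ?_
    have : D * (z + 1) = 2 * P * (a * P - c) := by
      rw [hz]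
      linear_combination c * hkD + 2 * hD + 2 * c * hP
    rw [this]
    exact (h2.mul hPu).mul hD'u
  have hxu : IsUnit (x + 1) := isUnit_of_mul_isUnit_right (hPx ▸ hzu)
  have hyu : IsUnit (y + 1) := isUnit_of_mul_isUnit_right (hQy ▸ hzu)
  have hx2 : x ^ 2 - 1 = k * a * (z + 1) := by
    linear_combination (x + 1) * hx + k * a * hPx
  have hy2 : y ^ 2 - 1 = k * (s * a) * (z + 1) := by
    linear_combination (y + 1) * hy + k * (s * a) * hQy
  have hz2 : z ^ 2 - 1 = k * c * (z + 1) := by linear_combination (z + 1) * hz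
  have hzy : z - y = ρ * (y + 1) := by linear_combination - hQy + (y + 1) * hQ
  have hzx : z - x = ρ * X * (x + 1) := by linear_combination - hPx + (x + 1) * hP
  have hx1 : IsUnit (x - 1) := by rw [hx, add_sub_cancel_left]; exact (hku.mul hau).mul hPu
  have hzyu : IsUnit (z - y) := hzy ▸ hρu.mul hyu
  have hprod : IsUnit ((y + 1) * ((x - y) * (z - x - y + 1))) := by
    have : (y + 1) * ((x - y) * (z - x - y + 1)) = (X - s) * ((z - y) * ((x - 1) * (x + 1))) := by
      linear_combination - (x - 1) * ((x + 1) * X * hzy - (y + 1) * hzx) + (z - y) * s * hx2 -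
        (z - y) * hy2
    rw [this]
    exact hT.X_sub_s.mul (hzyu.mul (hx1.mul hxu))
  have hprod' := isUnit_of_mul_isUnit_right hprod
  refine ⟨x, y, z, ⟨?_, hx1, hxu, ?_, hyu, ?_, hzu, hzyu, ?_, isUnit_of_mul_isUnit_left hprod',
    isUnit_of_mul_isUnit_right hprod'⟩, ?_, ?_, ?_⟩
  · have : quarticForm l x y z 1 = squareForm l (x ^ 2 - 1) (y ^ 2 - 1) (z ^ 2 - 1) 0 := by
      unfold quarticForm squareForm; ring
    rw [this, hx2, hy2, hz2, ha, hc]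
    unfold squareForm; ring
  · rw [hy, add_sub_cancel_left]; exact (hku.mul (hT.s_unit.mul hau)).mul hQu
  · rw [hz, add_sub_cancel_left]; exact hku.mul hcu
  · rw [hzx]; exact (hρu.mul hT.X_unit).mul hxu
  · rw [hx2, hy2]; ring
  · rw [hzx, hzy]; ring
  · rw [hnρ, hzy]; ring

end Correspondence

/-! ### Linear forms that are non-zero-divisors on the quartic -/

section LinearForms
variable {F : Type u} [Field F] {σ : Type} [Fintype σ]

/-- The linear form with given coefficients. -/
def linearForm (c : σ → F) : MvPolynomial σ F := ∑ j, MvPolynomial.C (c j) * MvPolynomial.X j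

lemma isHomogeneous_linearForm (c : σ → F) : (linearForm c).IsHomogeneous 1 :=
  MvPolynomial.IsHomogeneous.sum _ _ _ fun j _ => by
    simpa using (MvPolynomial.isHomogeneous_C σ (c j)).mul (MvPolynomial.isHomogeneous_X F j)

lemma aeval_linearForm {R : Type*} [CommRing R] [Algebra F R] (c : σ → F) (d : σ → R) :
    MvPolynomial.aeval d (linearForm c) = ∑ j, algebraMap F R (c j) * d j := by
  simp [linearForm]

/-- A linear form that vanishes at a rational point off the hypersurface is a non-zero-divisor
modulo the equation of the hypersurface. -/
lemma mk_linearForm_mem_nonZeroDivisors {p : MvPolynomial σ F} (c v : σ → F) {i : σ}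
    (hi : c i = 1) (hv : ∑ j, c j * v j = 0) (hp : MvPolynomial.eval v p ≠ 0) :
    Ideal.Quotient.mk (Ideal.span {p}) (linearForm c) ∈ nonZeroDivisors (CoordRing p) := by
  classical
  set L := linearForm c with hL
  -- Eliminating the i-th variable by means of L: φ kills L and is the identity modulo L, so it
  -- realizes the domain F[X]/(L) inside F[X]. Hence L is prime, and it does not divide p because p
  -- is nonzero at a zero of L.
  let φ : MvPolynomial σ F →ₐ[F] MvPolynomial σ F :=
    MvPolynomial.aeval fun j => MvPolynomial.X j - if j = i then L else 0
  have hφL : φ L = 0 := by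
    rw [hL]
    refine (aeval_linearForm c _).trans ?_
    simp [mul_sub, Finset.sum_sub_distrib, hi, MvPolynomial.algebraMap_eq]
    exact sub_self L
  have hφ : ∀ a, L ∣ a - φ a := by
    intro a
    rw [← Ideal.mem_span_singleton, ← Ideal.Quotient.eq]
    have : Ideal.Quotient.mkₐ F (Ideal.span {L}) = (Ideal.Quotient.mkₐ F (Ideal.span {L})).comp φ := by
      apply MvPolynomial.algHom_ext
      intro j
      rw [AlgHom.comp_apply]
      refine Ideal.Quotient.eq.mpr (Ideal.mem_span_singleton.mpr ?_)
      simp only [φ, MvPolynomial.aeval_X]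
      split_ifs <;> simp
    exact DFunLike.congr_fun this a
  have hLv : MvPolynomial.eval v L = 0 := by
    rw [hL, linearForm]; simpa using hv
  have hφp : φ p ≠ 0 := by
    intro h
    obtain ⟨b, hb⟩ := hφ p
    rw [h, sub_zero] at hb
    apply hp
    rw [hb, map_mul, hLv, zero_mul]
  have hL0 : L ≠ 0 := by
    intro h
    have := aeval_linearForm c (fun j => if j = i then (1 : F) else 0)
    rw [← hL, h] at this
    simp [hi] at this
  rw [mem_nonZeroDivisors_iff_right]
  intro a ha
  obtain ⟨a, rfl⟩ := Ideal.Quotient.mk_surjective a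
  rw [← map_mul, Ideal.Quotient.eq_zero_iff_mem, Ideal.mem_span_singleton] at ha
  obtain ⟨b, hb⟩ := ha
  have hb0 : φ b = 0 := by
    have h := congr(φ $hb)
    rw [map_mul, map_mul, hφL, mul_zero] at h
    exact (mul_eq_zero.mp h.symm).resolve_left hφp
  obtain ⟨e, he⟩ := hφ b
  rw [hb0, sub_zero] at he
  rw [Ideal.Quotient.eq_zero_iff_mem, Ideal.mem_span_singleton]
  refine ⟨e, mul_right_cancel₀ hL0 ?_⟩
  rw [hb, he]; ring

end LinearForms

section
variable {F : Type u} [Field F] (l : F)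

/-- The coefficients of the linear forms that have to be inverted. -/
def lineCoeffs (F : Type u) [Field F] : Fin 11 → Fin 4 → F :=
  ![![0, 0, 0, 1], ![1, 0, 0, -1], ![1, 0, 0, 1], ![0, 1, 0, -1], ![0, 1, 0, 1], ![0, 0, 1, -1],
    ![0, 0, 1, 1], ![0, -1, 1, 0], ![-1, 0, 1, 0], ![1, -1, 0, 0], ![-1, -1, 1, 1]]

/-- The product of the linear forms that have to be inverted. -/
def lineProduct (F : Type u) [Field F] : MvPolynomial (Fin 4) F :=
  ∏ k, linearForm (lineCoeffs F k)

lemma isHomogeneous_lineProduct : (lineProduct F).IsHomogeneous 11 := by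
  have := MvPolynomial.IsHomogeneous.prod Finset.univ (fun k => linearForm (lineCoeffs F k))
    (fun _ => 1) fun k _ => isHomogeneous_linearForm _
  simpa [lineProduct] using this

lemma mk_lineProduct_mem_nonZeroDivisors (h0 : l ≠ 0) (h1 : l ≠ 1) :
    Ideal.Quotient.mk (Ideal.span {quartic l}) (lineProduct F) ∈
      nonZeroDivisors (CoordRing (quartic l)) := by
  rw [lineProduct, map_prod]
  refine prod_mem fun k _ => ?_
  -- For each form: the index of a coefficient 1, and a zero of the form with two coordinates 1 and
  -- two coordinates 0. At such a point the quartic takes one of its coefficients 1, -l, l - 1 as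
  -- value.
  let w : Fin 11 → Fin 4 × (Fin 4 → F) :=
    ![(3, ![0, 1, 1, 0]), (0, ![0, 1, 1, 0]), (0, ![0, 1, 1, 0]), (1, ![1, 0, 1, 0]),
      (1, ![1, 0, 1, 0]), (2, ![1, 1, 0, 0]), (2, ![1, 1, 0, 0]), (2, ![1, 0, 0, 1]),
      (2, ![0, 1, 0, 1]), (0, ![0, 0, 1, 1]), (2, ![0, 1, 1, 0])]
  have h1' := sub_ne_zero.mpr h1
  refine mk_linearForm_mem_nonZeroDivisors _ (w k).2 (i := (w k).1) ?_ ?_ ?_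
  · fin_cases k <;> rfl
  · fin_cases k <;> simp [w, lineCoeffs, Fin.sum_univ_four]
  · rw [← MvPolynomial.coe_aeval_eq_eval, RingHom.coe_coe, aeval_quartic]
    fin_cases k <;> simp [w, quarticForm, h0, h1']

end
-- The double plane and the isomorphism of localized coordinate rings
section Maps
variable {R S : Type*} [CommRing R] [CommRing S] (φ : R →+* S) {l x y z s X t : R}

lemma Corresponds.map (h : Corresponds l x y z s X t) :
    Corresponds (φ l) (φ x) (φ y) (φ z) (φ s) (φ X) (φ t) := by
  refine ⟨?_, ?_, ?_⟩
  · simpa using congr(φ $h.s_eq)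
  · simpa using congr(φ $h.X_eq)
  · simpa [numer, denom] using congr(φ $h.numer_eq)

lemma QuarticPoint.map (h : QuarticPoint l x y z) : QuarticPoint (φ l) (φ x) (φ y) (φ z) := by
  refine ⟨?_, ?_, ?_, ?_, ?_, ?_, ?_, ?_, ?_, ?_, ?_⟩
  · simpa [quarticForm] using congr(φ $h.eq)
  · simpa using h.x_sub.map φ
  · simpa using h.x_add.map φ
  · simpa using h.y_sub.map φ
  · simpa using h.y_add.map φ
  · simpa using h.z_sub.map φ
  · simpa using h.z_add.map φ
  · simpa using h.z_sub_y.map φ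
  · simpa using h.z_sub_x.map φ
  · simpa using h.x_sub_y.map φ
  · simpa using h.z_sub_x_sub_y.map φ

end Maps

section DoublePlane
variable {F : Type u} [Field F] (l : F)

/-- The equation of the double plane `t ^ 2 = f (s) f (X)`, where `f (s) = s (s - 1) (s - l)`. -/
def doublePlaneEquation : MvPolynomial (Fin 3) F :=
  MvPolynomial.X 2 ^ 2 - MvPolynomial.X 0 * (MvPolynomial.X 0 - 1) *
    (MvPolynomial.X 0 - MvPolynomial.C l) *
    (MvPolynomial.X 1 * (MvPolynomial.X 1 - 1) * (MvPolynomial.X 1 - MvPolynomial.C l))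

/-- The coordinate ring of the double plane. -/
abbrev DoublePlane : Type u := MvPolynomial (Fin 3) F ⧸ Ideal.span {doublePlaneEquation l}

namespace DoublePlane

/-- The coordinates `s, X, t` on the double plane. -/
def coord (i : Fin 3) : DoublePlane l := Ideal.Quotient.mk _ (MvPolynomial.X i)

variable {l} {R : Type*} [CommRing R] [Algebra F R]

lemma coord_eq : coord l 2 ^ 2 = coord l 0 * (coord l 0 - 1) * (coord l 0 - algebraMap F _ l) *
    (coord l 1 * (coord l 1 - 1) * (coord l 1 - algebraMap F _ l)) := by
  rw [← sub_eq_zero]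
  have : Ideal.Quotient.mk (Ideal.span {doublePlaneEquation l}) (doublePlaneEquation l) = 0 :=
    Ideal.Quotient.eq_zero_iff_mem.mpr (Ideal.mem_span_singleton_self _)
  exact this

lemma algHom_ext {f g : DoublePlane l →ₐ[F] R} (h : ∀ i, f (coord l i) = g (coord l i)) :
    f = g := by
  apply Ideal.Quotient.algHom_ext
  apply MvPolynomial.algHom_ext
  exact h

lemma exists_algHom (s X t : R) (h : t ^ 2 = s * (s - 1) * (s - algebraMap F R l) *
    (X * (X - 1) * (X - algebraMap F R l))) :
    ∃ φ : DoublePlane l →ₐ[F] R,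
      φ (coord l 0) = s ∧ φ (coord l 1) = X ∧ φ (coord l 2) = t := by
  refine ⟨Ideal.Quotient.liftₐ _ (MvPolynomial.aeval ![s, X, t]) ?_, ?_, ?_, ?_⟩
  · intro a ha
    obtain ⟨b, rfl⟩ := Ideal.mem_span_singleton.mp ha
    rw [map_mul]
    have : MvPolynomial.aeval ![s, X, t] (doublePlaneEquation l) = 0 := by
      simp [doublePlaneEquation, h]
    rw [this, zero_mul]
  all_goals exact MvPolynomial.aeval_X ![s, X, t] _

end DoublePlane

/-- The product of the functions of a point of the double plane that have to be invertible. -/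
def doublePlaneProduct {R : Type*} [CommRing R] (l s X t : R) : R :=
  s * (l - s) * X * (X - s) * numer l s X t * (denom l s X + numer l s X t * X) *
    (denom l s X + numer l s X t) *
    ((l - s) * (denom l s X + numer l s X t * X) ^ 2 - (l - 1) * s * denom l s X ^ 2) *
    ((l - s) * (denom l s X + numer l s X t * X) - (l - 1) * s * denom l s X)

lemma doublePlanePoint_iff {R : Type*} [CommRing R] {l s X t : R} :
    DoublePlanePoint l s X t ↔ t ^ 2 = s * (s - 1) * (s - l) * (X * (X - 1) * (X - l)) ∧
      IsUnit (doublePlaneProduct l s X t) := by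
  simp only [doublePlaneProduct, IsUnit.mul_iff]
  exact ⟨fun ⟨h, h1, h2, h3, h4, h5, h6, h7, h8, h9⟩ => by tauto,
    fun ⟨h, ⟨⟨⟨⟨⟨⟨⟨h1, h2⟩, h3⟩, h4⟩, h5⟩, h6⟩, h7⟩, h8⟩, h9⟩ =>
      ⟨h, h1, h2, h3, h4, h5, h6, h7, h8, h9⟩⟩

lemma map_doublePlaneProduct {R S : Type*} [CommRing R] [CommRing S] (φ : R →+* S) (l s X t : R) :
    φ (doublePlaneProduct l s X t) = doublePlaneProduct (φ l) (φ s) (φ X) (φ t) := by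
  simp [doublePlaneProduct, numer, denom]

lemma quarticPoint_iff {R : Type*} [CommRing R] [Algebra F R] {x y z : R} :
    QuarticPoint (algebraMap F R l) x y z ↔
      MvPolynomial.aeval ![x, y, z, 1] (quartic l) = 0 ∧
      IsUnit (MvPolynomial.aeval ![x, y, z, 1] (lineProduct F)) := by
  rw [aeval_quartic]
  have : MvPolynomial.aeval ![x, y, z, 1] (lineProduct F) =
      (x - 1) * (x + 1) * (y - 1) * (y + 1) * (z - 1) * (z + 1) * (z - y) * (z - x) * (x - y) *
        (z - x - y + 1) := by
    rw [lineProduct, map_prod]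
    simp [Fin.prod_univ_succ, aeval_linearForm, lineCoeffs, Fin.sum_univ_succ]
    ring
  rw [this]
  simp only [IsUnit.mul_iff]
  exact ⟨fun ⟨h, h1, h2, h3, h4, h5, h6, h7, h8, h9, h10⟩ => ⟨by simpa using h, by tauto⟩,
    fun ⟨h, ⟨⟨⟨⟨⟨⟨⟨⟨⟨h1, h2⟩, h3⟩, h4⟩, h5⟩, h6⟩, h7⟩, h8⟩, h9⟩, h10⟩⟩ =>
      ⟨by simpa using h, h1, h2, h3, h4, h5, h6, h7, h8, h9, h10⟩⟩

/-- The function on the double plane that has to be inverted. -/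
abbrev DoublePlane.locus : DoublePlane l :=
  doublePlaneProduct (algebraMap F _ l) (coord l 0) (coord l 1) (coord l 2)

variable {l}

/-- Yoneda's argument: the tautological point of either ring corresponds to a point of the other
surface with values in it, which defines homomorphisms both ways; uniqueness of corresponding points
makes them inverse to each other. -/
lemma exists_algEquiv {D : Type u} [CommRing D] [Algebra F D] {d : Fin 4 → D}
    (h : IsChart (quartic l) 3 d) (hF : (2 : F) ≠ 0) (h1 : l ≠ 1) :
    Nonempty (Localization.Away (DoublePlane.locus l) ≃ₐ[F]
      Localization.Away (MvPolynomial.aeval d (lineProduct F))) := by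
  set A := Localization.Away (MvPolynomial.aeval d (lineProduct F)) with hA
  set T := Localization.Away (DoublePlane.locus l) with hT
  have hl : ∀ (R : Type u) [CommRing R] [Algebra F R], IsUnit (algebraMap F R l - 1) := by
    intro R _ _
    simpa using (sub_ne_zero.mpr h1).isUnit.map (algebraMap F R)
  have h2 : ∀ (R : Type u) [CommRing R] [Algebra F R], IsUnit (2 : R) := by
    intro R _ _
    have := hF.isUnit.map (algebraMap F R)
    rwa [map_ofNat] at this
  let α : D →ₐ[F] A := IsScalarTower.toAlgHom F D A
  let β : DoublePlane l →ₐ[F] T := IsScalarTower.toAlgHom F (DoublePlane l) T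
  have hd : (fun j => α (d j)) = ![α (d 0), α (d 1), α (d 2), 1] := by
    ext j
    fin_cases j
    · rfl
    · rfl
    · rfl
    · change α (d 3) = 1
      rw [h.coord_eq_one, map_one]
  have hQA : QuarticPoint (algebraMap F A l) (α (d 0)) (α (d 1)) (α (d 2)) := by
    rw [quarticPoint_iff, ← hd, ← MvPolynomial.comp_aeval_apply, ← MvPolynomial.comp_aeval_apply,
      h.aeval_eq_zero, map_zero]
    exact ⟨rfl, IsLocalization.Away.algebraMap_isUnit _⟩
  have hPT : DoublePlanePoint (algebraMap F T l) (β (DoublePlane.coord l 0))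
      (β (DoublePlane.coord l 1)) (β (DoublePlane.coord l 2)) := by
    rw [doublePlanePoint_iff]
    refine ⟨?_, ?_⟩
    · simpa using congr(β $(DoublePlane.coord_eq (l := l)))
    · have := map_doublePlaneProduct β.toRingHom (algebraMap F _ l) (DoublePlane.coord l 0)
        (DoublePlane.coord l 1) (DoublePlane.coord l 2)
      have e : β.toRingHom (algebraMap F _ l) = algebraMap F T l := β.commutes l
      rw [e] at this
      refine this ▸ ?_
      exact IsLocalization.Away.algebraMap_isUnit (DoublePlane.locus l)
  obtain ⟨s, X, t, hPA, hCA⟩ := hQA.exists_corresponds (h2 A) (hl A)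
  obtain ⟨x, y, z, hQT, hCT⟩ := hPT.exists_corresponds (h2 T) (hl T)
  obtain ⟨ψ₀, hs, hX, ht⟩ := DoublePlane.exists_algHom s X t hPA.eq
  obtain ⟨φ₀, hφ₀⟩ : ∃ φ₀ : D →ₐ[F] T, ∀ j, φ₀ (d j) = ![x, y, z, 1] j := by
    have hc := ((quarticPoint_iff l).mp hQT).1
    have hc1 : ![x, y, z, 1] 3 = 1 := rfl
    exact ⟨h.lift _ hc hc1, h.lift_coord _ hc hc1⟩
  have hψu : ∀ w : Submonoid.powers (DoublePlane.locus l), IsUnit (ψ₀ w) := by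
    rintro ⟨_, n, rfl⟩
    change IsUnit (ψ₀ (_ ^ n))
    rw [map_pow]
    refine IsUnit.pow n ?_
    have := map_doublePlaneProduct ψ₀.toRingHom (algebraMap F _ l) (DoublePlane.coord l 0)
        (DoublePlane.coord l 1) (DoublePlane.coord l 2)
    refine this ▸ ?_
    have e : ψ₀.toRingHom (algebraMap F _ l) = algebraMap F A l := ψ₀.commutes l
    have := (doublePlanePoint_iff.mp hPA).2
    rw [e]
    rwa [← hs, ← hX, ← ht] at this
  have hφu : ∀ w : Submonoid.powers (MvPolynomial.aeval d (lineProduct F)), IsUnit (φ₀ w) := by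
    rintro ⟨_, n, rfl⟩
    change IsUnit (φ₀ (_ ^ n))
    rw [map_pow]
    refine IsUnit.pow n ?_
    rw [MvPolynomial.comp_aeval_apply, funext hφ₀]
    exact ((quarticPoint_iff l).mp hQT).2
  let ψ : T →ₐ[F] A := IsLocalization.liftAlgHom (M := Submonoid.powers _) (f := ψ₀) hψu
  let φ : A →ₐ[F] T := IsLocalization.liftAlgHom (M := Submonoid.powers _) (f := φ₀) hφu
  have hψβ : ∀ w, ψ (β w) = ψ₀ w := fun w => IsLocalization.lift_eq hψu w
  have hφα : ∀ w, φ (α w) = φ₀ w := fun w => IsLocalization.lift_eq hφu w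
  have e1 := hCA.map φ.toRingHom
  have e2 := hCT.map ψ.toRingHom
  have hQ' := hQT.map ψ.toRingHom
  have hφl : φ.toRingHom (algebraMap F A l) = algebraMap F T l := φ.commutes l
  have hψl : ψ.toRingHom (algebraMap F T l) = algebraMap F A l := ψ.commutes l
  rw [hφl] at e1
  rw [hψl] at e2 hQ'
  change Corresponds _ (φ (α (d 0))) (φ (α (d 1))) (φ (α (d 2))) (φ s) (φ X) (φ t) at e1
  change Corresponds _ (ψ x) (ψ y) (ψ z) (ψ (β _)) (ψ (β _)) (ψ (β _)) at e2
  change QuarticPoint _ (ψ x) (ψ y) (ψ z) at hQ'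
  rw [hφα, hφα, hφα, hφ₀, hφ₀, hφ₀] at e1
  rw [hψβ, hψβ, hψβ, hs, hX, ht] at e2
  obtain ⟨a1, a2, a3⟩ := Corresponds.unique_right hQT e1 hCT
  obtain ⟨b1, b2, b3⟩ := Corresponds.unique_left hQ' hQA hPA e2 hCA
  refine ⟨AlgEquiv.ofAlgHom ψ φ ?_ ?_⟩
  · refine IsLocalization.algHom_ext (Submonoid.powers (MvPolynomial.aeval d (lineProduct F))) ?_
    refine h.algHom_ext fun j => ?_
    change ψ (φ (α (d j))) = α (d j)
    rw [hφα, hφ₀]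
    fin_cases j
    · exact b1
    · exact b2
    · exact b3
    · change ψ 1 = α (d 3)
      rw [map_one, h.coord_eq_one, map_one]
  · refine IsLocalization.algHom_ext (Submonoid.powers (DoublePlane.locus l)) ?_
    refine DoublePlane.algHom_ext fun j => ?_
    change φ (ψ (β (DoublePlane.coord l j))) = β (DoublePlane.coord l j)
    rw [hψβ]
    fin_cases j
    · change φ (ψ₀ (DoublePlane.coord l 0)) = _
      rw [hs]; exact a1
    · change φ (ψ₀ (DoublePlane.coord l 1)) = _
      rw [hX]; exact a2
    · change φ (ψ₀ (DoublePlane.coord l 2)) = _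
      rw [ht]; exact a3

end DoublePlane
-- The quartic is birational to the double plane
section
variable {F : Type u} [Field F]

lemma Spec_map_comp_algebraMap (R S : Type u) [CommRing R] [CommRing S] [Algebra F R] [Algebra F S]
    (f : R →ₐ[F] S) : Spec.map (CommRingCat.ofHom (f : R →+* S)) ≫
      Spec.map (CommRingCat.ofHom (algebraMap F R)) =
      Spec.map (CommRingCat.ofHom (algebraMap F S)) := by
  rw [← Spec.map_comp, ← CommRingCat.ofHom_comp, AlgHom.comp_algebraMap]

lemma birationalOver_of_algEquiv {R S : Type u} [CommRing R] [CommRing S] [Algebra F R] [Algebra F S]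
    (e : R ≃ₐ[F] S) :
    Scheme.BirationalOver (Spec.map (CommRingCat.ofHom (algebraMap F S)))
      (Spec.map (CommRingCat.ofHom (algebraMap F R))) := by
  have : IsIso (Spec.map (CommRingCat.ofHom ((e : R →ₐ[F] S) : R →+* S))) := by
    have : IsIso (CommRingCat.ofHom ((e : R →ₐ[F] S) : R →+* S)) :=
      e.toRingEquiv.toCommRingCatIso.isIso_hom
    infer_instance
  exact Scheme.Hom.birationalOver _ _ _ (Spec_map_comp_algebraMap R S (e : R →ₐ[F] S))

lemma isDominant_Spec_localization {R : Type u} [CommRing R] [IsDomain R] {f : R} (hf : f ≠ 0)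
    (S : Type u) [CommRing S] [Algebra R S] [IsLocalization.Away f S] :
    IsDominant (Spec.map (CommRingCat.ofHom (algebraMap R S))) := by
  refine ⟨?_⟩
  have : Set.range (Spec.map (CommRingCat.ofHom (algebraMap R S))) =
      (PrimeSpectrum.basicOpen f : Set (PrimeSpectrum R)) :=
    PrimeSpectrum.localization_away_comap_range S f
  rw [DenseRange, this]
  refine (PrimeSpectrum.basicOpen f).2.dense ?_
  exact ⟨⊥, by simpa using hf⟩

lemma birationalOver_localization {R : Type u} [CommRing R] [IsDomain R] [Algebra F R] {f : R}
    (hf : f ≠ 0) (S : Type u) [CommRing S] [Algebra F S] [Algebra R S] [IsScalarTower F R S]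
    [IsLocalization.Away f S] :
    Scheme.BirationalOver (Spec.map (CommRingCat.ofHom (algebraMap F S)))
      (Spec.map (CommRingCat.ofHom (algebraMap F R))) := by
  have := isDominant_Spec_localization hf S
  have := AlgebraicGeometry.IsOpenImmersion.of_isLocalization (S := S) f
  exact Scheme.Hom.birationalOver (Spec.map (CommRingCat.ofHom (algebraMap R S))) _ _
    (Spec_map_comp_algebraMap R S (IsScalarTower.toAlgHom F R S))

variable {l : F}

lemma X_dvd_lineProduct : (MvPolynomial.X 3 : MvPolynomial (Fin 4) F) ∣ lineProduct F := by
  have h : linearForm (lineCoeffs F 0) = MvPolynomial.X 3 := by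
    simp [linearForm, lineCoeffs, Fin.sum_univ_four]
  rw [← h]
  exact Finset.dvd_prod_of_mem (fun k => linearForm (lineCoeffs F k)) (Finset.mem_univ 0)

/-- Since X i divides a, the locus a ≠ 0 lies inside the chart, and it is dense because a is a
non-zero-divisor. -/
lemma IsChart.isDominant_chart_localization {σ : Type} {p : MvPolynomial σ F}
    [Fact (∃ d, p.IsHomogeneous d)] {D : Type u} [CommRing D] [Algebra F D] {i : σ} {d : σ → D}
    (h : IsChart p i d) {n : ℕ} (hn : 0 < n) {a : MvPolynomial σ F} (ha : a.IsHomogeneous n)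
    (hi : MvPolynomial.X i ∣ a)
    (h0 : Ideal.Quotient.mk (Ideal.span {p}) a ∈ nonZeroDivisors (CoordRing p)) :
    IsDominant (Spec.map (CommRingCat.ofHom (algebraMap D
      (Localization.Away (MvPolynomial.aeval d a)))) ≫ h.chart) := by
  refine ⟨Dense.mono ?_ (dense_basicOpen (mk_mem_grading p ha) h0)⟩
  intro x hx
  have hxi : coord p i ∉ (show ProjectiveSpectrum (grading p) from x).asHomogeneousIdeal := by
    intro h3
    obtain ⟨b, rfl⟩ := hi
    refine hx ?_
    rw [map_mul]
    exact Ideal.mul_mem_right _ _ h3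
  obtain ⟨P, rfl⟩ := h.exists_chart_eq x hxi
  have hP : P ∈ h.chart ⁻¹ᵁ Proj.basicOpen (grading p) (Ideal.Quotient.mk _ a) := hx
  rw [h.chart_preimage_basicOpen hn ha] at hP
  obtain ⟨Q, rfl⟩ := exists_eq_of_notMem P hP
  exact ⟨Q, rfl⟩

theorem birationalOver_doublePlane (hF : (2 : F) ≠ 0) (h0 : l ≠ 0) (h1 : l ≠ 1)
    [IsDomain (DoublePlane l)] :
    Scheme.BirationalOver (quarticSurface.structure l)
      (Spec.map (CommRingCat.ofHom (algebraMap F (DoublePlane l)))) := by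
  have h := isChart_chartRing (quartic l) 3
  set d : Fin 4 → ChartRing (quartic l) 3 := fun j => Ideal.Quotient.mk _ (MvPolynomial.X j) with hd
  set G := MvPolynomial.aeval d (lineProduct F)
  let f : Spec (.of (Localization.Away G)) ⟶ quarticSurface l :=
    Spec.map (CommRingCat.ofHom (algebraMap (ChartRing (quartic l) 3) _)) ≫ h.chart
  have hf : f ≫ quarticSurface.structure l =
      Spec.map (CommRingCat.ofHom (algebraMap F (Localization.Away G))) := by
    rw [Category.assoc, h.chart_structure]
    exact Spec_map_comp_algebraMap _ _ (IsScalarTower.toAlgHom F (ChartRing (quartic l) 3) _)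
  have hdom : IsDominant f := h.isDominant_chart_localization (by norm_num)
    isHomogeneous_lineProduct X_dvd_lineProduct (mk_lineProduct_mem_nonZeroDivisors l h0 h1)
  have hop : IsOpenImmersion f := by
    have := AlgebraicGeometry.IsOpenImmersion.of_isLocalization (S := Localization.Away G) G
    infer_instance
  obtain ⟨e⟩ := exists_algEquiv h hF h1
  -- K is nonempty, since it contains a node, so a dense open of it is nonempty. Through the
  -- isomorphism, the inverted function on the integral double plane is then nonzero, and its locus
  -- is dense.
  have hne : Nontrivial (Localization.Away G) := by
    obtain ⟨x, -⟩ := exists_isA1Singularity_of_mem_nodes hF h0 h1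
      (v := Pi.single 0 1) (Or.inl ⟨0, rfl⟩)
    obtain ⟨y⟩ : Nonempty (Spec (.of (Localization.Away G))) := by
      exact hdom.1.nonempty_iff.mpr ⟨x⟩
    exact PrimeSpectrum.nonempty_iff_nontrivial.mp ⟨y⟩
  have hT : DoublePlane.locus l ≠ 0 := by
    intro h0
    have := e.symm.injective.nontrivial
    refine (IsLocalization.Away.algebraMap_isUnit (S := Localization.Away (DoublePlane.locus l))
      (DoublePlane.locus l)).ne_zero ?_
    rw [h0, map_zero]
  refine (Scheme.Hom.birationalOver f _ _ hf).symm.trans ?_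
  refine (birationalOver_of_algEquiv e).trans ?_
  exact birationalOver_localization hT _

end
-- Quotients by an involution and rings of invariants
section Quotient

lemma isIso_appLE_of_opensRange_eq {X Y : Scheme.{u}} (f : X ⟶ Y) [IsOpenImmersion f] {U : Y.Opens}
    (hU : f.opensRange = U) (e : ⊤ ≤ f ⁻¹ᵁ U) : IsIso (f.appLE U ⊤ e) := by
  subst hU
  have := f.appIso_hom' ⊤
  have h2 : IsIso (f.appLE (f ''ᵁ ⊤) ⊤ (f.preimage_image_eq ⊤).ge) := by
    rw [← this]; infer_instance
  have h3 := f.appLE_congr (f.preimage_image_eq ⊤).ge (f.image_top_eq_opensRange) rfl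
    (fun g => IsIso g)
  exact h3.mp h2

variable {X Y : Scheme.{u}} {i : X ⟶ X} {π : X ⟶ Y} (hπ : IsQuotientByInvolution i π)
  {A : Type u} [CommRing A] {k : Spec (.of A) ⟶ X} [IsOpenImmersion k] {W : Y.Opens}
  (hW : k.opensRange = π ⁻¹ᵁ W)

lemma appLE_comp_appTop {X Y Z : Scheme.{u}} (g : Z ⟶ X) (f : X ⟶ Y) (U : Y.Opens)
    (e : ⊤ ≤ f ⁻¹ᵁ U) (e' : ⊤ ≤ (g ≫ f) ⁻¹ᵁ U) :
    f.appLE U ⊤ e ≫ g.appTop = (g ≫ f).appLE U ⊤ e' := by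
  have h : g.appTop = g.appLE ⊤ (g ⁻¹ᵁ ⊤) le_rfl := g.app_eq_appLE
  rw [h]
  exact Scheme.Hom.appLE_comp_appLE g f U ⊤ (g ⁻¹ᵁ ⊤) e le_rfl

lemma top_le_of_opensRange_eq {X Y : Scheme.{u}} {f : X ⟶ Y} [IsOpenImmersion f] {U : Y.Opens}
    (hU : f.opensRange = U) : ⊤ ≤ f ⁻¹ᵁ U := by
  rintro x -
  have : f x ∈ f.opensRange := ⟨x, rfl⟩
  rw [hU] at this
  exact this

/-- The pullback of functions on `W` to an affine chart of the preimage of `W`. -/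
def pullSections (k : Spec (.of A) ⟶ X) (π : X ⟶ Y) (W : Y.Opens)
    (e : ⊤ ≤ k ⁻¹ᵁ π ⁻¹ᵁ W) : Γ(Y, W) →+* A :=
  (π.app W ≫ k.appLE (π ⁻¹ᵁ W) ⊤ e ≫ (Scheme.ΓSpecIso (.of A)).hom).hom

include hπ hW in
lemma pullSections_injective :
    Function.Injective (pullSections k π W (top_le_of_opensRange_eq hW)) := by
  have e : ⊤ ≤ k ⁻¹ᵁ π ⁻¹ᵁ W := top_le_of_opensRange_eq hW
  have := isIso_appLE_of_opensRange_eq k hW e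
  rw [pullSections, CommRingCat.hom_comp, RingHom.coe_comp]
  refine Function.Injective.comp ?_ (hπ.app_injective W)
  exact (ConcreteCategory.bijective_of_isIso (k.appLE (π ⁻¹ᵁ W) ⊤ e ≫
    (Scheme.ΓSpecIso (.of A)).hom)).1

include hπ hW in
lemma exists_pullSections_eq {ι : A →+* A}
    (hι : Spec.map (CommRingCat.ofHom ι) ≫ k = k ≫ i) {a : A} (ha : ι a = a) :
    ∃ s, pullSections k π W (top_le_of_opensRange_eq hW) s = a := by
  have e : ⊤ ≤ k ⁻¹ᵁ π ⁻¹ᵁ W := top_le_of_opensRange_eq hW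
  have := isIso_appLE_of_opensRange_eq k hW e
  let κ := k.appLE (π ⁻¹ᵁ W) ⊤ e ≫ (Scheme.ΓSpecIso (.of A)).hom
  have hκ := ConcreteCategory.bijective_of_isIso κ
  obtain ⟨t, ht⟩ := hκ.2 a
  have hU : π ⁻¹ᵁ W ≤ i ⁻¹ᵁ π ⁻¹ᵁ W := by
    rw [← Scheme.Hom.comp_preimage, hπ.invariant]
  have key : i.appLE (π ⁻¹ᵁ W) (π ⁻¹ᵁ W) hU ≫ κ = κ ≫ CommRingCat.ofHom ι := by
    simp only [κ]
    rw [← Category.assoc, Scheme.Hom.appLE_comp_appLE]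
    have e1 : ⊤ ≤ (k ≫ i) ⁻¹ᵁ π ⁻¹ᵁ W := fun x hx => hU (e hx)
    have h1 : (k ≫ i).appLE (π ⁻¹ᵁ W) ⊤ e1 =
        k.appLE (π ⁻¹ᵁ W) ⊤ e ≫ (Spec.map (CommRingCat.ofHom ι)).appTop := by
      simp only [← hι]
      exact (appLE_comp_appTop _ _ _ _ _).symm
    rw [h1, Category.assoc, Category.assoc, Scheme.ΓSpecIso_naturality]
  have hinv : i.appLE (π ⁻¹ᵁ W) (π ⁻¹ᵁ W) hU t = t := by
    apply hκ.1
    have := ConcreteCategory.congr_hom key t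
    refine this.trans ?_
    change ι (κ t) = κ t
    rw [ht, ha]
  obtain ⟨s, hs⟩ := hπ.mem_range_app W hU t hinv
  refine ⟨s, ?_⟩
  change κ (π.app W s) = a
  rw [hs, ht]

include hπ hW in
lemma pullSections_invariant {ι : A →+* A}
    (hι : Spec.map (CommRingCat.ofHom ι) ≫ k = k ≫ i) (s : Γ(Y, W)) :
    ι (pullSections k π W (top_le_of_opensRange_eq hW) s) =
      pullSections k π W (top_le_of_opensRange_eq hW) s := by
  have e0 : ⊤ ≤ k ⁻¹ᵁ π ⁻¹ᵁ W := top_le_of_opensRange_eq hW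
  have e : ⊤ ≤ (k ≫ π) ⁻¹ᵁ W := e0
  have h0 : π.app W ≫ k.appLE (π ⁻¹ᵁ W) ⊤ (top_le_of_opensRange_eq hW) = (k ≫ π).appLE W ⊤ e := by
    rw [Scheme.Hom.comp_appLE]
  have h1 : (k ≫ π).appLE W ⊤ e ≫ (Spec.map (CommRingCat.ofHom ι)).appTop =
      (k ≫ π).appLE W ⊤ e := by
    have : Spec.map (CommRingCat.ofHom ι) ≫ k ≫ π = k ≫ π := by
      rw [reassoc_of% hι, hπ.invariant]
    rw [appLE_comp_appTop _ _ _ _ (by rw [this]; exact e)]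
    simp only [this]
  have h2 : (π.app W ≫ k.appLE (π ⁻¹ᵁ W) ⊤ (top_le_of_opensRange_eq hW) ≫
      (Scheme.ΓSpecIso (.of A)).hom) ≫ CommRingCat.ofHom ι =
      π.app W ≫ k.appLE (π ⁻¹ᵁ W) ⊤ (top_le_of_opensRange_eq hW) ≫
        (Scheme.ΓSpecIso (.of A)).hom := by
    rw [reassoc_of% h0, Category.assoc, ← Scheme.ΓSpecIso_naturality, reassoc_of% h1]
  exact ConcreteCategory.congr_hom h2 s

include hπ hW in
/-- If the preimage of an affine open `W` is affine, then `W` is the spectrum of the ring of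
invariants. -/
lemma exists_openImmersion_of_invariants {ι : A →+* A}
    (hι : Spec.map (CommRingCat.ofHom ι) ≫ k = k ≫ i) (haff : IsAffineOpen W)
    {S : Type u} [CommRing S] (τ : S →+* A) (hτ : Function.Injective τ)
    (hτι : ∀ a, ι a = a ↔ a ∈ τ.range) :
    ∃ (f : Spec (.of S) ⟶ Y) (_ : IsOpenImmersion f), f.opensRange = W ∧
      Spec.map (CommRingCat.ofHom τ) ≫ f = k ≫ π := by
  have e : ⊤ ≤ k ⁻¹ᵁ π ⁻¹ᵁ W := top_le_of_opensRange_eq hW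
  have e' : ⊤ ≤ (k ≫ π) ⁻¹ᵁ W := e
  set α := pullSections k π W e with hα
  have h1 : ∀ s, α s ∈ τ.range := fun s => (hτι _).mp (pullSections_invariant hπ hW hι s)
  choose g hg using h1
  let γ : Γ(Y, W) →+* S :=
    { toFun := g
      map_one' := hτ (by rw [hg, map_one, map_one])
      map_mul' := fun a b => hτ (by rw [hg, map_mul, map_mul, hg, hg])
      map_zero' := hτ (by rw [hg, map_zero, map_zero])
      map_add' := fun a b => hτ (by rw [hg, map_add, map_add, hg, hg]) }
  have hγ : Function.Bijective γ := by
    constructor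
    · intro a b hab
      apply pullSections_injective hπ hW
      change α a = α b
      rw [← hg, ← hg]
      exact congrArg τ hab
    · intro s
      obtain ⟨t, ht⟩ := exists_pullSections_eq hπ hW hι ((hτι (τ s)).mpr ⟨s, rfl⟩)
      exact ⟨t, hτ ((hg t).trans ht)⟩
  have hτγ : τ.comp γ = α := RingHom.ext hg
  have hiso : IsIso (CommRingCat.ofHom γ : Γ(Y, W) ⟶ .of S) :=
    (RingEquiv.ofBijective γ hγ).toCommRingCatIso.isIso_hom
  refine ⟨Spec.map (CommRingCat.ofHom γ : Γ(Y, W) ⟶ .of S) ≫ haff.fromSpec, inferInstance, ?_, ?_⟩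
  · rw [Scheme.Hom.opensRange_comp_of_isIso, haff.opensRange_fromSpec]
  · rw [← Spec.map_comp_assoc]
    have : (CommRingCat.ofHom γ : Γ(Y, W) ⟶ .of S) ≫ CommRingCat.ofHom τ =
        (k ≫ π).appLE W ⊤ e' ≫ (Scheme.ΓSpecIso (.of A)).hom := by
      rw [← CommRingCat.ofHom_comp, hτγ, Scheme.Hom.comp_appLE, Category.assoc]; rfl
    rw [this, Spec.map_comp, Category.assoc,
      haff.SpecMap_appLE_fromSpec (k ≫ π) (isAffineOpen_top _), IsAffineOpen.fromSpec_top,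
      Scheme.isoSpec_Spec_inv, ← Spec.map_comp_assoc, Iso.inv_hom_id, Spec.map_id,
      Category.id_comp]

end Quotient
-- Localizing invariants; the quotient is birational to the spectrum of invariants
section Invariants
variable {C S : Type*} [CommRing C] [IsDomain C] [CommRing S] {τ : S →+* C}
  (hτ : Function.Injective τ) {ι : C →+* C} (hτι : ∀ a, ι a = a ↔ a ∈ τ.range) {M : S} (hM : M ≠ 0)
  (SM CN : Type*) [CommRing SM] [CommRing CN] [Algebra S SM] [Algebra C CN]
  [IsLocalization.Away M SM] [IsLocalization.Away (τ M) CN]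

include hτ hτι hM in
/-- Forming the invariants of an involution commutes with localization. -/
lemma exists_localized_involution :
    ∃ (τ' : SM →+* CN) (ι' : CN →+* CN), Function.Injective τ' ∧
      τ'.comp (algebraMap S SM) = (algebraMap C CN).comp τ ∧
      ι'.comp (algebraMap C CN) = (algebraMap C CN).comp ι ∧ ∀ a, ι' a = a ↔ a ∈ τ'.range := by
  have hN : τ M ≠ 0 := fun h => hM (hτ (h.trans (map_zero τ).symm))
  have hCN : Function.Injective (algebraMap C CN) :=
    IsLocalization.injective CN (powers_le_nonZeroDivisors_of_noZeroDivisors hN)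
  have hu : IsUnit (algebraMap C CN (τ M)) := IsLocalization.Away.algebraMap_isUnit _
  have h1 : IsUnit ((algebraMap C CN).comp τ M) := hu
  have h2 : IsUnit ((algebraMap C CN).comp ι (τ M)) := by
    rw [RingHom.comp_apply, (hτι (τ M)).mpr ⟨M, rfl⟩]; exact hu
  let τ' : SM →+* CN := IsLocalization.Away.lift M h1
  let ι' : CN →+* CN := IsLocalization.Away.lift (τ M) h2
  have hτ' : ∀ s, τ' (algebraMap S SM s) = algebraMap C CN (τ s) := IsLocalization.Away.lift_eq M h1
  have hι' : ∀ c, ι' (algebraMap C CN c) = algebraMap C CN (ι c) :=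
    IsLocalization.Away.lift_eq (τ M) h2
  refine ⟨τ', ι', ?_, RingHom.ext hτ', RingHom.ext hι', fun a => ⟨fun ha => ?_, ?_⟩⟩
  · rw [injective_iff_map_eq_zero]
    intro a ha
    obtain ⟨n, s, hs⟩ := IsLocalization.Away.surj M a
    have hs0 : s = 0 := by
      have := congr(τ' $hs)
      rw [map_mul, ha, zero_mul, hτ', eq_comm, map_eq_zero_iff _ hCN, map_eq_zero_iff _ hτ] at this
      exact this
    rw [hs0, map_zero] at hs
    exact ((IsLocalization.Away.algebraMap_isUnit M).pow n).mul_left_eq_zero.mp hs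
  · obtain ⟨n, c, hc⟩ := IsLocalization.Away.surj (τ M) a
    have hιc : ι c = c := by
      apply hCN
      rw [← hι', ← hc, map_mul, ha, map_pow, hι', (hτι (τ M)).mpr ⟨M, rfl⟩]
    obtain ⟨s, rfl⟩ := (hτι c).mp hιc
    obtain ⟨w, hw⟩ := ((IsLocalization.Away.algebraMap_isUnit (S := SM) M).pow n).exists_right_inv
    refine ⟨algebraMap S SM s * w, (hu.pow n).mul_right_cancel ?_⟩
    have := congr(τ' $hw)
    rw [map_mul, map_pow, hτ', map_one] at this
    rw [map_mul, hc, hτ']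
    linear_combination algebraMap C CN (τ s) * this
  · rintro ⟨b, rfl⟩
    have : ι'.comp τ' = τ' := by
      apply IsLocalization.ringHom_ext (Submonoid.powers M)
      ext s
      simp only [RingHom.comp_apply]
      rw [hτ', hι', (hτι (τ s)).mpr ⟨s, rfl⟩]
    exact congr($this b)

end Invariants

lemma eq_of_Spec_map_comp_eq {R A B : Type u} [CommRing R] [CommRing A] [CommRing B] (τ : A →+* B)
    (hτ : Function.Injective τ) {f g : Spec (.of A) ⟶ Spec (.of R)}
    (h : Spec.map (CommRingCat.ofHom τ) ≫ f = Spec.map (CommRingCat.ofHom τ) ≫ g) : f = g := by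
  obtain ⟨f, rfl⟩ := Spec.map_surjective f
  obtain ⟨g, rfl⟩ := Spec.map_surjective g
  rw [← Spec.map_comp, ← Spec.map_comp] at h
  have h2 := Spec.map_injective h
  congr 1
  ext a
  exact hτ (ConcreteCategory.congr_hom h2 a)

section
variable {F : Type u} [Field F] {X Y : Scheme.{u}} {i : X ⟶ X} {π : X ⟶ Y}
  (hπ : IsQuotientByInvolution i π) {C S : Type u} [CommRing C] [IsDomain C] [CommRing S]
  {j : Spec (.of C) ⟶ X} [IsOpenImmersion j] {ι : C →+* C}
  (hι : Spec.map (CommRingCat.ofHom ι) ≫ j = j ≫ i)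

omit [IsDomain C] in
include hπ hι in
/-- The image in the quotient of a stable affine open subset. -/
lemma exists_opens_of_stable : ∃ V : Y.Opens, j.opensRange = π ⁻¹ᵁ V ∧
    ∀ y ∈ V, ∃ c, π (j c) = y := by
  have h : π ⁻¹' (π '' Set.range j) = Set.range j := by
    refine subset_antisymm ?_ (Set.subset_preimage_image _ _)
    rintro x ⟨_, ⟨c, rfl⟩, hc⟩
    rcases hπ.orbits _ _ hc with rfl | rfl
    · exact ⟨c, rfl⟩
    · refine ⟨Spec.map (CommRingCat.ofHom ι) c, ?_⟩
      rw [← Scheme.Hom.comp_apply, hι, Scheme.Hom.comp_apply]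
  refine ⟨⟨π '' Set.range j, ?_⟩, ?_, ?_⟩
  · rw [← hπ.isQuotientMap.isOpen_preimage, h]
    exact j.opensRange.2
  · exact TopologicalSpace.Opens.ext h.symm
  · rintro _ ⟨_, ⟨c, rfl⟩, rfl⟩
    exact ⟨c, rfl⟩

-- The image V of the stable affine open is open but not known to be affine. Take an affine V' ⊆ V
-- around the image of the generic point, a nonzero h whose basic open maps into V', and the norm of
-- h. The norm is invariant, so it descends to a function n on V; the basic open of n lies in V' and
-- is a basic open of it, hence affine.
include hπ hι in
lemma exists_affine_basicOpen {τ : S →+* C} (hτι : ∀ a, ι a = a ↔ a ∈ τ.range)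
    (hιι : ∀ a, ι (ι a) = a) :
    ∃ (M : S) (W : Y.Opens), M ≠ 0 ∧ IsAffineOpen W ∧
      (∀ x, x ∈ π ⁻¹ᵁ W ↔ ∃ c ∈ PrimeSpectrum.basicOpen (τ M), j c = x) := by
  obtain ⟨V, hV, hVj⟩ := exists_opens_of_stable hπ hι
  let c₀ : Spec (.of C) := (⊥ : PrimeSpectrum C)
  have hc₀ : π (j c₀) ∈ V := by
    have : j c₀ ∈ j.opensRange := ⟨c₀, rfl⟩
    rwa [hV] at this
  obtain ⟨V', hV', hcV', hle⟩ := exists_isAffineOpen_mem_and_subset hc₀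
  obtain ⟨_, ⟨h, rfl⟩, hch, hh⟩ := (PrimeSpectrum.isTopologicalBasis_basic_opens
    (R := C)).exists_subset_of_mem_open (a := c₀) (u := ((j ≫ π) ⁻¹ᵁ V' : Set (Spec (.of C)))) hcV' ((j ≫ π) ⁻¹ᵁ V').2
  have hh0 : h ≠ 0 := by
    rintro rfl
    exact hch (Ideal.zero_mem _)
  have hιh : ι h ≠ 0 := by
    intro h0
    apply hh0
    rw [← hιι h, h0, map_zero]
  -- The norm of h; it is nonzero because C is a domain and ι is injective.
  obtain ⟨M, hM⟩ : h * ι h ∈ τ.range := by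
    rw [← hτι, map_mul, hιι, mul_comm]
  obtain ⟨n, hn⟩ := exists_pullSections_eq hπ hV hι ((hτι (τ M)).mpr ⟨M, rfl⟩)
  have hpre : ∀ c : Spec (.of C), π (j c) ∈ Y.basicOpen n ↔ c ∈ PrimeSpectrum.basicOpen (τ M) := by
    intro c
    have e0 : ⊤ ≤ j ⁻¹ᵁ π ⁻¹ᵁ V := top_le_of_opensRange_eq hV
    have e : ⊤ ≤ (j ≫ π) ⁻¹ᵁ V := e0
    have h1 := Scheme.basicOpen_appLE (j ≫ π) ⊤ V e n
    rw [Scheme.Hom.comp_appLE] at h1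
    rw [← hn]
    rw [top_inf_eq] at h1
    have h2 := basicOpen_eq_of_affine' (R := .of C) ((π.app V ≫ j.appLE (π ⁻¹ᵁ V) ⊤ e) n)
    rw [h1] at h2
    exact SetLike.ext_iff.mp h2 c
  have hWV : Y.basicOpen n ≤ V := Y.basicOpen_le n
  refine ⟨M, Y.basicOpen n, ?_, ?_, fun x => ?_⟩
  · rintro rfl
    rw [map_zero] at hM
    exact mul_ne_zero hh0 hιh hM.symm
  · have hle' : V' ≤ V := hle
    have hWV' : Y.basicOpen n ≤ V' := by
      intro y hy
      obtain ⟨c, rfl⟩ := hVj y (hWV hy)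
      have hc := (hpre c).mp hy
      rw [hM] at hc
      exact hh (fun h0 => hc (Ideal.mul_mem_right _ _ h0))
    have h1 := Y.basicOpen_res n (homOfLE hle').op
    rw [inf_eq_right.mpr hWV'] at h1
    rw [← h1]
    exact hV'.basicOpen _
  · constructor
    · intro hx
      have : x ∈ j.opensRange := by rw [hV]; exact hWV hx
      obtain ⟨c, rfl⟩ := this
      exact ⟨c, (hpre c).mp hx, rfl⟩
    · rintro ⟨c, hc, rfl⟩
      exact (hpre c).mpr hc

include hπ hι in
/-- Let an involution act on `X`, and on a dense affine open subset with coordinate ring `C`. Then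
the quotient is birational to the spectrum of the ring of invariants of `C`. -/
theorem birationalOver_quotient [IsDominant j] [IsDomain S] [Algebra F C] [Algebra F S]
    (τ : S →ₐ[F] C) (hτ : Function.Injective τ)
    (hτι : ∀ a, ι a = a ↔ a ∈ (τ : S →+* C).range) (hιι : ∀ a, ι (ι a) = a)
    (s₀ : Y ⟶ Spec (.of F))
    (hs₀ : j ≫ π ≫ s₀ = Spec.map (CommRingCat.ofHom (algebraMap F C))) :
    Scheme.BirationalOver s₀ (Spec.map (CommRingCat.ofHom (algebraMap F S))) := by
  obtain ⟨M, W, hM, hW, hWj⟩ := exists_affine_basicOpen hπ hι hτι hιι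
  have hN : τ M ≠ 0 := fun h => hM (hτ (h.trans (map_zero τ).symm))
  let CN := Localization.Away (τ M)
  let SM := Localization.Away M
  have : IsLocalization.Away ((τ : S →+* C) M) CN := inferInstanceAs (IsLocalization.Away (τ M) CN)
  obtain ⟨τ', ι', hτ', hττ', hιι', hτι'⟩ :=
    exists_localized_involution (τ := (τ : S →+* C)) hτ hτι hM SM CN
  have hloc := AlgebraicGeometry.IsOpenImmersion.of_isLocalization (S := CN) (τ M)
  let k : Spec (.of CN) ⟶ X := Spec.map (CommRingCat.ofHom (algebraMap C CN)) ≫ j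
  have hk : k.opensRange = π ⁻¹ᵁ W := by
    ext x
    refine Iff.trans ?_ (hWj x).symm
    constructor
    · rintro ⟨Q, rfl⟩
      refine ⟨Spec.map (CommRingCat.ofHom (algebraMap C CN)) Q, ?_, rfl⟩
      have := PrimeSpectrum.localization_away_comap_range CN (τ M)
      change _ ∈ (PrimeSpectrum.basicOpen (τ M) : Set (PrimeSpectrum C))
      rw [← this]
      exact ⟨Q, rfl⟩
    · rintro ⟨c, hc, rfl⟩
      obtain ⟨Q, rfl⟩ := exists_eq_of_notMem c hc
      exact ⟨Q, rfl⟩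
  have hk' : Spec.map (CommRingCat.ofHom ι') ≫ k = k ≫ i := by
    rw [Category.assoc, ← hι, ← Spec.map_comp_assoc, ← Spec.map_comp_assoc,
      ← CommRingCat.ofHom_comp, ← CommRingCat.ofHom_comp, hιι']
  obtain ⟨f, hf, hfW, hfk⟩ := exists_openImmersion_of_invariants hπ hk hk' hW τ' hτ' hτι'
  have hfs : f ≫ s₀ = Spec.map (CommRingCat.ofHom (algebraMap F SM)) := by
    apply eq_of_Spec_map_comp_eq τ' hτ'
    rw [reassoc_of% hfk]
    simp only [k, Category.assoc]
    rw [hs₀, ← Spec.map_comp, ← Spec.map_comp, ← CommRingCat.ofHom_comp, ← CommRingCat.ofHom_comp]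
    congr 2
    rw [IsScalarTower.algebraMap_eq F S SM, ← RingHom.comp_assoc, hττ', RingHom.comp_assoc]
    congr 1
    exact τ.comp_algebraMap.symm
  have hdom : IsDominant f := by
    have h1 := isDominant_Spec_localization hN CN
    have h2 : IsDominant k := inferInstance
    have h3 : DenseRange (k ≫ π) := by
      rw [Scheme.Hom.comp_base, TopCat.coe_comp]
      exact hπ.isQuotientMap.surjective.denseRange.comp h2.denseRange π.continuous
    refine ⟨?_⟩
    rw [← hfk] at h3
    refine Dense.mono ?_ h3
    rintro _ ⟨x, rfl⟩
    exact ⟨Spec.map (CommRingCat.ofHom τ') x, rfl⟩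
  exact (Scheme.Hom.birationalOver f s₀ _ hfs).symm.trans (birationalOver_localization hM SM)

end
-- The affine Legendre curve, its square, and invariants under negation
section LegendreRing

/-- The Legendre curve over a commutative ring. -/
def legendreCurve {R : Type*} [CommRing R] (l : R) : WeierstrassCurve R where
  a₁ := 0
  a₂ := -(1 + l)
  a₃ := 0
  a₄ := l
  a₆ := 0

/-- The coordinate ring of the affine Legendre curve. -/
abbrev LegendreRing {R : Type*} [CommRing R] (l : R) := (legendreCurve l).toAffine.CoordinateRing

namespace LegendreRing
variable {R S : Type*} [CommRing R] [CommRing S] (l : R)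

/-- The coordinate `x` on the Legendre curve. -/
def x : LegendreRing l := WeierstrassCurve.Affine.CoordinateRing.mk _ (.C .X)

/-- The coordinate `y` on the Legendre curve. -/
def y : LegendreRing l := WeierstrassCurve.Affine.CoordinateRing.mk _ .X

lemma polynomial_eq : (legendreCurve l).toAffine.polynomial = .X ^ 2 -
    .C .X * (.C .X - 1) * (.C .X - .C (.C l)) := by
  simp only [WeierstrassCurve.Affine.polynomial, legendreCurve, map_add, map_mul, map_pow,
    map_neg, map_one, map_zero]
  ring

lemma y_sq : y l ^ 2 = x l * (x l - 1) * (x l - algebraMap R _ l) := by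
  have h : WeierstrassCurve.Affine.CoordinateRing.mk (legendreCurve l).toAffine
      (.X ^ 2 - .C .X * (.C .X - 1) * (.C .X - .C (.C l))) = 0 := by
    rw [← polynomial_eq]
    exact AdjoinRoot.mk_self
  simp only [map_sub, map_mul, map_pow, map_one] at h
  exact sub_eq_zero.mp h

variable {l}

lemma exists_lift (φ : R →+* S) (a b : S) (h : b ^ 2 = a * (a - 1) * (a - φ l)) :
    ∃ ψ : LegendreRing l →+* S, ψ.comp (algebraMap R _) = φ ∧ ψ (x l) = a ∧ ψ (y l) = b := by
  refine ⟨AdjoinRoot.lift (Polynomial.eval₂RingHom φ a) b ?_, ?_, ?_, ?_⟩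
  · rw [polynomial_eq]
    simp only [Polynomial.eval₂_sub, Polynomial.eval₂_mul, Polynomial.eval₂_pow,
      Polynomial.eval₂_X, Polynomial.eval₂_C, Polynomial.coe_eval₂RingHom, Polynomial.eval₂_one]
    linear_combination h
  · ext r
    have : algebraMap R (LegendreRing l) r = AdjoinRoot.of _ (.C r) := rfl
    rw [RingHom.comp_apply, this, AdjoinRoot.lift_of]
    simp
  · refine (AdjoinRoot.lift_of _).trans ?_
    simp
  · exact AdjoinRoot.lift_root _

lemma ringHom_ext {f g : LegendreRing l →+* S}
    (h : f.comp (algebraMap R _) = g.comp (algebraMap R _)) (hx : f (x l) = g (x l))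
    (hy : f (y l) = g (y l)) : f = g := by
  apply Ideal.Quotient.ringHom_ext
  apply Polynomial.ringHom_ext'
  · apply Polynomial.ringHom_ext'
    · exact h
    · exact hx
  · exact hy

lemma aeval_x (p : Polynomial R) : Polynomial.aeval (x l) p =
    WeierstrassCurve.Affine.CoordinateRing.mk (legendreCurve l).toAffine (.C p) := by
  have h : (Polynomial.aeval (x l)).toRingHom =
      (WeierstrassCurve.Affine.CoordinateRing.mk (legendreCurve l).toAffine).comp Polynomial.C := by
    apply Polynomial.ringHom_ext'
    · ext r; simp; rfl
    · simp; rfl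
  exact congr($h p)

lemma exists_eq (c : LegendreRing l) : ∃ p q : Polynomial R,
    c = Polynomial.aeval (x l) p + Polynomial.aeval (x l) q * y l := by
  obtain ⟨p, q, h⟩ := WeierstrassCurve.Affine.CoordinateRing.exists_smul_basis_eq c
  refine ⟨p, q, ?_⟩
  rw [aeval_x, aeval_x, ← h, WeierstrassCurve.Affine.CoordinateRing.smul,
    WeierstrassCurve.Affine.CoordinateRing.smul, mul_one]
  rfl

lemma eq_zero_of_aeval (p q : Polynomial R)
    (h : Polynomial.aeval (x l) p + Polynomial.aeval (x l) q * y l = 0) : p = 0 ∧ q = 0 := by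
  apply WeierstrassCurve.Affine.CoordinateRing.smul_basis_eq_zero (W' := (legendreCurve l).toAffine)
  rw [WeierstrassCurve.Affine.CoordinateRing.smul,
    WeierstrassCurve.Affine.CoordinateRing.smul, mul_one, ← aeval_x, ← aeval_x]
  exact h

end LegendreRing
end LegendreRing

section
variable {F : Type u} [Field F] {l : F}

namespace LegendreRing
variable {S : Type*} [CommRing S] [Algebra F S]

lemma exists_algHom (a b : S) (h : b ^ 2 = a * (a - 1) * (a - algebraMap F S l)) :
    ∃ ψ : LegendreRing l →ₐ[F] S, ψ (x l) = a ∧ ψ (y l) = b := by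
  obtain ⟨ψ, h1, h2, h3⟩ := exists_lift (algebraMap F S) a b h
  exact ⟨{ ψ with commutes' := fun r => congr($h1 r) }, h2, h3⟩

lemma algHom_ext {f g : LegendreRing l →ₐ[F] S} (hx : f (x l) = g (x l)) (hy : f (y l) = g (y l)) :
    f = g := by
  have : (f : LegendreRing l →+* S) = g :=
    ringHom_ext (by rw [AlgHom.comp_algebraMap, AlgHom.comp_algebraMap]) hx hy
  exact AlgHom.ext fun a => congr($this a)

variable (l) in
/-- Negation on the affine Legendre curve. -/
def neg : LegendreRing l →ₐ[F] LegendreRing l :=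
  (exists_algHom (x l) (- y l) (by rw [neg_sq, y_sq])).choose

lemma neg_x : neg l (x l) = x l :=
  (exists_algHom (x l) (- y l) (by rw [neg_sq, y_sq])).choose_spec.1

lemma neg_y : neg l (y l) = - y l :=
  (exists_algHom (x l) (- y l) (by rw [neg_sq, y_sq])).choose_spec.2

lemma aeval_x_injective : Function.Injective (Polynomial.aeval (R := F) (x l)) := by
  rw [injective_iff_map_eq_zero]
  intro p hp
  exact (eq_zero_of_aeval p 0 (by rw [hp]; simp)).1

end LegendreRing

namespace LegendreRing

lemma y_ne_zero {R : Type*} [CommRing R] [Nontrivial R] {l : R} : y l ≠ 0 := by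
  intro h
  exact one_ne_zero (eq_zero_of_aeval (l := l) 0 1 (by rw [h]; simp)).2

end LegendreRing

variable (l) in
/-- The coordinate ring of the product of the affine Legendre curve with itself. -/
abbrev LegendreSquare : Type u := LegendreRing (algebraMap F (LegendreRing l) l)

namespace LegendreSquare

variable (l) in
/-- The first projection. -/
def fst : LegendreRing l →ₐ[F] LegendreSquare l :=
  IsScalarTower.toAlgHom F (LegendreRing l) (LegendreSquare l)

variable (l) in
lemma y_sq' : LegendreRing.y (algebraMap F (LegendreRing l) l) ^ 2 =
    LegendreRing.x (algebraMap F (LegendreRing l) l) *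
      (LegendreRing.x (algebraMap F (LegendreRing l) l) - 1) *
      (LegendreRing.x (algebraMap F (LegendreRing l) l) - algebraMap F (LegendreSquare l) l) := by
  rw [LegendreRing.y_sq, IsScalarTower.algebraMap_apply F (LegendreRing l) (LegendreSquare l)]

variable (l) in
/-- The second projection. -/
def snd : LegendreRing l →ₐ[F] LegendreSquare l :=
  (LegendreRing.exists_algHom _ _ (y_sq' l)).choose

lemma snd_x : snd l (LegendreRing.x l) = LegendreRing.x _ :=
  (LegendreRing.exists_algHom _ _ (y_sq' l)).choose_spec.1

lemma snd_y : snd l (LegendreRing.y l) = LegendreRing.y _ :=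
  (LegendreRing.exists_algHom _ _ (y_sq' l)).choose_spec.2

variable {S : Type*} [CommRing S] [Algebra F S]

lemma algHom_ext {f g : LegendreSquare l →ₐ[F] S} (h1 : f.comp (fst l) = g.comp (fst l))
    (h2 : f.comp (snd l) = g.comp (snd l)) : f = g := by
  have : (f : LegendreSquare l →+* S) = g := by
    refine LegendreRing.ringHom_ext ?_ ?_ ?_
    · exact RingHom.ext fun a => congr($h1 a)
    · have := congr($h2 (LegendreRing.x l))
      rwa [AlgHom.comp_apply, AlgHom.comp_apply, snd_x] at this
    · have := congr($h2 (LegendreRing.y l))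
      rwa [AlgHom.comp_apply, AlgHom.comp_apply, snd_y] at this
  exact AlgHom.ext fun a => congr($this a)

lemma exists_algHom (α β : LegendreRing l →ₐ[F] S) :
    ∃ ψ : LegendreSquare l →ₐ[F] S, ψ.comp (fst l) = α ∧ ψ.comp (snd l) = β := by
  obtain ⟨ψ, h1, h2, h3⟩ := LegendreRing.exists_lift (l := algebraMap F (LegendreRing l) l)
    (α : LegendreRing l →+* S) (β (LegendreRing.x l)) (β (LegendreRing.y l)) (by
      have := congr(β $(LegendreRing.y_sq l))
      rw [RingHom.coe_coe, α.commutes]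
      simpa using this)
  let ψ' : LegendreSquare l →ₐ[F] S := { ψ with
    commutes' := fun r => by
      have := congr($h1 (algebraMap F _ r))
      rw [RingHom.comp_apply, ← IsScalarTower.algebraMap_apply] at this
      exact this.trans (α.commutes r) }
  have hψ' : ∀ a, ψ' a = ψ a := fun _ => rfl
  refine ⟨ψ', AlgHom.ext fun a => congr($h1 a), LegendreRing.algHom_ext ?_ ?_⟩
  · rw [AlgHom.comp_apply, snd_x, hψ', h2]
  · rw [AlgHom.comp_apply, snd_y, hψ', h3]

open TensorProduct in
variable (l) in
/-- The coordinate ring of the product is the tensor square. -/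
lemma exists_tensorEquiv : ∃ e : LegendreRing l ⊗[F] LegendreRing l ≃ₐ[F] LegendreSquare l,
    (e : LegendreRing l ⊗[F] LegendreRing l →ₐ[F] LegendreSquare l).comp
      Algebra.TensorProduct.includeLeft = fst l ∧
    (e : LegendreRing l ⊗[F] LegendreRing l →ₐ[F] LegendreSquare l).comp
      Algebra.TensorProduct.includeRight = snd l := by
  obtain ⟨ψ, h1, h2⟩ := exists_algHom (l := l)
    (Algebra.TensorProduct.includeLeft : LegendreRing l →ₐ[F] LegendreRing l ⊗[F] LegendreRing l)
    Algebra.TensorProduct.includeRight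
  have g1 : (Algebra.TensorProduct.productMap (fst l) (snd l)).comp
      Algebra.TensorProduct.includeLeft = fst l :=
    AlgHom.ext fun a => by simp
  have g2 : (Algebra.TensorProduct.productMap (fst l) (snd l)).comp
      Algebra.TensorProduct.includeRight = snd l :=
    AlgHom.ext fun a => by simp
  refine ⟨AlgEquiv.ofAlgHom (Algebra.TensorProduct.productMap (fst l) (snd l)) ψ ?_ ?_, g1, g2⟩
  · refine algHom_ext ?_ ?_
    · rw [AlgHom.comp_assoc, h1, g1, AlgHom.id_comp]
    · rw [AlgHom.comp_assoc, h2, g2, AlgHom.id_comp]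
  · refine Algebra.TensorProduct.ext ?_ ?_
    · rw [AlgHom.comp_assoc, g1, h1, AlgHom.id_comp]
    · have : (ψ.comp (Algebra.TensorProduct.productMap (fst l) (snd l))).comp
          Algebra.TensorProduct.includeRight = Algebra.TensorProduct.includeRight := by
        rw [AlgHom.comp_assoc, g2, h2]
      exact this

variable (l) in
/-- Negation on the product. -/
def neg : LegendreSquare l →ₐ[F] LegendreSquare l :=
  (exists_algHom ((fst l).comp (LegendreRing.neg l)) ((snd l).comp (LegendreRing.neg l))).choose

lemma neg_comp_fst : (neg l).comp (fst l) = (fst l).comp (LegendreRing.neg l) :=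
  (exists_algHom ((fst l).comp (LegendreRing.neg l))
    ((snd l).comp (LegendreRing.neg l))).choose_spec.1

lemma neg_comp_snd : (neg l).comp (snd l) = (snd l).comp (LegendreRing.neg l) :=
  (exists_algHom ((fst l).comp (LegendreRing.neg l))
    ((snd l).comp (LegendreRing.neg l))).choose_spec.2

lemma neg_fst (a : LegendreRing l) : neg l (fst l a) = fst l (LegendreRing.neg l a) :=
  congr($neg_comp_fst a)

lemma neg_snd (a : LegendreRing l) : neg l (snd l a) = snd l (LegendreRing.neg l a) :=
  congr($neg_comp_snd a)

lemma neg_neg (a : LegendreSquare l) : neg l (neg l a) = a := by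
  have h : (LegendreRing.neg l).comp (LegendreRing.neg l) = AlgHom.id F _ := by
    refine LegendreRing.algHom_ext ?_ ?_ <;>
      simp [LegendreRing.neg_x, LegendreRing.neg_y]
  have : (neg l).comp (neg l) = AlgHom.id F _ := by
    refine algHom_ext ?_ ?_
    · rw [AlgHom.comp_assoc, neg_comp_fst, ← AlgHom.comp_assoc, neg_comp_fst, AlgHom.comp_assoc, h,
        AlgHom.comp_id, AlgHom.id_comp]
    · rw [AlgHom.comp_assoc, neg_comp_snd, ← AlgHom.comp_assoc, neg_comp_snd, AlgHom.comp_assoc, h,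
        AlgHom.comp_id, AlgHom.id_comp]
  exact congr($this a)

variable (l) in
lemma exists_toDoublePlane : ∃ φ : DoublePlane l →ₐ[F] LegendreSquare l,
    φ (DoublePlane.coord l 0) = fst l (LegendreRing.x l) ∧
    φ (DoublePlane.coord l 1) = snd l (LegendreRing.x l) ∧
    φ (DoublePlane.coord l 2) = fst l (LegendreRing.y l) * snd l (LegendreRing.y l) := by
  apply DoublePlane.exists_algHom
  rw [mul_pow, ← map_pow, ← map_pow, LegendreRing.y_sq]
  simp

variable (l) in
/-- The map from the product to the double plane. -/
def ofDoublePlane : DoublePlane l →ₐ[F] LegendreSquare l := (exists_toDoublePlane l).choose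

lemma ofDoublePlane_zero : ofDoublePlane l (DoublePlane.coord l 0) = fst l (LegendreRing.x l) :=
  (exists_toDoublePlane l).choose_spec.1

lemma ofDoublePlane_one : ofDoublePlane l (DoublePlane.coord l 1) = snd l (LegendreRing.x l) :=
  (exists_toDoublePlane l).choose_spec.2.1

lemma ofDoublePlane_two : ofDoublePlane l (DoublePlane.coord l 2) =
    fst l (LegendreRing.y l) * snd l (LegendreRing.y l) :=
  (exists_toDoublePlane l).choose_spec.2.2

end LegendreSquare

open Polynomial in
/-- Evaluation of a polynomial in `s` and `X` on the double plane. -/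
def DoublePlane.ofBase (l : F) : F[X][X] →+* DoublePlane l :=
  Polynomial.eval₂RingHom (Polynomial.aeval (DoublePlane.coord l 0)).toRingHom (DoublePlane.coord l 1)

open Polynomial in
lemma DoublePlane.exists_eq (a : DoublePlane l) : ∃ p q : F[X][X],
    a = ofBase l p + ofBase l q * coord l 2 := by
  have h0 : coord l 0 = ofBase l (.C .X) := by simp [ofBase]
  have h1 : coord l 1 = ofBase l .X := by simp [ofBase]
  have hc : ∀ r : F, algebraMap F (DoublePlane l) r = ofBase l (.C (.C r)) := by simp [ofBase]
  obtain ⟨a, rfl⟩ := Ideal.Quotient.mk_surjective a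
  induction a using MvPolynomial.induction_on with
  | C r => exact ⟨.C (.C r), 0, by rw [← hc]; simp; rfl⟩
  | add a b ha hb =>
    obtain ⟨p, q, h⟩ := ha
    obtain ⟨p', q', h'⟩ := hb
    exact ⟨p + p', q + q', by rw [map_add, h, h', map_add, map_add]; ring⟩
  | mul_X a i ha =>
    obtain ⟨p, q, h⟩ := ha
    have hi : Ideal.Quotient.mk (Ideal.span {doublePlaneEquation l}) (a * MvPolynomial.X i) =
      (ofBase l p + ofBase l q * coord l 2) * coord l i := by rw [← h, map_mul]; rfl
    rw [hi]
    fin_cases i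
    · exact ⟨p * .C .X, q * .C .X, by
        change _ * coord l 0 = _
        rw [map_mul, map_mul, ← h0]; ring⟩
    · exact ⟨p * .X, q * .X, by
        change _ * coord l 1 = _
        rw [map_mul, map_mul, ← h1]; ring⟩
    · refine ⟨q * (.C .X * (.C .X - 1) * (.C .X - .C (.C l)) * (.X * (.X - 1) * (.X - .C (.C l)))),
        p, ?_⟩
      change _ * coord l 2 = _
      simp only [map_mul, map_sub, map_one, ← h0, ← h1, ← hc]
      linear_combination ofBase l q * coord_eq (l := l)

namespace LegendreSquare

open Polynomial in
lemma ofDoublePlane_ofBase (p : F[X][X]) : ofDoublePlane l (DoublePlane.ofBase l p) =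
    Polynomial.aeval (LegendreRing.x (algebraMap F (LegendreRing l) l))
      (p.map (Polynomial.aeval (LegendreRing.x l)).toRingHom) := by
  have : (ofDoublePlane l).toRingHom.comp (DoublePlane.ofBase l) =
      (Polynomial.aeval (LegendreRing.x (algebraMap F (LegendreRing l) l))).toRingHom.comp
        (Polynomial.mapRingHom (Polynomial.aeval (LegendreRing.x l)).toRingHom) := by
    apply Polynomial.ringHom_ext'
    · apply Polynomial.ringHom_ext'
      · ext r
        simp [DoublePlane.ofBase]
        rfl
      · simp [DoublePlane.ofBase, ofDoublePlane_zero]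
        rfl
    · simp [DoublePlane.ofBase, ofDoublePlane_one, snd_x]
  exact congr($this p)

-- The product ring is a Legendre ring over the coordinate ring of the first factor, hence free with
-- basis 1, y₂ over polynomials in x₂. The image of p + q t has coordinates p and q y₁ there, and y₁
-- is nonzero in a domain.
open Polynomial in
lemma ofDoublePlane_injective : Function.Injective (ofDoublePlane l) := by
  rw [injective_iff_map_eq_zero]
  intro a ha
  obtain ⟨p, q, rfl⟩ := DoublePlane.exists_eq a
  rw [map_add, map_mul, ofDoublePlane_ofBase, ofDoublePlane_ofBase, ofDoublePlane_two, snd_y] at ha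
  have hinj : Function.Injective
      (Polynomial.map (Polynomial.aeval (R := F) (LegendreRing.x l)).toRingHom) :=
    Polynomial.map_injective _ LegendreRing.aeval_x_injective
  set P := p.map (Polynomial.aeval (LegendreRing.x l)).toRingHom with hP
  set Q := q.map (Polynomial.aeval (LegendreRing.x l)).toRingHom with hQ
  obtain ⟨h1, h2⟩ := LegendreRing.eq_zero_of_aeval
    (l := algebraMap F (LegendreRing l) l) P (Q * .C (LegendreRing.y l)) (by
    rw [map_mul, Polynomial.aeval_C, ← ha]
    change _ = _ + _ * (algebraMap (LegendreRing l) (LegendreSquare l) _ * _)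
    ring)
  have h3 : Q = 0 := (mul_eq_zero.mp h2).resolve_right
    (Polynomial.C_ne_zero.mpr LegendreRing.y_ne_zero)
  have hp : p = 0 := hinj (by rw [← hP, h1, Polynomial.map_zero])
  have hq : q = 0 := hinj (by rw [← hQ, h3, Polynomial.map_zero])
  rw [hp, hq, map_zero, zero_mul, add_zero]

instance : IsDomain (DoublePlane l) :=
  (ofDoublePlane_injective (l := l)).isDomain (ofDoublePlane l).toRingHom

lemma neg_ofDoublePlane (a : DoublePlane l) : neg l (ofDoublePlane l a) = ofDoublePlane l a := by
  have : (neg l).comp (ofDoublePlane l) = ofDoublePlane l := by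
    apply DoublePlane.algHom_ext
    intro i
    rw [AlgHom.comp_apply]
    fin_cases i
    · change neg l (ofDoublePlane l (DoublePlane.coord l 0)) = ofDoublePlane l (DoublePlane.coord l 0)
      rw [ofDoublePlane_zero, neg_fst, LegendreRing.neg_x]
    · change neg l (ofDoublePlane l (DoublePlane.coord l 1)) = ofDoublePlane l (DoublePlane.coord l 1)
      rw [ofDoublePlane_one, neg_snd, LegendreRing.neg_x]
    · change neg l (ofDoublePlane l (DoublePlane.coord l 2)) = ofDoublePlane l (DoublePlane.coord l 2)
      rw [ofDoublePlane_two, map_mul, neg_fst, neg_snd, LegendreRing.neg_y, map_neg, map_neg,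
        neg_mul_neg]
  exact congr($this a)

-- Traces of the basis elements: with P over F[x₁] ⊕ F[x₁]y₁, the sum with the conjugate kills the
-- y₁-part, and the difference keeps only the y₁-part, which times y₂ is a multiple of t. The second
-- case is the trace of P y₂, as negation changes the sign of y₂.
open Polynomial in
lemma add_neg_mem_range (P : (LegendreRing l)[X]) :
    Polynomial.aeval (snd l (LegendreRing.x l)) P +
      neg l (Polynomial.aeval (snd l (LegendreRing.x l)) P) ∈ (ofDoublePlane l).range ∧
    (Polynomial.aeval (snd l (LegendreRing.x l)) P -
      neg l (Polynomial.aeval (snd l (LegendreRing.x l)) P)) * snd l (LegendreRing.y l) ∈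
        (ofDoublePlane l).range := by
  induction P using Polynomial.induction_on' with
  | add p q hp hq =>
    constructor
    · convert add_mem hp.1 hq.1 using 1
      rw [map_add, map_add]; ring
    · convert add_mem hp.2 hq.2 using 1
      rw [map_add, map_add]; ring
  | monomial n b =>
    obtain ⟨p, q, rfl⟩ := LegendreRing.exists_eq b
    have hb : ∀ b : LegendreRing l, Polynomial.aeval (snd l (LegendreRing.x l))
        (Polynomial.monomial n b) = fst l b * snd l (LegendreRing.x l) ^ n := fun b => by
      rw [Polynomial.aeval_monomial]; rfl
    have hneg : LegendreRing.neg l (aeval (LegendreRing.x l) p +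
        aeval (LegendreRing.x l) q * LegendreRing.y l) = aeval (LegendreRing.x l) p -
        aeval (LegendreRing.x l) q * LegendreRing.y l := by
      rw [map_add, map_mul, LegendreRing.neg_y, ← Polynomial.aeval_algHom_apply,
        ← Polynomial.aeval_algHom_apply, LegendreRing.neg_x]
      ring
    rw [hb, map_mul, map_pow, neg_fst, neg_snd, LegendreRing.neg_x, hneg]
    have hp : ∀ p : F[X], fst l (aeval (LegendreRing.x l) p) =
        ofDoublePlane l (aeval (DoublePlane.coord l 0) p) := fun p => by
      rw [← Polynomial.aeval_algHom_apply, ← Polynomial.aeval_algHom_apply, ofDoublePlane_zero]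
    simp only [map_add, map_sub, map_mul, hp]
    constructor
    · refine ⟨2 * aeval (DoublePlane.coord l 0) p * DoublePlane.coord l 1 ^ n, ?_⟩
      simp only [RingHom.coe_coe, AlgHom.toRingHom_eq_coe, map_mul, map_pow, ofDoublePlane_one,
        map_ofNat]
      ring
    · refine ⟨2 * aeval (DoublePlane.coord l 0) q * DoublePlane.coord l 1 ^ n *
        DoublePlane.coord l 2, ?_⟩
      simp only [RingHom.coe_coe, AlgHom.toRingHom_eq_coe, map_mul, map_pow, ofDoublePlane_one,
        ofDoublePlane_two, map_ofNat]
      ring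

/-- The coordinate ring of the double plane is the ring of invariants of negation. -/
lemma neg_eq_self_iff (hF : (2 : F) ≠ 0) (c : LegendreSquare l) :
    neg l c = c ↔ c ∈ (ofDoublePlane l).range := by
  constructor
  · intro hc
    obtain ⟨P, Q, h⟩ := LegendreRing.exists_eq c
    rw [← snd_x, ← snd_y] at h
    have h2 : c + neg l c ∈ (ofDoublePlane l).range := by
      convert add_mem (add_neg_mem_range P).1 (add_neg_mem_range Q).2 using 1
      rw [h, map_add, map_mul, neg_snd, LegendreRing.neg_y, map_neg]
      ring
    rw [hc] at h2
    -- An invariant element is half its trace.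
    have h3 := Subalgebra.smul_mem _ h2 (2⁻¹ : F)
    convert h3 using 1
    rw [← two_smul F c, smul_smul, inv_mul_cancel₀ hF, one_smul]
  · rintro ⟨a, rfl⟩
    exact neg_ofDoublePlane a

end LegendreSquare
end
-- Graded automorphisms in affine charts
section ChartMaps
variable {F : Type u} [Field F] {σ : Type} {p : MvPolynomial σ F} [hp : Fact (∃ d, p.IsHomogeneous d)]

-- Keeping t separate from g s allows the case in which g fixes s by a theorem rather than by
-- definition, without transporting localizations along an equality.
open HomogeneousLocalization in
lemma exists_awayι_comp_map (g : grading p →+*ᵍ grading p)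
    (hg : HomogeneousIdeal.irrelevant (grading p) ≤
      (HomogeneousIdeal.irrelevant (grading p)).map g) {s t : CoordRing p}
    (hs : s ∈ grading p 1) (ht : t ∈ grading p 1) (e : g s = t) :
    ∃ μ : Away (grading p) s →+* Away (grading p) t,
      Proj.awayι (grading p) t ht one_pos ≫ Proj.map g hg =
        Spec.map (CommRingCat.ofHom μ) ≫ Proj.awayι (grading p) s hs one_pos ∧
      ∀ n x hx, μ (Away.mk _ hs n x hx) = Away.mk _ ht n (g x) (g.2 hx) := by
  subst e
  exact ⟨Away.map g s, Proj.awayι_comp_map g hg one_pos s hs, fun n x hx => Away.map_mk g s hs n x hx⟩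

namespace IsChart
variable {D : Type u} [CommRing D] [Algebra F D] {i : σ} {d : σ → D} (h : IsChart p i d)

open HomogeneousLocalization in
lemma chart_comp_map (g : grading p →+*ᵍ grading p)
    (hg : HomogeneousIdeal.irrelevant (grading p) ≤
      (HomogeneousIdeal.irrelevant (grading p)).map g) (c : σ → MvPolynomial σ F)
    (hc : ∀ j, (c j).IsHomogeneous 1)
    (hgc : ∀ a, g (Ideal.Quotient.mk _ a) = Ideal.Quotient.mk _ (MvPolynomial.aeval c a))
    (hi : c i = MvPolynomial.X i) (ν : D →ₐ[F] D)
    (hν : ∀ j, ν (d j) = MvPolynomial.aeval d (c j)) :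
    h.chart ≫ Proj.map g hg = Spec.map (CommRingCat.ofHom (ν : D →+* D)) ≫ h.chart := by
  have e : g (coord p i) = coord p i := by rw [coord, hgc, MvPolynomial.aeval_X, hi]
  obtain ⟨μ, hμ, hμ'⟩ := exists_awayι_comp_map g hg (coord_mem p i) (coord_mem p i) e
  rw [chart, Category.assoc, hμ, ← Spec.map_comp_assoc, ← Spec.map_comp_assoc,
    ← CommRingCat.ofHom_comp, ← CommRingCat.ofHom_comp]
  congr 3
  ext x
  obtain ⟨n, a, ha, rfl⟩ := Away.mk_surjective _ (coord_mem p i) x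
  obtain ⟨a, ha', rfl⟩ : a ∈ grading p n := by simpa using ha
  have ha'' : (MvPolynomial.aeval c a).IsHomogeneous n := by
    have := MvPolynomial.IsHomogeneous.aeval ha' c hc
    rwa [one_mul] at this
  have h1 : Away.mk _ (coord_mem p i) n _ ha = dehom p i a := (dehom_eq_mk p i ha').symm
  have h2 : μ (Away.mk _ (coord_mem p i) n _ ha) = dehom p i (MvPolynomial.aeval c a) := by
    rw [hμ', dehom_eq_mk p i ha'']
    congr 1
    exact hgc a
  rw [RingHom.comp_apply, RingHom.comp_apply, h2, h1, awayHom_dehom, awayHom_dehom,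
    MvPolynomial.comp_aeval_apply, RingHom.coe_coe, MvPolynomial.comp_aeval_apply]
  simp_rw [hν]

lemma isDominant_chart (hX : Ideal.Quotient.mk (Ideal.span {p}) (MvPolynomial.X i) ∈
    nonZeroDivisors (CoordRing p)) : IsDominant h.chart := by
  have := h.isDominant_chart_localization one_pos (MvPolynomial.isHomogeneous_X F i) dvd_rfl hX
  exact @IsDominant.of_comp _ _ _ _ h.chart this

end IsChart
end ChartMaps

/-! ### Dense affine chart of E × E, and comparison of K₀ with the double plane -/

section Product

/-- The projections are base changes of universally open maps, hence open, and preimages of dense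
sets under open maps are dense. -/
lemma dense_preimage_inter {X Y S : Scheme.{u}} (f : X ⟶ S) (g : Y ⟶ S) [UniversallyOpen f]
    [UniversallyOpen g] {U : Set X} {V : Set Y} (hU : Dense U) (hV : Dense V) (hVo : IsOpen V) :
    Dense (pullback.fst f g ⁻¹' U ∩ pullback.snd f g ⁻¹' V) := by
  refine Dense.inter_of_isOpen_right ?_ ?_ (hVo.preimage (pullback.snd f g).continuous)
  · exact hU.preimage (pullback.fst f g).isOpenMap
  · exact hV.preimage (pullback.snd f g).isOpenMap

end Product

section Legendre
variable {F : Type u} [Field F] (l : F)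

lemma aeval_legendre {R : Type*} [CommRing R] [Algebra F R] (c : Fin 3 → R) :
    MvPolynomial.aeval c (legendre l).toProjective.polynomial =
      c 1 ^ 2 * c 2 - c 0 * (c 0 - c 2) * (c 0 - algebraMap F R l * c 2) := by
  simp [WeierstrassCurve.Projective.polynomial, legendre]
  ring

/-- The kernel is found without normal forms: the universal property of `LegendreRing` gives a map
to the tautological chart ring, through which the quotient map factors. -/
lemma isChart_legendreRing : IsChart (legendre l).toProjective.polynomial 2
    ![LegendreRing.x l, LegendreRing.y l, 1] := by
  refine ⟨fun b => ?_, fun a ha => ?_, ?_, rfl⟩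
  · obtain ⟨p, q, rfl⟩ := LegendreRing.exists_eq b
    refine ⟨Polynomial.aeval (MvPolynomial.X 0) p +
      Polynomial.aeval (MvPolynomial.X 0) q * MvPolynomial.X 1, ?_⟩
    rw [map_add, map_mul, ← Polynomial.aeval_algHom_apply, ← Polynomial.aeval_algHom_apply]
    simp
  · have h := isChart_chartRing (legendre l).toProjective.polynomial 2
    set d : Fin 3 → ChartRing (legendre l).toProjective.polynomial 2 :=
      fun j => Ideal.Quotient.mk _ (MvPolynomial.X j) with hd
    have h1 := h.aeval_eq_zero
    rw [aeval_legendre, h.coord_eq_one] at h1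
    obtain ⟨ψ, hx, hy⟩ := LegendreRing.exists_algHom (l := l) (d 0) (d 1)
      (by linear_combination h1)
    rw [← Ideal.Quotient.eq_zero_iff_mem]
    have h2 : ψ.comp (MvPolynomial.aeval ![LegendreRing.x l, LegendreRing.y l, 1]) =
        Ideal.Quotient.mkₐ F _ := by
      apply MvPolynomial.algHom_ext
      intro j
      rw [AlgHom.comp_apply, MvPolynomial.aeval_X]
      fin_cases j
      · exact hx
      · exact hy
      · exact (map_one ψ).trans h.coord_eq_one.symm
    have h3 := congr($h2 a)
    rw [AlgHom.comp_apply, ha, map_zero] at h3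
    exact h3.symm
  · rw [aeval_legendre]
    have := LegendreRing.y_sq l
    simp [this]

/-- The line Z = 0 is not a component of the cubic, since it contains (1:0:0), where the equation
does not vanish. -/
lemma isDominant_chart_legendre : IsDominant (isChart_legendreRing l).chart := by
  apply IsChart.isDominant_chart
  · have h : linearForm (![0, 0, 1] : Fin 3 → F) = MvPolynomial.X 2 := by
      simp [linearForm, Fin.sum_univ_three]
    rw [← h]
    refine mk_linearForm_mem_nonZeroDivisors _ ![1, 0, 0] (i := 2) rfl ?_ ?_
    · simp [Fin.sum_univ_three]
    · rw [← MvPolynomial.coe_aeval_eq_eval, RingHom.coe_coe, aeval_legendre]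
      simp

lemma chart_comp_neg : (isChart_legendreRing l).chart ≫ neg (legendre l) =
    Spec.map (CommRingCat.ofHom (LegendreRing.neg l : LegendreRing l →+* LegendreRing l)) ≫
      (isChart_legendreRing l).chart := by
  refine (isChart_legendreRing l).chart_comp_map _ _ (negCoord (legendre l))
    (isHomogeneous_negCoord _) (fun a => rfl) rfl _ fun j => ?_
  fin_cases j
  · simp [negCoord, LegendreRing.neg_x]
  · simp [negCoord, LegendreRing.neg_y, legendre]
  · simp [negCoord]

open TensorProduct in
lemma exists_affine_chart_square : ∃ (j : Spec (.of (LegendreSquare l)) ⟶ square (legendre l))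
    (_ : IsOpenImmersion j) (_ : IsDominant j),
    Spec.map (CommRingCat.ofHom (LegendreSquare.neg l : LegendreSquare l →+* LegendreSquare l)) ≫ j =
      j ≫ squareNeg (legendre l) ∧
    j ≫ square.structure (legendre l) =
      Spec.map (CommRingCat.ofHom (algebraMap F (LegendreSquare l))) := by
  have h := isChart_legendreRing l
  obtain ⟨e, he1, he2⟩ := LegendreSquare.exists_tensorEquiv l
  let s := Spec.map (CommRingCat.ofHom (algebraMap F (LegendreRing l)))
  have hs : h.chart ≫ curve.structure (legendre l) = s := h.chart_structure
  let m : pullback s s ⟶ square (legendre l) := pullback.map s s _ _ h.chart h.chart (𝟙 _)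
    (by rw [hs, Category.comp_id]) (by rw [hs, Category.comp_id])
  let ε := Spec.map (CommRingCat.ofHom (e.toRingEquiv : LegendreRing l ⊗[F] LegendreRing l →+* LegendreSquare l))
  have hε : IsIso ε := by
    have : IsIso (CommRingCat.ofHom (e.toRingEquiv : LegendreRing l ⊗[F] LegendreRing l →+* LegendreSquare l)) :=
      e.toRingEquiv.toCommRingCatIso.isIso_hom
    infer_instance
  let j := ε ≫ (pullbackSpecIso F (LegendreRing l) (LegendreRing l)).inv ≫ m
  have hj1 : j ≫ pullback.fst _ _ = Spec.map (CommRingCat.ofHom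
      (LegendreSquare.fst l : LegendreRing l →+* LegendreSquare l)) ≫ h.chart := by
    simp only [j, m, Category.assoc, pullback.map, pullback.lift_fst]
    rw [pullbackSpecIso_inv_fst_assoc, ← Spec.map_comp_assoc, ← CommRingCat.ofHom_comp, ← he1]
    rfl
  have hj2 : j ≫ pullback.snd _ _ = Spec.map (CommRingCat.ofHom
      (LegendreSquare.snd l : LegendreRing l →+* LegendreSquare l)) ≫ h.chart := by
    simp only [j, m, Category.assoc, pullback.map, pullback.lift_snd]
    rw [pullbackSpecIso_inv_snd_assoc, ← Spec.map_comp_assoc, ← CommRingCat.ofHom_comp, ← he2]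
    rfl
  have hm : IsDominant m := by
    have := isDominant_chart_legendre l
    refine ⟨?_⟩
    rw [DenseRange, Scheme.Pullback.range_map]
    exact dense_preimage_inter _ _ this.denseRange this.denseRange h.chart.opensRange.2
  have hn1 : (LegendreSquare.neg l : LegendreSquare l →+* LegendreSquare l).comp
      (LegendreSquare.fst l : LegendreRing l →+* LegendreSquare l) =
      (LegendreSquare.fst l : LegendreRing l →+* LegendreSquare l).comp
        (LegendreRing.neg l : LegendreRing l →+* LegendreRing l) :=
    RingHom.ext LegendreSquare.neg_fst
  have hn2 : (LegendreSquare.neg l : LegendreSquare l →+* LegendreSquare l).comp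
      (LegendreSquare.snd l : LegendreRing l →+* LegendreSquare l) =
      (LegendreSquare.snd l : LegendreRing l →+* LegendreSquare l).comp
        (LegendreRing.neg l : LegendreRing l →+* LegendreRing l) :=
    RingHom.ext LegendreSquare.neg_snd
  refine ⟨j, inferInstance, inferInstance, ?_, ?_⟩
  · apply pullback.hom_ext
    · rw [Category.assoc, hj1, Category.assoc, squareNeg, pullback.lift_fst, reassoc_of% hj1,
        chart_comp_neg, ← Spec.map_comp_assoc, ← Spec.map_comp_assoc, ← CommRingCat.ofHom_comp,
        ← CommRingCat.ofHom_comp]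
      rw [hn1]
    · rw [Category.assoc, hj2, Category.assoc, squareNeg, pullback.lift_snd, reassoc_of% hj2,
        chart_comp_neg, ← Spec.map_comp_assoc, ← Spec.map_comp_assoc, ← CommRingCat.ofHom_comp,
        ← CommRingCat.ofHom_comp]
      rw [hn2]
  · rw [reassoc_of% hj1, hs, Spec_map_comp_algebraMap]

theorem birationalOver_kummer (hF : (2 : F) ≠ 0) {K₀ : Scheme.{u}} (s₀ : K₀ ⟶ Spec (.of F))
    (π : square (legendre l) ⟶ K₀) (hπ : IsQuotientByInvolution (squareNeg (legendre l)) π)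
    (hs : π ≫ s₀ = square.structure (legendre l)) :
    Scheme.BirationalOver s₀ (Spec.map (CommRingCat.ofHom (algebraMap F (DoublePlane l)))) := by
  obtain ⟨j, hj, hjd, hneg, hjs⟩ := exists_affine_chart_square l
  exact birationalOver_quotient hπ hneg (LegendreSquare.ofDoublePlane l)
    LegendreSquare.ofDoublePlane_injective (LegendreSquare.neg_eq_self_iff hF)
    LegendreSquare.neg_neg s₀ (by rw [hs, hjs])

end Legendre

/-! ### Desingularizations are birational -/

section Resolution
variable {F : Type u} [Field F] {X Y : Scheme.{u}}

lemma IsDesingularization.birationalOver {ρ : X ⟶ Y} (h : IsDesingularization ρ)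
    (s : Y ⟶ Spec (.of F)) : Scheme.BirationalOver (ρ ≫ s) s := by
  obtain ⟨V, hV, hV', hiso⟩ := h.birational
  refine ((ρ ⁻¹ᵁ V).birationalOver_of_dense (ρ ≫ s) hV').symm.trans
    (Scheme.BirationalOver.trans ?_ (V.birationalOver_of_dense s hV))
  refine Scheme.Hom.birationalOver (ρ ∣_ V) _ _ ?_
  rw [morphismRestrict_ι_assoc]

end Resolution
end KummerQuartic
end

open KummerQuartic in
theorem proposition2p4 {F : Type u} [Field F] (hF : (2 : F) ≠ 0) (l : F) (h0 : l ≠ 0) (h1 : l ≠ 1) :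
    -- the singular points of `K` are exactly the nodes
    (∀ x : quarticSurface l, x ∈ singularLocus (quarticSurface.structure l) ↔
      ∃ v ∈ nodes F, HasCoords (quartic l) x v) ∧
    -- each of the nodes lies on `K` and is an `A₁` singularity
    (∀ v ∈ nodes F, ∃ x : quarticSurface l, HasCoords (quartic l) x v ∧
      IsA1Singularity (quarticSurface.structure l) x) ∧
    -- `K` is birational over `F` to the quotient `K₀` of `E × E` by `-1` and to its minimal
    -- desingularization `Kt`
    (∀ (K₀ : Scheme.{u}) (s₀ : K₀ ⟶ Spec (.of F)) (π : square (legendre l) ⟶ K₀),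
      IsQuotientByInvolution (squareNeg (legendre l)) π →
      π ≫ s₀ = square.structure (legendre l) →
      Scheme.BirationalOver (quarticSurface.structure l) s₀ ∧
      ∀ (Kt : Scheme.{u}) (ρ : Kt ⟶ K₀), IsMinimalDesingularization ρ →
        Scheme.BirationalOver (quarticSurface.structure l) (ρ ≫ s₀)) := by
  refine ⟨mem_singularLocus_quarticSurface_iff hF h0 h1,
    fun v hv => exists_isA1Singularity_of_mem_nodes hF h0 h1 hv, fun K₀ s₀ π hπ hs => ?_⟩
  have h : Scheme.BirationalOver (quarticSurface.structure l) s₀ :=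
    (birationalOver_doublePlane hF h0 h1).trans (birationalOver_kummer l hF s₀ π hπ hs).symm
  exact ⟨h, fun Kt ρ hρ => h.trans (hρ.toIsDesingularization.birationalOver s₀).symm⟩
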